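/- **Setting.** Let $\mathcal C$ be a weakly abelian category (an additive category in which every morphism has a weak kernel and a weak cokernel, and is a weak kernel and a weak cokernel), and let $\mathsf T$ be an automorphism of $\mathcal C$, written $X\mapsto X^{+1}$. For $k\ge 0$ let $\bar\Delta_k$ be the linearly ordered set consisting of $\mathbb Z$ copies $\{0^{+z},\dots,k^{+z}\}$ ($z\in\mathbb Z$) of $\Delta_k=\{0,\dots,k\}$ put in a row, with shift $i^{+z}\mapsto i^{+(z+1)}$. A *periodic monotone map* $\bar\Delta_m\to\bar\Delta_n$ is a monotone map commuting with the shifts. The strip $\bar\Delta_k^\#$ is the poset of all pairs $\beta/\alpha$ with $\alpha\le\beta\le\alpha^{+1}$ in $\bar\Delta_k$, where $\beta/\alpha\le\delta/\gamma$ means $\alpha\le\gamma$ and $\beta\le\delta$; it carries the shift $(\beta/\alpha)^{+1}=\alpha^{+1}/\beta$. A periodic monotone map $p$ induces $p^\#:\beta/\alpha\mapsto p(\beta)/p(\alpha)$. Let $\dot\Delta_k=\{1,\dots,k\}$, embedded in $\bar\Delta_k^\#$ via $i\mapsto i/0$. A *$k$-pretriangle* is a diagram $X:\bar\Delta_k^\#\to\mathcal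 C$ with $X_{\alpha/\alpha}$ and $X_{\alpha^{+1}/\alpha}$ zero for all $\alpha$ and such that, whenever $\delta^{-1}\le\alpha\le\beta\le\gamma\le\delta\le\alpha^{+1}$, the quadrangle on $\gamma/\alpha,\ \delta/\alpha,\ \gamma/\beta,\ \delta/\beta$ is a weak square (in its diagonal sequence, the first morphism is a weak kernel of the second). These form a full subcategory $\mathcal C^+(\bar\Delta_k^\#)$ of the category of diagrams. A pretriangle is *split* if all its morphisms are split in the Freyd category of $\mathcal C$, i.e. factor there into a retraction followed by a coretraction. The *stable category* $\underline{\mathcal C^+(\bar\Delta_k^\#)}$ is the quotient of $\mathcal C^+(\bar\Delta_k^\#)$ identifying morphisms whose difference factors over a split pretriangle. The *outer shift* is $[X]^{+1}_{v}=X_{v^{+1}}$, the *inner shift* is $[X^{+1}]_{v}=(X_v)^{+1}$, for $v\in\bar\Delta_k^\#$; both pass to the stable category. *Folding* sends a $(2k+1)$-pretriangle $X$ to a $(k+1)$-pretriangle $X\mathfrak f_k$. Identify $\bar\Delta_{2k+1}$ with $\bar\Delta_k$ equipped with the doubled shift $\alpha\mapsto\alpha^{+2}$, and $\Delta_{k+1}$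 with $\{\rho\}\sqcup\Delta_k$, $\rho$ minimal. For $\alpha,\beta,\gamma,\delta\in\Delta_k$ with $\alpha\le\beta$, $\gamma\le\delta$, and with all unnamed morphisms $x$ taken from $X$, the diagram $Y=X\mathfrak f_k$ is given by $$Y_{\alpha/\rho}=X_{\alpha^{+1}/\alpha},\qquad Y_{\beta/\alpha}=X_{\beta^{+1}/\alpha^{+1}}\oplus X_{\alpha^{+2}/\beta},\qquad Y_{\rho^{+1}/\gamma}=X_{\gamma^{+2}/\gamma^{+1}},$$ the morphisms $Y_{\alpha/\rho}\to Y_{\beta/\rho}$, $Y_{\beta/\rho}\to Y_{\beta/\alpha}$, $Y_{\beta/\alpha}\to Y_{\delta/\gamma}$ (for $\beta/\alpha\le\delta/\gamma$), $Y_{\delta/\gamma}\to Y_{\rho^{+1}/\gamma}$ being $x$, $(x\ \,x)$, $\begin{pmatrix}x&0\\0&x\end{pmatrix}$, $\begin{pmatrix}x\\-x\end{pmatrix}$ respectively, and by the same formulas for all iterated outer shifts (inverse ones included) of $Y$ and $X$. This determines $Y$ up to unique isomorphism compatible with the direct sum decompositions, and it is functorial in $X$. A *Heller triangulation* on $(\mathcal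 C,\mathsf T)$ is a family $\theta=(\theta_k)_{k\ge 0}$ of isomorphisms of functors $\theta_k:[-]^{+1}\to[-^{+1}]$ on $\underline{\mathcal C^+(\bar\Delta_k^\#)}$ which is compatible with the functors $X\mapsto Xp^\#$ ("restriction along $p$", the composite diagram $v\mapsto X_{p^\#(v)}$) for all $l,k\ge0$ and all periodic monotone maps $p:\bar\Delta_l\to\bar\Delta_k$ (the image of $X\theta_k$ is $(Xp^\#)\theta_l$), and with folding for all $k\ge 0$ (folding $X\theta_{2k+1}$ gives $(X\mathfrak f_k)\theta_{k+1}$, where the inner shift of a folding of $X$ is regarded as a folding of $[X^{+1}]$). A pretriangle $X$ is *periodic* if $[X]^{+1}=[X^{+1}]$, and a morphism $f$ of periodic pretriangles is *periodic* if $[f]^{+1}=[f^{+1}]$; these form the category $\mathcal C^{+,\mathrm{per}}(\bar\Delta_k^\#)$. A *$k$-triangle* is a periodic $k$-pretriangle $X$ with $X\theta_k=1_{[X]^{+1}}$ in the stable category; the morphisms of $k$-triangles are the periodic morphisms, and the resulting category is $\mathcal C^{+,\theta=1}(\bar\Delta_k^\#)$. A *periodic folding* of a periodic $(2k+1)$-pretriangle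 $X$ is a periodic $(k+1)$-pretriangle $Y$ obtained from $X$ by folding, with direct sum decompositions and identifications chosen periodically, i.e. so that folding the identity $[X]^{+1}=[X^{+1}]$ yields the identity $[Y]^{+1}=[Y^{+1}]$. **Lemma.** Let $\theta$ be a Heller triangulation on $(\mathcal C,\mathsf T)$ and let $n,m\ge 1$. 1. If $X$ is an $n$-triangle and $p:\bar\Delta_m\to\bar\Delta_n$ is a periodic monotone map, then $Xp^\#$ is an $m$-triangle. 2. If $X$ is a $(2n+1)$-triangle, then it has a periodic folding, and every periodic folding of $X$ is an $(n+1)$-triangle. 3. The category $\mathcal C^{+,\theta=1}(\bar\Delta_n^\#)$ is a full additive subcategory of the additive category $\mathcal C^{+,\mathrm{per}}(\bar\Delta_n^\#)$, closed under direct summands: zero objects of $\mathcal C^{+,\mathrm{per}}(\bar\Delta_n^\#)$ are $n$-triangles, and a direct sum $X\oplus Y$ in $\mathcal C^{+,\mathrm{per}}(\bar\Delta_n^\#)$ is an $n$-triangle if and only if $X$ and $Y$ are $n$-triangles. 4. If $X\to Y$ is an isomorphism in $\mathcal C^{+,\mathrm{per}}(\bar\Delta_n^\#)$ and $X$ is an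 $n$-triangle, then $Y$ is an $n$-triangle. 5. If $f:X\to Y$ is a morphism in $\mathcal C^{+,\mathrm{per}}(\bar\Delta_n^\#)$ such that $f|_{\dot\Delta_n}$ is an isomorphism, then $f$ is an isomorphism. 6. If $X$ and $Y$ are $n$-triangles and $u:X|_{\dot\Delta_n}\to Y|_{\dot\Delta_n}$ is an isomorphism of diagrams, then there exists an isomorphism $\tilde u:X\to Y$ of $n$-triangles with $\tilde u|_{\dot\Delta_n}=u$. 7. Every periodic split $n$-pretriangle is an $n$-triangle. -/

import Mathlib

open CategoryTheory CategoryTheory.Limits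

universe v u

namespace Heller

noncomputable section

/-! ### Weakly abelian categories -/

section WeaklyAbelian

variable {C : Type u} [Category.{v} C] [Preadditive C]

/-- `i` is a weak kernel of `f`: the sequence `(T, K) → (T, X) → (T, Y)` is exact at `(T, X)` for
every object `T`. -/
def IsWeakKernel {K X Y : C} (i : K ⟶ X) (f : X ⟶ Y) : Prop :=
  i ≫ f = 0 ∧ ∀ ⦃T : C⦄ (t : T ⟶ X), t ≫ f = 0 → ∃ t' : T ⟶ K, t' ≫ i = t

/-- `p` is a weak cokernel of `f`. -/
def IsWeakCokernel {X Y Q : C} (p : Y ⟶ Q) (f : X ⟶ Y) : Prop :=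
  f ≫ p = 0 ∧ ∀ ⦃T : C⦄ (t : Y ⟶ T), f ≫ t = 0 → ∃ t' : Q ⟶ T, p ≫ t' = t

variable (C) in
/-- A weakly abelian category: an additive category in which every morphism has a weak kernel and
a weak cokernel, and is a weak kernel and a weak cokernel. -/
class WeaklyAbelian : Prop extends HasFiniteBiproducts C where
  exists_weakKernel : ∀ {X Y : C} (f : X ⟶ Y), ∃ (K : C) (i : K ⟶ X), IsWeakKernel i f
  exists_weakCokernel : ∀ {X Y : C} (f : X ⟶ Y), ∃ (Q : C) (p : Y ⟶ Q), IsWeakCokernel p f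
  isWeakKernel : ∀ {X Y : C} (f : X ⟶ Y), ∃ (Z : C) (g : Y ⟶ Z), IsWeakKernel f g
  isWeakCokernel : ∀ {X Y : C} (f : X ⟶ Y), ∃ (Z : C) (g : Z ⟶ X), IsWeakCokernel f g

instance [WeaklyAbelian C] : HasBinaryBiproducts C := hasBinaryBiproducts_of_finite_biproducts C

/-- The commutative quadrangle with edges `f : A ⟶ B`, `g : A ⟶ A'`, `h : B ⟶ B'`, `k : A' ⟶ B'`
is a weak square: its diagonal sequence `A ⟶ A' ⊞ B ⟶ B'`, with morphisms `(g, f)` and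
`(k, -h)`, is exact at the middle object, i.e. the first morphism is a weak kernel of the
second. -/
def IsWeakSquare [HasBinaryBiproducts C] {A B A' B' : C}
    (f : A ⟶ B) (g : A ⟶ A') (h : B ⟶ B') (k : A' ⟶ B') : Prop :=
  f ≫ h = g ≫ k ∧ IsWeakKernel (biprod.lift g f) (biprod.desc k (-h))

theorem isWeakSquare_iff [HasBinaryBiproducts C] {A B A' B' : C}
    (f : A ⟶ B) (g : A ⟶ A') (h : B ⟶ B') (k : A' ⟶ B') :
    IsWeakSquare f g h k ↔ f ≫ h = g ≫ k ∧
      ∀ ⦃T : C⦄ (b : T ⟶ B) (c : T ⟶ A'), b ≫ h = c ≫ k →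
        ∃ a : T ⟶ A, a ≫ f = b ∧ a ≫ g = c := by
  constructor
  · rintro ⟨h1, -, h3⟩
    refine ⟨h1, fun T b c hbc => ?_⟩
    obtain ⟨a, ha⟩ := h3 (biprod.lift c b) (by simp [hbc])
    refine ⟨a, ?_, ?_⟩
    · have := congrArg (· ≫ biprod.snd) ha
      simpa using this
    · have := congrArg (· ≫ biprod.fst) ha
      simpa using this
  · rintro ⟨h1, h2⟩
    refine ⟨h1, by simp [h1], fun T t ht => ?_⟩
    obtain ⟨a, ha, ha'⟩ := h2 (t ≫ biprod.snd) (t ≫ biprod.fst) (by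
      rw [biprod.desc_eq, Preadditive.comp_add] at ht
      simp only [Preadditive.comp_neg, ← Category.assoc] at ht
      exact (sub_eq_zero.1 (by rw [sub_eq_add_neg]; exact ht)).symm)
    exact ⟨a, by ext <;> simp [ha, ha']⟩

theorem IsWeakSquare.transpose [HasBinaryBiproducts C] {A B A' B' : C}
    {f : A ⟶ B} {g : A ⟶ A'} {h : B ⟶ B'} {k : A' ⟶ B'} (H : IsWeakSquare f g h k) :
    IsWeakSquare g f k h := by
  rw [isWeakSquare_iff] at H ⊢
  refine ⟨H.1.symm, fun T b c hbc => ?_⟩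
  obtain ⟨a, h1, h2⟩ := H.2 c b hbc.symm
  exact ⟨a, h2, h1⟩

end WeaklyAbelian

/-! ### The Freyd category and split morphisms -/

section Freyd

variable (C : Type u) [Category.{v} C] [Preadditive C]

/-- Two morphisms of the arrow category of `C` are identified if their difference factors over a
zero arrow. -/
def freydRel : HomRel (Arrow C) := fun X Y f g =>
  ∃ (Z : Arrow C) (_ : Z.hom = 0) (a : X ⟶ Z) (b : Z ⟶ Y),
    f.left - g.left = a.left ≫ b.left ∧ f.right - g.right = a.right ≫ b.right

/-- The Freyd category of `C`: the category of arrows of `C` modulo the full subcategory of zero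
arrows. -/
abbrev Freyd := CategoryTheory.Quotient (freydRel C)

/-- The embedding of `C` into its Freyd category, sending `X` to the identity arrow of `X`. -/
abbrev toFreyd : C ⥤ Freyd C where
  obj X := (Quotient.functor (freydRel C)).obj (Arrow.mk (𝟙 X))
  map f := (Quotient.functor (freydRel C)).map (Arrow.homMk f f (by simp))
  map_id X := (Quotient.functor (freydRel C)).map_id (Arrow.mk (𝟙 X))
  map_comp f g := (Quotient.functor (freydRel C)).map_comp
    (Arrow.homMk f f (by simp) : Arrow.mk (𝟙 _) ⟶ Arrow.mk (𝟙 _))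
    (Arrow.homMk g g (by simp) : Arrow.mk (𝟙 _) ⟶ Arrow.mk (𝟙 _))

variable {C}

/-- A morphism of `C` is split in the Freyd category: there, it factors into a retraction followed
by a coretraction. -/
def IsSplitInFreyd {X Y : C} (f : X ⟶ Y) : Prop :=
  ∃ (M : Freyd C) (p : (toFreyd C).obj X ⟶ M) (i : M ⟶ (toFreyd C).obj Y),
    IsSplitEpi p ∧ IsSplitMono i ∧ p ≫ i = (toFreyd C).map f

theorem freydRel_comp_hom {X Y : Arrow C} {f g : X ⟶ Y} (h : freydRel C f g) :
    f.left ≫ Y.hom = g.left ≫ Y.hom := by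
  obtain ⟨Z, hZ, a, b, h1, -⟩ := h
  rw [← sub_eq_zero, ← Preadditive.sub_comp, h1, Category.assoc, Arrow.w b, hZ]
  simp

theorem freyd_functor_map_eq {X Y : Arrow C} {f g : X ⟶ Y}
    (h : (Quotient.functor (freydRel C)).map f = (Quotient.functor (freydRel C)).map g) :
    f.left ≫ Y.hom = g.left ≫ Y.hom := by
  have h' : Relation.EqvGen (@HomRel.CompClosure _ _ (freydRel C) X Y) f g :=
    Quot.eqvGen_exact (r := @HomRel.CompClosure _ _ (freydRel C) X Y) h
  clear h
  induction h' with
  | rel f g h =>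
    obtain ⟨a, b, l, m₁, m₂, r, h⟩ := h
    have := freydRel_comp_hom h
    simp only [Arrow.comp_left, Category.assoc]
    rw [Arrow.w r, ← Category.assoc m₁.left, ← Category.assoc m₂.left, this]
  | refl => rfl
  | symm _ _ _ ih => exact ih.symm
  | trans _ _ _ _ _ ih1 ih2 => exact ih1.trans ih2

/-- A morphism is split in the Freyd category if and only if it is von Neumann regular. -/
theorem isSplitInFreyd_iff {X Y : C} (f : X ⟶ Y) :
    IsSplitInFreyd f ↔ ∃ g : Y ⟶ X, f ≫ g ≫ f = f := by
  constructor
  · rintro ⟨M, p, i, ⟨⟨s⟩⟩, ⟨⟨r⟩⟩, hpi⟩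
    obtain ⟨φ, hφ⟩ := (Quotient.functor (freydRel C)).map_surjective (r.retraction ≫ s.section_)
    have key : (toFreyd C).map f ≫ (r.retraction ≫ s.section_) ≫ (toFreyd C).map f =
        (toFreyd C).map f := by
      rw [← hpi]
      have h1 := r.id
      have h2 := s.id
      simp only [Category.assoc]
      rw [reassoc_of% h1, reassoc_of% h2]
    rw [← hφ] at key
    have h3 : (Quotient.functor (freydRel C)).map
        ((Arrow.homMk f f (by simp) : Arrow.mk (𝟙 X) ⟶ Arrow.mk (𝟙 Y)) ≫ φ ≫
          (Arrow.homMk f f (by simp) : Arrow.mk (𝟙 X) ⟶ Arrow.mk (𝟙 Y))) =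
        (Quotient.functor (freydRel C)).map (Arrow.homMk f f (by simp)) := by
      rw [Functor.map_comp, Functor.map_comp]
      exact key
    have h4 := freyd_functor_map_eq h3
    refine ⟨φ.left, ?_⟩
    simpa using h4
  · rintro ⟨g, hg⟩
    have hg' : (f ≫ g) ≫ f = f := by simpa using hg
    have rel : freydRel C (X := Arrow.mk f) (Y := Arrow.mk f)
        (Arrow.homMk (f ≫ g) (g ≫ f) (by simp)) (𝟙 _) := by
      refine ⟨Arrow.mk (0 : X ⟶ Y), rfl,
        Arrow.homMk (𝟙 X) (g ≫ f - 𝟙 Y) ?_, Arrow.homMk (f ≫ g - 𝟙 X) (𝟙 Y) ?_, ?_, ?_⟩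
      · simp [hg]
      · simp [hg]
      · simp
      · simp
    let Q := Quotient.functor (freydRel C)
    refine ⟨Q.obj (Arrow.mk f),
      Q.map (Arrow.homMk (𝟙 X) f (by simp) : Arrow.mk (𝟙 X) ⟶ Arrow.mk f),
      Q.map (Arrow.homMk f (𝟙 Y) (by simp) : Arrow.mk f ⟶ Arrow.mk (𝟙 Y)), ⟨⟨?_⟩⟩, ⟨⟨?_⟩⟩, ?_⟩
    · refine ⟨Q.map (Arrow.homMk (f ≫ g) g (by simp) : Arrow.mk f ⟶ Arrow.mk (𝟙 X)), ?_⟩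
      rw [← Q.map_comp]
      refine Eq.trans ?_ ((CategoryTheory.Quotient.sound _ rel).trans (Q.map_id _))
      congr 1
      ext <;> simp
    · refine ⟨Q.map (Arrow.homMk g (g ≫ f) (by simp) : Arrow.mk (𝟙 Y) ⟶ Arrow.mk f), ?_⟩
      rw [← Q.map_comp]
      refine Eq.trans ?_ ((CategoryTheory.Quotient.sound _ rel).trans (Q.map_id _))
      congr 1
      ext <;> simp
    · rw [← Q.map_comp]
      change _ = Q.map _
      congr 1
      ext <;> simp

end Freyd

/-! ### Automorphisms of a category -/

/-- An automorphism of a category: an endofunctor with a strict two-sided inverse. -/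
structure CatAut (C : Type u) [Category.{v} C] where
  functor : C ⥤ C
  inverse : C ⥤ C
  functor_inverse : functor ⋙ inverse = 𝟭 C
  inverse_functor : inverse ⋙ functor = 𝟭 C

section CatAut

variable {C : Type u} [Category.{v} C] (T : CatAut C)

instance : T.functor.IsEquivalence :=
  (CategoryTheory.Equivalence.mk T.functor T.inverse (eqToIso T.functor_inverse.symm)
    (eqToIso T.inverse_functor)).isEquivalence_functor

variable [Preadditive C]

instance [HasFiniteBiproducts C] : T.functor.Additive :=
  T.functor.additive_of_preserves_binary_products

theorem IsWeakSquare.map [WeaklyAbelian C] {A B A' B' : C}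
    {f : A ⟶ B} {g : A ⟶ A'} {h : B ⟶ B'} {k : A' ⟶ B'} (H : IsWeakSquare f g h k) :
    IsWeakSquare (T.functor.map f) (T.functor.map g) (T.functor.map h) (T.functor.map k) := by
  rw [isWeakSquare_iff] at H ⊢
  refine ⟨by rw [← T.functor.map_comp, ← T.functor.map_comp, H.1], fun S b c hbc => ?_⟩
  let e := T.functor.objObjPreimageIso S
  obtain ⟨b', hb'⟩ := T.functor.map_surjective (e.hom ≫ b)
  obtain ⟨c', hc'⟩ := T.functor.map_surjective (e.hom ≫ c)
  obtain ⟨a, h1, h2⟩ := H.2 b' c' (by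
    apply T.functor.map_injective
    rw [T.functor.map_comp, T.functor.map_comp, hb', hc', Category.assoc, Category.assoc, hbc])
  refine ⟨e.inv ≫ T.functor.map a, ?_, ?_⟩
  · rw [Category.assoc, ← T.functor.map_comp, h1, hb', e.inv_hom_id_assoc]
  · rw [Category.assoc, ← T.functor.map_comp, h2, hc', e.inv_hom_id_assoc]

end CatAut

/-! ### The periodic linearly ordered sets and their strips

The periodic repetition of `{0, …, n}` is identified with `ℤ`, the element `α` of the `z`-th copy
of `{0, …, n}` being identified with `α + (n + 1) * z`. The order is that of `ℤ`, and the shift is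
`i ↦ i + (n + 1)`. -/

/-- A morphism of periodic linearly ordered sets from the periodic repetition of `{0, …, m}` to
that of `{0, …, n}`: a monotone map compatible with the shifts. -/
structure PeriodicMap (m n : ℕ) where
  toFun : ℤ → ℤ
  monotone : Monotone toFun
  map_shift : ∀ i, toFun (i + (m + 1)) = toFun i + (n + 1)

/-- The strip of the periodic repetition of `{0, …, n}`: the pairs `β/α` with
`α ≤ β ≤ α + (n + 1)`, where `src` is `α` and `tgt` is `β`. -/
@[ext]
structure Strip (n : ℕ) where
  src : ℤ
  tgt : ℤ
  le : src ≤ tgt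
  le_shift : tgt ≤ src + (n + 1)

namespace Strip

variable {n m : ℕ}

instance : PartialOrder (Strip n) where
  le v w := v.src ≤ w.src ∧ v.tgt ≤ w.tgt
  le_refl _ := ⟨le_refl _, le_refl _⟩
  le_trans _ _ _ h h' := ⟨h.1.trans h'.1, h.2.trans h'.2⟩
  le_antisymm _ _ h h' := Strip.ext (le_antisymm h.1 h'.1) (le_antisymm h.2 h'.2)

theorem le_iff {v w : Strip n} : v ≤ w ↔ v.src ≤ w.src ∧ v.tgt ≤ w.tgt := Iff.rfl

/-- The shift automorphism `β/α ↦ α⁺¹/β` of the strip. -/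
def shift (n : ℕ) : Strip n ≃o Strip n where
  toFun v := ⟨v.tgt, v.src + (n + 1), v.le_shift, by have := v.le; omega⟩
  invFun v := ⟨v.tgt - (n + 1), v.src, by have := v.le_shift; omega, by have := v.le; omega⟩
  left_inv v := by ext <;> simp
  right_inv v := by ext <;> simp
  map_rel_iff' := by
    intro v w
    simp only [le_iff, Equiv.coe_fn_mk]
    omega

/-- The `k`-th power of the shift, `k` an integer. -/
def iter (k : ℤ) (v : Strip n) : Strip n := (shift n ^ k) v

theorem iter_mono (k : ℤ) {v w : Strip n} (h : v ≤ w) : v.iter k ≤ w.iter k :=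
  (shift n ^ k).monotone h

theorem iter_succ (k : ℤ) (v : Strip n) : v.iter (k + 1) = (shift n v).iter k := by
  unfold iter
  rw [zpow_add, zpow_one]
  rfl

theorem shift_iter (k : ℤ) (v : Strip n) : shift n (v.iter k) = v.iter (k + 1) := by
  unfold iter
  rw [add_comm, zpow_add, zpow_one]
  rfl

theorem iter_le_iter_succ (k : ℤ) {v w : Strip n} (h : v ≤ shift n w) :
    v.iter k ≤ w.iter (k + 1) := by
  rw [iter_succ]
  exact iter_mono k h

/-- The shift as a functor. -/
abbrev shiftFunctor (n : ℕ) : Strip n ⥤ Strip n := (shift n).monotone.functor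

/-- The monotone map of strips `β/α ↦ p(β)/p(α)` induced by a periodic monotone map `p`. -/
def map (p : PeriodicMap m n) (v : Strip m) : Strip n where
  src := p.toFun v.src
  tgt := p.toFun v.tgt
  le := p.monotone v.le
  le_shift := by
    rw [← p.map_shift]
    exact p.monotone v.le_shift

theorem map_monotone (p : PeriodicMap m n) : Monotone (map p) :=
  fun _ _ h => ⟨p.monotone h.1, p.monotone h.2⟩

/-- `map p` as a functor. -/
abbrev mapFunctor (p : PeriodicMap m n) : Strip m ⥤ Strip n := (map_monotone p).functor

theorem shift_map (p : PeriodicMap m n) (v : Strip m) :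
    shift n (map p v) = map p (shift m v) := by
  ext
  · rfl
  · exact (p.map_shift v.src).symm

theorem mapFunctor_comp_shiftFunctor (p : PeriodicMap m n) :
    mapFunctor p ⋙ shiftFunctor n = shiftFunctor m ⋙ mapFunctor p :=
  CategoryTheory.Functor.ext (fun v => shift_map p v) (fun _ _ _ => Subsingleton.elim _ _)

end Strip

/-- The linearly ordered set `{1, …, n}`. -/
abbrev DotDelta (n : ℕ) := Set.Icc (1 : ℤ) n

/-- The embedding `α ↦ α/0` of `{1, …, n}` into the strip. -/
def dotEmb (n : ℕ) : DotDelta n ⥤ Strip n :=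
  Monotone.functor (f := fun α : DotDelta n =>
    (⟨0, α.1, by have := α.2.1; omega, by have := α.2.2; omega⟩ : Strip n))
    (fun _ _ h => ⟨le_refl _, h⟩)

/-! ### Pretriangles -/

section Pretriangle

variable {C : Type u} [Category.{v} C]

/-- The morphism of a diagram `X` on a strip belonging to `v ≤ w`. -/
abbrev arr {n : ℕ} (X : Strip n ⥤ C) {v w : Strip n} (h : v ≤ w) : X.obj v ⟶ X.obj w :=
  X.map (homOfLE h)

theorem arr_comp {n : ℕ} (X : Strip n ⥤ C) {v w z : Strip n} (h : v ≤ w) (h' : w ≤ z) :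
    arr X h ≫ arr X h' = arr X (h.trans h') := by
  rw [← X.map_comp]
  rfl

variable [Preadditive C] [WeaklyAbelian C]

/-- An `n`-pretriangle: a diagram on the strip with zero objects at `α/α` and `α⁺¹/α` such that for
`δ⁻¹ ≤ α ≤ β ≤ γ ≤ δ ≤ α⁺¹` the quadrangle on `γ/α`, `δ/α`, `γ/β`, `δ/β` is a weak square. -/
structure IsPretriangle {n : ℕ} (X : Strip n ⥤ C) : Prop where
  isZero_diag : ∀ α : ℤ, IsZero (X.obj ⟨α, α, le_refl _, by omega⟩)
  isZero_shift : ∀ α : ℤ, IsZero (X.obj ⟨α, α + (n + 1), by omega, le_refl _⟩)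
  isWeakSquare : ∀ (α β γ δ : ℤ) (_ : δ - (n + 1) ≤ α) (_ : α ≤ β) (_ : β ≤ γ) (_ : γ ≤ δ)
    (_ : δ ≤ α + (n + 1)),
    IsWeakSquare
      (arr X (v := ⟨α, γ, by omega, by omega⟩) (w := ⟨α, δ, by omega, by omega⟩)
        ⟨by dsimp; omega, by dsimp; omega⟩)
      (arr X (v := ⟨α, γ, by omega, by omega⟩) (w := ⟨β, γ, by omega, by omega⟩)
        ⟨by dsimp; omega, by dsimp; omega⟩)
      (arr X (v := ⟨α, δ, by omega, by omega⟩) (w := ⟨β, δ, by omega, by omega⟩)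
        ⟨by dsimp; omega, by dsimp; omega⟩)
      (arr X (v := ⟨β, γ, by omega, by omega⟩) (w := ⟨β, δ, by omega, by omega⟩)
        ⟨by dsimp; omega, by dsimp; omega⟩)

/-- A diagram on the strip all of whose morphisms are split in the Freyd category. -/
def IsSplitDiagram {n : ℕ} (X : Strip n ⥤ C) : Prop :=
  ∀ ⦃v w : Strip n⦄ (h : v ≤ w), IsSplitInFreyd (arr X h)

variable (C) in
/-- The category of `n`-pretriangles, a full subcategory of the category of diagrams. -/
abbrev Pretriangle (n : ℕ) :=
  ObjectProperty.FullSubcategory (fun X : Strip n ⥤ C => IsPretriangle X)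

variable (C) in
/-- Two morphisms of pretriangles are identified in the stable category if their difference factors
over a pretriangle consisting of split morphisms. -/
def stableRel (n : ℕ) : HomRel (Pretriangle C n) := fun X Y f g =>
  ∃ (Z : Pretriangle C n) (_ : IsSplitDiagram Z.obj) (a : X ⟶ Z) (b : Z ⟶ Y), f - g = a ≫ b

variable (C) in
/-- The stable category of `n`-pretriangles. -/
abbrev Stable (n : ℕ) := CategoryTheory.Quotient (stableRel C n)

variable (C) in
/-- The residue class functor to the stable category. -/
abbrev toStable (n : ℕ) : Pretriangle C n ⥤ Stable C n := Quotient.functor (stableRel C n)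

theorem IsPretriangle.outer {n : ℕ} {X : Strip n ⥤ C} (hX : IsPretriangle X) :
    IsPretriangle (Strip.shiftFunctor n ⋙ X) where
  isZero_diag α := hX.isZero_shift α
  isZero_shift α := hX.isZero_diag (α + (n + 1))
  isWeakSquare α β γ δ h1 h2 h3 h4 h5 :=
    (hX.isWeakSquare γ δ (α + (n + 1)) (β + (n + 1)) (by omega) (by omega) (by omega) (by omega)
      (by omega)).transpose

theorem IsPretriangle.inner (T : CatAut C) {n : ℕ} {X : Strip n ⥤ C} (hX : IsPretriangle X) :
    IsPretriangle (X ⋙ T.functor) where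
  isZero_diag α := T.functor.map_isZero (hX.isZero_diag α)
  isZero_shift α := T.functor.map_isZero (hX.isZero_shift α)
  isWeakSquare α β γ δ h1 h2 h3 h4 h5 := (hX.isWeakSquare α β γ δ h1 h2 h3 h4 h5).map T

theorem IsPretriangle.restrict {m n : ℕ} (p : PeriodicMap m n) {X : Strip n ⥤ C}
    (hX : IsPretriangle X) : IsPretriangle (Strip.mapFunctor p ⋙ X) where
  isZero_diag α := hX.isZero_diag (p.toFun α)
  isZero_shift α := by
    refine (hX.isZero_shift (p.toFun α)).of_iso (X.mapIso (eqToIso ?_))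
    ext
    · rfl
    · exact p.map_shift α
  isWeakSquare α β γ δ h1 h2 h3 h4 h5 := by
    have e := p.map_shift α
    have h := p.monotone h5
    exact hX.isWeakSquare (p.toFun α) (p.toFun β) (p.toFun γ) (p.toFun δ) (by omega)
      (p.monotone h2) (p.monotone h3) (p.monotone h4) (by omega)

variable (C) in
/-- The outer shift `[X]⁺¹`, obtained by shifting the diagram. -/
def outer (n : ℕ) : Pretriangle C n ⥤ Pretriangle C n :=
  ObjectProperty.lift _
    (ObjectProperty.ι _ ⋙ (Functor.whiskeringLeft _ _ C).obj (Strip.shiftFunctor n))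
    (fun X => X.property.outer)

/-- The inner shift `[X⁺¹]`, obtained by applying the automorphism entrywise. -/
def inner (T : CatAut C) (n : ℕ) : Pretriangle C n ⥤ Pretriangle C n :=
  ObjectProperty.lift _
    (ObjectProperty.ι _ ⋙ (Functor.whiskeringRight (Strip n) _ _).obj T.functor)
    (fun X => X.property.inner T)

variable (C) in
/-- The restriction functor along a periodic monotone map. -/
def restrict {m n : ℕ} (p : PeriodicMap m n) : Pretriangle C n ⥤ Pretriangle C m :=
  ObjectProperty.lift _
    (ObjectProperty.ι _ ⋙ (Functor.whiskeringLeft _ _ C).obj (Strip.mapFunctor p))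
    (fun X => X.property.restrict p)

/-! The three functors on the stable categories. -/

theorem IsSplitDiagram.inner (T : CatAut C) {n : ℕ} {X : Strip n ⥤ C} (hX : IsSplitDiagram X) :
    IsSplitDiagram (X ⋙ T.functor) := by
  intro v w h
  obtain ⟨g, hg⟩ := (isSplitInFreyd_iff _).1 (hX h)
  refine (isSplitInFreyd_iff _).2 ⟨T.functor.map g, ?_⟩
  change T.functor.map _ ≫ _ ≫ T.functor.map _ = T.functor.map _
  rw [← T.functor.map_comp, ← T.functor.map_comp, hg]

instance (n : ℕ) : (outer C n).Additive where
  map_add := rfl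

instance (T : CatAut C) (n : ℕ) : (inner T n).Additive where
  map_add := by
    intro X Y f g
    ext v
    exact T.functor.map_add

instance {m n : ℕ} (p : PeriodicMap m n) : (restrict C p).Additive where
  map_add := rfl

/-- An additive functor between categories of pretriangles which preserves diagrams consisting of
split morphisms induces a functor on the stable categories. -/
abbrev stableLift {m n : ℕ} (F : Pretriangle C n ⥤ Pretriangle C m) [F.Additive]
    (hF : ∀ Z : Pretriangle C n, IsSplitDiagram Z.obj → IsSplitDiagram (F.obj Z).obj) :
    Stable C n ⥤ Stable C m :=
  CategoryTheory.Quotient.lift (stableRel C n) (F ⋙ toStable C m) (by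
    rintro X Y f g ⟨Z, hZ, a, b, hab⟩
    refine CategoryTheory.Quotient.sound _ ⟨F.obj Z, hF Z hZ, F.map a, F.map b, ?_⟩
    rw [← F.map_sub, hab, F.map_comp])

variable (C) in
/-- The outer shift on the stable category. -/
abbrev stableOuter (n : ℕ) : Stable C n ⥤ Stable C n :=
  stableLift (outer C n) (fun _ hZ _ _ h => hZ ((Strip.shift n).monotone h))

/-- The inner shift on the stable category. -/
abbrev stableInner (T : CatAut C) (n : ℕ) : Stable C n ⥤ Stable C n :=
  stableLift (inner T n) (fun _ hZ => hZ.inner T)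

variable (C) in
/-- Restriction along a periodic monotone map on the stable categories. -/
abbrev stableRestrict {m n : ℕ} (p : PeriodicMap m n) : Stable C n ⥤ Stable C m :=
  stableLift (restrict C p) (fun _ hZ _ _ h => hZ (Strip.map_monotone p h))

theorem restrict_outer {m n : ℕ} (p : PeriodicMap m n) (X : Pretriangle C n) :
    (restrict C p).obj ((outer C n).obj X) = (outer C m).obj ((restrict C p).obj X) :=
  ObjectProperty.FullSubcategory.ext
    (congrArg (fun q => q ⋙ X.obj) (Strip.mapFunctor_comp_shiftFunctor p))

theorem restrict_inner (T : CatAut C) {m n : ℕ} (p : PeriodicMap m n) (X : Pretriangle C n) :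
    (restrict C p).obj ((inner T n).obj X) = (inner T m).obj ((restrict C p).obj X) := rfl

end Pretriangle

/-! ### Folding

Let `0 ≤ n`. The periodic repetition of `{0, …, n}` with the doubled period `2 * (n + 1)` is the
periodic repetition of `{0, …, 2n + 1}`; with both identified with `ℤ` as above, this
identification is the identity of `ℤ`. The linearly ordered set `{ρ} ⊔ {0, …, n}` obtained by adding
an initial element `ρ` is identified with `{0, …, n + 1}` via `ρ ↦ 0` and `α ↦ α + 1`. Exponents
`⁺¹`, `⁺²` in the indices of a diagram `X` on `Strip (2 * n + 1)` below refer to the period `n + 1`,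
whereas the shift of `Strip (2 * n + 1)` belongs to the period `2 * (n + 1)`. -/

namespace Fold

variable {n : ℕ}

/-- `α/ρ` -/
def rho (α : Fin (n + 1)) : Strip (n + 1) where
  src := 0
  tgt := (α : ℤ) + 1
  le := by omega
  le_shift := by push_cast; omega

/-- `β/α` for `α ≤ β` in `{0, …, n}` -/
def pair (α β : Fin (n + 1)) (h : α ≤ β) : Strip (n + 1) where
  src := (α : ℤ) + 1
  tgt := (β : ℤ) + 1
  le := by have : (α : ℕ) ≤ β := h; omega
  le_shift := by push_cast; omega

/-- `α⁺¹/α` -/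
def loop (α : Fin (n + 1)) : Strip (2 * n + 1) where
  src := (α : ℤ)
  tgt := (α : ℤ) + (n + 1)
  le := by omega
  le_shift := by push_cast; omega

/-- `β⁺¹/α⁺¹` -/
def left (α β : Fin (n + 1)) (h : α ≤ β) : Strip (2 * n + 1) where
  src := (α : ℤ) + (n + 1)
  tgt := (β : ℤ) + (n + 1)
  le := by have : (α : ℕ) ≤ β := h; omega
  le_shift := by push_cast; omega

/-- `α⁺²/β` -/
def right (α β : Fin (n + 1)) (h : α ≤ β) : Strip (2 * n + 1) where
  src := (β : ℤ)
  tgt := (α : ℤ) + 2 * (n + 1)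
  le := by omega
  le_shift := by have : (α : ℕ) ≤ β := h; push_cast; omega

theorem rho_le_rho {α β : Fin (n + 1)} (h : α ≤ β) : rho α ≤ rho β :=
  ⟨le_refl _, by have : (α : ℕ) ≤ β := h; dsimp [rho]; omega⟩

theorem loop_le_loop {α β : Fin (n + 1)} (h : α ≤ β) : loop α ≤ loop β := by
  have : (α : ℕ) ≤ β := h
  constructor <;> dsimp [loop] <;> omega

theorem rho_le_pair (α β : Fin (n + 1)) (h : α ≤ β) : rho β ≤ pair α β h := by
  constructor <;> dsimp [rho, pair] <;> omega

theorem loop_le_left (α β : Fin (n + 1)) (h : α ≤ β) : loop β ≤ left α β h := by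
  constructor <;> dsimp [loop, left] <;> omega

theorem loop_le_right (α β : Fin (n + 1)) (h : α ≤ β) : loop β ≤ right α β h := by
  constructor <;> dsimp [loop, right] <;> omega

theorem pair_le_pair {α β γ δ : Fin (n + 1)} (h : α ≤ β) (h' : γ ≤ δ) (h₁ : α ≤ γ) (h₂ : β ≤ δ) :
    pair α β h ≤ pair γ δ h' := by
  have : (α : ℕ) ≤ γ := h₁
  have : (β : ℕ) ≤ δ := h₂
  constructor <;> dsimp [pair] <;> omega

theorem left_le_left {α β γ δ : Fin (n + 1)} (h : α ≤ β) (h' : γ ≤ δ) (h₁ : α ≤ γ) (h₂ : β ≤ δ) :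
    left α β h ≤ left γ δ h' := by
  have : (α : ℕ) ≤ γ := h₁
  have : (β : ℕ) ≤ δ := h₂
  constructor <;> dsimp [left] <;> omega

theorem right_le_right {α β γ δ : Fin (n + 1)} (h : α ≤ β) (h' : γ ≤ δ) (h₁ : α ≤ γ)
    (h₂ : β ≤ δ) : right α β h ≤ right γ δ h' := by
  have : (α : ℕ) ≤ γ := h₁
  have : (β : ℕ) ≤ δ := h₂
  constructor <;> dsimp [right] <;> omega

theorem pair_le_shift_rho (γ δ : Fin (n + 1)) (h : γ ≤ δ) :
    pair γ δ h ≤ Strip.shift (n + 1) (rho γ) := by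
  constructor <;> dsimp [rho, pair, Strip.shift] <;> omega

theorem left_le_shift_loop (γ δ : Fin (n + 1)) (h : γ ≤ δ) :
    left γ δ h ≤ Strip.shift (2 * n + 1) (loop γ) := by
  constructor <;> dsimp [loop, left, Strip.shift] <;> omega

theorem right_le_shift_loop (γ δ : Fin (n + 1)) (h : γ ≤ δ) :
    right γ δ h ≤ Strip.shift (2 * n + 1) (loop γ) := by
  constructor <;> dsimp [loop, right, Strip.shift] <;> omega

end Fold

section Folding

variable {C : Type u} [Category.{v} C] [Preadditive C]

/-- `p` and `q` are the projections of a direct sum. -/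
def IsDirectSum {Z A B : C} (p : Z ⟶ A) (q : Z ⟶ B) : Prop :=
  ∃ (i : A ⟶ Z) (j : B ⟶ Z), i ≫ p = 𝟙 A ∧ i ≫ q = 0 ∧ j ≫ p = 0 ∧ j ≫ q = 𝟙 B ∧
    p ≫ i + q ≫ j = 𝟙 Z

/-- The data exhibiting a diagram `Y` on `Strip (n + 1)` as the diagram obtained from the diagram
`X` on `Strip (2 * n + 1)` by folding. Up to identification along the isomorphisms `single` and the
direct sum projections `fst`, `snd`, this says that (for `k = 0`)
* `Y` at `α/ρ ⟶ β/ρ` is `X` at `α⁺¹/α ⟶ β⁺¹/β`,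
* `Y` at `β/ρ ⟶ β/α` is `(x, x)` from `X` at `β⁺¹/β` to the direct sum of `X` at `β⁺¹/α⁺¹` and
  `X` at `α⁺²/β`,
* `Y` at `β/α ⟶ δ/γ` is the diagonal matrix with entries `x`,
* `Y` at `δ/γ ⟶ ρ⁺¹/γ` is `(x, -x)` from the direct sum of `X` at `δ⁺¹/γ⁺¹` and `X` at `γ⁺²/δ` to
  `X` at `γ⁺²/γ⁺¹`,
and that the same holds for the `k`-fold outer shifts of `Y` and `X`, for every integer `k`.
As every morphism of the strip is a composite of morphisms of these four types and their shifts, a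
folding of `X` is determined up to unique isomorphism. -/
structure Folding {n : ℕ} (X : Strip (2 * n + 1) ⥤ C) (Y : Strip (n + 1) ⥤ C) where
  single : ∀ (k : ℤ) (α : Fin (n + 1)),
    Y.obj ((Fold.rho α).iter k) ≅ X.obj ((Fold.loop α).iter k)
  fst : ∀ (k : ℤ) (α β : Fin (n + 1)) (h : α ≤ β),
    Y.obj ((Fold.pair α β h).iter k) ⟶ X.obj ((Fold.left α β h).iter k)
  snd : ∀ (k : ℤ) (α β : Fin (n + 1)) (h : α ≤ β),
    Y.obj ((Fold.pair α β h).iter k) ⟶ X.obj ((Fold.right α β h).iter k)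
  isDirectSum : ∀ (k : ℤ) (α β : Fin (n + 1)) (h : α ≤ β), IsDirectSum (fst k α β h) (snd k α β h)
  rho_rho : ∀ (k : ℤ) (α β : Fin (n + 1)) (h : α ≤ β),
    arr Y (Strip.iter_mono k (Fold.rho_le_rho h)) ≫ (single k β).hom =
      (single k α).hom ≫ arr X (Strip.iter_mono k (Fold.loop_le_loop h))
  rho_pair_fst : ∀ (k : ℤ) (α β : Fin (n + 1)) (h : α ≤ β),
    arr Y (Strip.iter_mono k (Fold.rho_le_pair α β h)) ≫ fst k α β h =
      (single k β).hom ≫ arr X (Strip.iter_mono k (Fold.loop_le_left α β h))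
  rho_pair_snd : ∀ (k : ℤ) (α β : Fin (n + 1)) (h : α ≤ β),
    arr Y (Strip.iter_mono k (Fold.rho_le_pair α β h)) ≫ snd k α β h =
      (single k β).hom ≫ arr X (Strip.iter_mono k (Fold.loop_le_right α β h))
  pair_pair_fst : ∀ (k : ℤ) (α β γ δ : Fin (n + 1)) (h : α ≤ β) (h' : γ ≤ δ) (h₁ : α ≤ γ)
    (h₂ : β ≤ δ),
    arr Y (Strip.iter_mono k (Fold.pair_le_pair h h' h₁ h₂)) ≫ fst k γ δ h' =
      fst k α β h ≫ arr X (Strip.iter_mono k (Fold.left_le_left h h' h₁ h₂))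
  pair_pair_snd : ∀ (k : ℤ) (α β γ δ : Fin (n + 1)) (h : α ≤ β) (h' : γ ≤ δ) (h₁ : α ≤ γ)
    (h₂ : β ≤ δ),
    arr Y (Strip.iter_mono k (Fold.pair_le_pair h h' h₁ h₂)) ≫ snd k γ δ h' =
      snd k α β h ≫ arr X (Strip.iter_mono k (Fold.right_le_right h h' h₁ h₂))
  pair_rho : ∀ (k : ℤ) (γ δ : Fin (n + 1)) (h : γ ≤ δ),
    arr Y (Strip.iter_le_iter_succ k (Fold.pair_le_shift_rho γ δ h)) ≫ (single (k + 1) γ).hom =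
      fst k γ δ h ≫ arr X (Strip.iter_le_iter_succ k (Fold.left_le_shift_loop γ δ h)) -
        snd k γ δ h ≫ arr X (Strip.iter_le_iter_succ k (Fold.right_le_shift_loop γ δ h))

/-- `s` is the morphism obtained from `t` by folding. -/
structure IsFoldHom {n : ℕ} {X X' : Strip (2 * n + 1) ⥤ C} {Y Y' : Strip (n + 1) ⥤ C}
    (F : Folding X Y) (F' : Folding X' Y') (t : X ⟶ X') (s : Y ⟶ Y') : Prop where
  single : ∀ (k : ℤ) (α : Fin (n + 1)),
    s.app _ ≫ (F'.single k α).hom = (F.single k α).hom ≫ t.app _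
  fst : ∀ (k : ℤ) (α β : Fin (n + 1)) (h : α ≤ β),
    s.app _ ≫ F'.fst k α β h = F.fst k α β h ≫ t.app _
  snd : ∀ (k : ℤ) (α β : Fin (n + 1)) (h : α ≤ β),
    s.app _ ≫ F'.snd k α β h = F.snd k α β h ≫ t.app _

/-- The isomorphism of entries at equal places of a diagram. -/
def entryIso {n : ℕ} (X : Strip n ⥤ C) {v w : Strip n} (h : v = w) : X.obj v ≅ X.obj w where
  hom := arr X h.le
  inv := arr X h.ge
  hom_inv_id := by rw [arr_comp]; exact X.map_id v
  inv_hom_id := by rw [arr_comp]; exact X.map_id w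

theorem IsDirectSum.conj {Z A B Z' A' B' : C} {p : Z ⟶ A} {q : Z ⟶ B} (H : IsDirectSum p q)
    (e : Z' ≅ Z) (a : A' ≅ A) (b : B' ≅ B) :
    IsDirectSum (e.hom ≫ p ≫ a.inv) (e.hom ≫ q ≫ b.inv) := by
  obtain ⟨i, j, h1, h2, h3, h4, h5⟩ := H
  refine ⟨a.hom ≫ i ≫ e.inv, b.hom ≫ j ≫ e.inv, ?_, ?_, ?_, ?_, ?_⟩
  · simp [reassoc_of% h1]
  · simp [reassoc_of% h2]
  · simp [reassoc_of% h3]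
  · simp [reassoc_of% h4]
  · have := congrArg (fun x => e.hom ≫ x ≫ e.inv) h5
    simpa using this

theorem IsDirectSum.map {D : Type*} [Category D] [Preadditive D] (G : C ⥤ D) [G.Additive]
    {Z A B : C} {p : Z ⟶ A} {q : Z ⟶ B} (H : IsDirectSum p q) :
    IsDirectSum (G.map p) (G.map q) := by
  obtain ⟨i, j, h1, h2, h3, h4, h5⟩ := H
  refine ⟨G.map i, G.map j, ?_, ?_, ?_, ?_, ?_⟩
  · rw [← G.map_comp, h1, G.map_id]
  · rw [← G.map_comp, h2, G.map_zero]
  · rw [← G.map_comp, h3, G.map_zero]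
  · rw [← G.map_comp, h4, G.map_id]
  · rw [← G.map_comp, ← G.map_comp, ← G.map_add, h5, G.map_id]

theorem entryIso_square {m n : ℕ} {X : Strip m ⥤ C} {Y : Strip n ⥤ C} {v v' w w' : Strip n}
    {a a' b b' : Strip m} (hv : v = v') (hw : w = w') (ha : a = a') (hb : b = b')
    {h : v ≤ w} {h' : v' ≤ w'} {l : a ≤ b} {l' : a' ≤ b'}
    {p : Y.obj v' ⟶ X.obj a'} {q : Y.obj w' ⟶ X.obj b'} (H : arr Y h' ≫ q = p ≫ arr X l') :
    arr Y h ≫ (entryIso Y hw).hom ≫ q ≫ (entryIso X hb).inv =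
      ((entryIso Y hv).hom ≫ p ≫ (entryIso X ha).inv) ≫ arr X l := by
  subst hv hw ha hb
  have e1 : ∀ v, (entryIso Y (rfl : v = v)).hom = 𝟙 _ := fun v => Y.map_id v
  have e2 : ∀ v, (entryIso X (rfl : v = v)).inv = 𝟙 _ := fun v => X.map_id v
  simp only [e1, e2, Category.id_comp, Category.comp_id]
  exact H

theorem entryIso_square_sub {m n : ℕ} {X : Strip m ⥤ C} {Y : Strip n ⥤ C} {v v' w w' : Strip n}
    {a a' c c' b b' : Strip m} (hv : v = v') (hw : w = w') (ha : a = a') (hc : c = c')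
    (hb : b = b') {h : v ≤ w} {h' : v' ≤ w'} {l : a ≤ b} {l' : a' ≤ b'} {r : c ≤ b} {r' : c' ≤ b'}
    {p : Y.obj v' ⟶ X.obj a'} {p' : Y.obj v' ⟶ X.obj c'} {q : Y.obj w' ⟶ X.obj b'}
    (H : arr Y h' ≫ q = p ≫ arr X l' - p' ≫ arr X r') :
    arr Y h ≫ (entryIso Y hw).hom ≫ q ≫ (entryIso X hb).inv =
      ((entryIso Y hv).hom ≫ p ≫ (entryIso X ha).inv) ≫ arr X l -
        ((entryIso Y hv).hom ≫ p' ≫ (entryIso X hc).inv) ≫ arr X r := by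
  subst hv hw ha hb hc
  have e1 : ∀ v, (entryIso Y (rfl : v = v)).hom = 𝟙 _ := fun v => Y.map_id v
  have e2 : ∀ v, (entryIso X (rfl : v = v)).inv = 𝟙 _ := fun v => X.map_id v
  simp only [e1, e2, Category.id_comp, Category.comp_id]
  exact H

/-- If `Y` is obtained from `X` by folding, then the outer shift of `Y` is obtained from the outer
shift of `X` by folding. -/
def Folding.outer {n : ℕ} {X : Strip (2 * n + 1) ⥤ C} {Y : Strip (n + 1) ⥤ C} (F : Folding X Y) :
    Folding (Strip.shiftFunctor _ ⋙ X) (Strip.shiftFunctor _ ⋙ Y) where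
  single k α := entryIso Y (Strip.shift_iter k _) ≪≫ F.single (k + 1) α ≪≫
    (entryIso X (Strip.shift_iter k _)).symm
  fst k α β h := (entryIso Y (Strip.shift_iter k _)).hom ≫ F.fst (k + 1) α β h ≫
    (entryIso X (Strip.shift_iter k _)).inv
  snd k α β h := (entryIso Y (Strip.shift_iter k _)).hom ≫ F.snd (k + 1) α β h ≫
    (entryIso X (Strip.shift_iter k _)).inv
  isDirectSum k α β h := (F.isDirectSum (k + 1) α β h).conj _ _ _
  rho_rho k α β h := entryIso_square (Strip.shift_iter k _) (Strip.shift_iter k _) (Strip.shift_iter k _)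
    (Strip.shift_iter k _) (F.rho_rho (k + 1) α β h)
  rho_pair_fst k α β h := entryIso_square (Strip.shift_iter k _) (Strip.shift_iter k _) (Strip.shift_iter k _)
    (Strip.shift_iter k _) (F.rho_pair_fst (k + 1) α β h)
  rho_pair_snd k α β h := entryIso_square (Strip.shift_iter k _) (Strip.shift_iter k _) (Strip.shift_iter k _)
    (Strip.shift_iter k _) (F.rho_pair_snd (k + 1) α β h)
  pair_pair_fst k α β γ δ h h' h₁ h₂ :=
    entryIso_square (Strip.shift_iter k _) (Strip.shift_iter k _) (Strip.shift_iter k _)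
    (Strip.shift_iter k _) (F.pair_pair_fst (k + 1) α β γ δ h h' h₁ h₂)
  pair_pair_snd k α β γ δ h h' h₁ h₂ :=
    entryIso_square (Strip.shift_iter k _) (Strip.shift_iter k _) (Strip.shift_iter k _)
    (Strip.shift_iter k _) (F.pair_pair_snd (k + 1) α β γ δ h h' h₁ h₂)
  pair_rho k γ δ h := entryIso_square_sub (Strip.shift_iter k _) (Strip.shift_iter (k + 1) _)
    (Strip.shift_iter k _) (Strip.shift_iter k _) (Strip.shift_iter (k + 1) _) (F.pair_rho (k + 1) γ δ h)

/-- If `Y` is obtained from `X` by folding, then the inner shift of `Y` is obtained from the inner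
shift of `X` by folding. -/
def Folding.inner [HasFiniteBiproducts C] (T : CatAut C) {n : ℕ} {X : Strip (2 * n + 1) ⥤ C}
    {Y : Strip (n + 1) ⥤ C} (F : Folding X Y) : Folding (X ⋙ T.functor) (Y ⋙ T.functor) where
  single k α := T.functor.mapIso (F.single k α)
  fst k α β h := T.functor.map (F.fst k α β h)
  snd k α β h := T.functor.map (F.snd k α β h)
  isDirectSum k α β h := (F.isDirectSum k α β h).map T.functor
  rho_rho k α β h :=
    (T.functor.map_comp _ _).symm.trans
      ((congrArg T.functor.map (F.rho_rho k α β h)).trans (T.functor.map_comp _ _))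
  rho_pair_fst k α β h :=
    (T.functor.map_comp _ _).symm.trans
      ((congrArg T.functor.map (F.rho_pair_fst k α β h)).trans (T.functor.map_comp _ _))
  rho_pair_snd k α β h :=
    (T.functor.map_comp _ _).symm.trans
      ((congrArg T.functor.map (F.rho_pair_snd k α β h)).trans (T.functor.map_comp _ _))
  pair_pair_fst k α β γ δ h h' h₁ h₂ :=
    (T.functor.map_comp _ _).symm.trans
      ((congrArg T.functor.map (F.pair_pair_fst k α β γ δ h h' h₁ h₂)).trans
        (T.functor.map_comp _ _))
  pair_pair_snd k α β γ δ h h' h₁ h₂ :=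
    (T.functor.map_comp _ _).symm.trans
      ((congrArg T.functor.map (F.pair_pair_snd k α β γ δ h h' h₁ h₂)).trans
        (T.functor.map_comp _ _))
  pair_rho k γ δ h :=
    (T.functor.map_comp _ _).symm.trans
      ((congrArg T.functor.map (F.pair_rho k γ δ h)).trans
        (T.functor.map_sub.trans
          (congrArg₂ (· - ·) (T.functor.map_comp _ _) (T.functor.map_comp _ _))))

end Folding

/-! ### Heller triangulations -/

section HellerTriangulation

variable {C : Type u} [Category.{v} C] [Preadditive C] [WeaklyAbelian C]

/-- A Heller triangulation on `(C, T)`: isomorphisms `θ n` from the outer shift to the inner shift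
on the stable category of `n`-pretriangles, for `n ≥ 0`, compatible with restriction along periodic
monotone maps and with folding. Compatibility with folding says that if `t` represents `θ (2n + 1)`
at `X`, and if `Y` is obtained from `X` by folding, then the morphism `s` obtained from `t` by
folding represents `θ (n + 1)` at `Y`. -/
structure HellerTriangulation (T : CatAut C) where
  θ : ∀ n : ℕ, stableOuter C n ≅ stableInner T n
  restrict_comm : ∀ {m n : ℕ} (p : PeriodicMap m n) (X : Pretriangle C n),
    (stableRestrict C p).map ((θ n).hom.app ((toStable C n).obj X)) =
      (toStable C m).map (eqToHom (restrict_outer p X)) ≫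
        (θ m).hom.app ((toStable C m).obj ((restrict C p).obj X)) ≫
          (toStable C m).map (eqToHom (restrict_inner T p X).symm)
  fold_comm : ∀ {n : ℕ} (X : Pretriangle C (2 * n + 1)) (Y : Pretriangle C (n + 1))
    (F : Folding X.obj Y.obj)
    (t : (outer C (2 * n + 1)).obj X ⟶ (inner T (2 * n + 1)).obj X)
    (s : (outer C (n + 1)).obj Y ⟶ (inner T (n + 1)).obj Y),
    IsFoldHom F.outer (F.inner T) t.hom s.hom →
    (toStable C (2 * n + 1)).map t =
      (θ (2 * n + 1)).hom.app ((toStable C (2 * n + 1)).obj X) →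
    (toStable C (n + 1)).map s = (θ (n + 1)).hom.app ((toStable C (n + 1)).obj Y)

/-- A periodic `n`-pretriangle: a pretriangle whose outer and inner shift coincide. -/
structure PerPretriangle (T : CatAut C) (n : ℕ) where
  obj : Pretriangle C n
  periodic : (outer C n).obj obj = (inner T n).obj obj

namespace PerPretriangle

variable {T : CatAut C} {n : ℕ}

/-- A periodic morphism: a morphism whose outer and inner shift coincide. -/
@[ext]
structure Hom (X Y : PerPretriangle T n) where
  hom : X.obj ⟶ Y.obj
  periodic : (outer C n).map hom ≫ eqToHom Y.periodic =
    eqToHom X.periodic ≫ (inner T n).map hom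

instance : Category (PerPretriangle T n) where
  Hom := Hom
  id X := ⟨𝟙 _, by simp⟩
  comp f g := ⟨f.hom ≫ g.hom, by
    rw [Functor.map_comp, Functor.map_comp, Category.assoc, g.periodic, ← Category.assoc,
      f.periodic, Category.assoc]⟩

@[ext]
theorem hom_ext {X Y : PerPretriangle T n} {f g : X ⟶ Y} (h : f.hom = g.hom) : f = g :=
  Hom.ext h

@[simp]
theorem id_hom (X : PerPretriangle T n) : (𝟙 X : X ⟶ X).hom = 𝟙 X.obj := rfl

@[simp]
theorem comp_hom {X Y Z : PerPretriangle T n} (f : X ⟶ Y) (g : Y ⟶ Z) :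
    (f ≫ g).hom = f.hom ≫ g.hom := rfl

/-- The periodic morphisms, as a subgroup of the group of all morphisms. -/
def homSubgroup (X Y : PerPretriangle T n) : AddSubgroup (X.obj ⟶ Y.obj) where
  carrier := {f | (outer C n).map f ≫ eqToHom Y.periodic = eqToHom X.periodic ≫ (inner T n).map f}
  zero_mem' := by simp
  add_mem' := by
    intro f g (hf : _ = _) (hg : _ = _)
    change _ = _
    rw [Functor.map_add, Functor.map_add, Preadditive.add_comp, Preadditive.comp_add, hf, hg]
  neg_mem' := by
    intro f (hf : _ = _)
    change _ = _
    rw [Functor.map_neg, Functor.map_neg, Preadditive.neg_comp, Preadditive.comp_neg, hf]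

/-- Periodic morphisms as elements of the subgroup of periodic morphisms. -/
def homEquiv (X Y : PerPretriangle T n) : (X ⟶ Y) ≃ homSubgroup X Y where
  toFun f := ⟨f.hom, f.periodic⟩
  invFun f := ⟨f.1, f.2⟩
  left_inv _ := rfl
  right_inv _ := rfl

instance : Preadditive (PerPretriangle T n) where
  homGroup X Y := (homEquiv X Y).addCommGroup
  add_comp _ _ _ f f' g := hom_ext (Preadditive.add_comp _ _ _ f.hom f'.hom g.hom)
  comp_add _ _ _ f g g' := hom_ext (Preadditive.comp_add _ _ _ f.hom g.hom g'.hom)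

/-- Restriction of a periodic pretriangle along a periodic monotone map. -/
abbrev restrict {m : ℕ} (p : PeriodicMap m n) (X : PerPretriangle T n) : PerPretriangle T m where
  obj := (Heller.restrict C p).obj X.obj
  periodic := by
    rw [← restrict_outer, X.periodic]
    rfl

/-- The restriction of a diagram on the strip to `{1, …, n}`. -/
abbrev toDot (T : CatAut C) (n : ℕ) : PerPretriangle T n ⥤ (DotDelta n ⥤ C) where
  obj X := dotEmb n ⋙ X.obj.obj
  map f := Functor.whiskerLeft (dotEmb n) f.hom.hom

end PerPretriangle

/-- A periodic folding of a periodic pretriangle: a periodic pretriangle `Y` obtained from `X` by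
folding such that the identity `[Y]⁺¹ = [Y⁺¹]` is obtained from the identity `[X]⁺¹ = [X⁺¹]` by
folding. -/
def Folding.IsPeriodic {T : CatAut C} {n : ℕ} {X : PerPretriangle T (2 * n + 1)}
    {Y : PerPretriangle T (n + 1)} (F : Folding X.obj.obj Y.obj.obj) : Prop :=
  IsFoldHom F.outer (F.inner T) (eqToHom X.periodic).hom (eqToHom Y.periodic).hom

/-- A periodic `n`-pretriangle `X` is an `n`-triangle if `θ n` at `X` is the identity of
`[X]⁺¹ = [X⁺¹]` in the stable category. -/
def IsTriangle {T : CatAut C} (H : HellerTriangulation T) {n : ℕ} (X : PerPretriangle T n) : Prop :=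
  (H.θ n).hom.app ((toStable C n).obj X.obj) = (toStable C n).map (eqToHom X.periodic)

/-- The category of `n`-triangles; its morphisms are the periodic morphisms. -/
abbrev Triangle {T : CatAut C} (H : HellerTriangulation T) (n : ℕ) :=
  ObjectProperty.FullSubcategory (fun X : PerPretriangle T n => IsTriangle H X)

/-- The restriction functor from `n`-triangles to diagrams on `{1, …, n}`. -/
abbrev Triangle.toDot {T : CatAut C} (H : HellerTriangulation T) (n : ℕ) :
    Triangle H n ⥤ (DotDelta n ⥤ C) :=
  ObjectProperty.ι _ ⋙ PerPretriangle.toDot T n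

end HellerTriangulation

end

end Heller

open Heller

/-!
The assertions on restriction, folding, direct sums and split pretriangles are consequences of the
naturality of `θ` and of its compatibilities: a split pretriangle is zero in the stable category,
and `θ` at a direct sum is determined by `θ` at its summands and conversely. The work lies in
lifting isomorphisms, in the existence of biproducts of periodic pretriangles, and in the existence
of periodic foldings.

*Lifting isomorphisms.* In a weakly abelian category, weak squares are weak pullbacks and weak
pushouts, so a morphism between the restrictions of pretriangles to `{1, …, n}` extends, row by row,
to a morphism `f` of pretriangles (`IsPretriangle.exists_extension`). Between triangles, naturality
of `θ` shows that the outer and the inner shift of `f` agree in the stable category, i.e. up to a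
morphism that factors over split pretriangles. In a split pretriangle, the entries at `i/0` and at
`0/i⁻¹` belong to different direct summands. Hence there is a morphism `d` which is the difference
of the two shifts at the places `i/0` and vanishes at `0/i⁻¹` (`exists_correction`). Read along the
inverse of the outer shift, `d` vanishes at the places `i/0`. Subtracting it from `f` leaves `f`
unchanged on `{1, …, n}` and makes it periodic there. Such a morphism can be continued periodically
from the fundamental domain `{β/α : 0 ≤ α ≤ β ≤ n}` of the shift (`IsPretriangle.exists_periodic`).
That the result is an isomorphism follows from the five lemma (`IsPretriangle.isIso_app`).

*Periodicity up to isomorphism.* Constructions yield diagrams whose outer shift is only isomorphic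
to their inner shift (`Periodicity`). Since `T` is an automorphism, the entries along the orbits of
the shift may be replaced by isomorphic ones for which the isomorphism becomes an identity
(`Periodicity.exists_perPretriangle`).

*Foldings.* The entry of a folding at a place `v` represents the pairs of morphisms to the two
entries of `X` belonging to `v`, subject to a condition at the places involving `ρ`
(`IsFoldLimit`). Its morphisms are given by diagonal matrices inside a translate of the
fundamental domain, by differences between adjacent translates, and vanish otherwise (`IsFoldArr`).
With this uniform description, functoriality and the shift of a folding are formal. That a folding
is a pretriangle reduces, by periodicity and a chase in octahedra, to the exactness of the sequences
`γ/0 ⟶ δ/0 ⟶ δ/γ ⟶ 0⁺¹/γ ⟶ 0⁺¹/δ` (`Periodicity.isPretriangle`), which is read off from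
`X` (`FoldRep.isPretriangle`).
-/

namespace Heller

noncomputable section

/-! ### The fundamental domain of the shift -/

namespace Strip

variable {n : ℕ}

/-- The index of the translate, under the powers of the shift, of the fundamental domain
`{β/α : 0 ≤ α ≤ β ≤ n}` in which a place of the strip lies. -/
def level (v : Strip n) : ℤ := v.src / (n + 1) + v.tgt / (n + 1)

theorem level_shift (v : Strip n) : (shift n v).level = v.level + 1 := by
  change v.tgt / (n + 1) + (v.src + (n + 1)) / (n + 1) = v.src / (n + 1) + v.tgt / (n + 1) + 1
  rw [Int.add_ediv_of_dvd_right (dvd_refl _), Int.ediv_self (by omega)]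
  ring

theorem level_iter (k : ℤ) (v : Strip n) : (v.iter k).level = v.level + k := by
  induction k using Int.induction_on with
  | zero => simp [iter]
  | succ k ih => rw [← shift_iter, level_shift, ih]; ring
  | pred k ih =>
    have := level_shift (v.iter (-k - 1))
    rw [shift_iter, sub_add_cancel, ih] at this
    omega

theorem ediv_src_le (v : Strip n) : v.src / (n + 1) ≤ v.tgt / (n + 1) :=
  Int.ediv_le_ediv (by omega) v.le

theorem ediv_tgt_le (v : Strip n) : v.tgt / (n + 1) ≤ v.src / (n + 1) + 1 := by
  have := Int.ediv_le_ediv (c := (n + 1 : ℤ)) (by omega) v.le_shift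
  rwa [Int.add_ediv_of_dvd_right (dvd_refl _), Int.ediv_self (by omega)] at this

theorem level_mono {v w : Strip n} (h : v ≤ w) : v.level ≤ w.level :=
  add_le_add (Int.ediv_le_ediv (by omega) h.1) (Int.ediv_le_ediv (by omega) h.2)

theorem level_eq_zero_iff {v : Strip n} : v.level = 0 ↔ 0 ≤ v.src ∧ v.tgt < n + 1 := by
  have h1 := v.ediv_src_le
  have h2 := v.ediv_tgt_le
  rw [Int.ediv_nonneg_iff_of_pos (a := v.src) (b := n + 1) (by omega) |>.symm]
  have : v.tgt < n + 1 ↔ v.tgt / (n + 1) < 1 := by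
    rw [Int.ediv_lt_iff_lt_mul (by omega)]; simp
  rw [this, level]
  omega

theorem of_level_eq_one {v : Strip n} (h : v.level = 1) :
    0 ≤ v.src ∧ v.src < n + 1 ∧ (n + 1 : ℤ) ≤ v.tgt := by
  have h1 := v.ediv_src_le
  have h2 := v.ediv_tgt_le
  rw [level] at h
  refine ⟨?_, ?_, ?_⟩
  · rw [← Int.ediv_nonneg_iff_of_pos (b := (n : ℤ) + 1) (by omega)]; omega
  · have : v.src / (n + 1) < 1 := by omega
    rw [Int.ediv_lt_iff_lt_mul (by omega)] at this; simpa using this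
  · have : 1 ≤ v.tgt / (n + 1) := by omega
    rw [Int.le_ediv_iff_mul_le (by omega)] at this; simpa using this

theorem of_two_le_level {v : Strip n} (h : 2 ≤ v.level) : (n + 1 : ℤ) ≤ v.src := by
  have h2 := v.ediv_tgt_le
  rw [level] at h
  have : 1 ≤ v.src / (n + 1) := by omega
  rw [Int.le_ediv_iff_mul_le (by omega)] at this; simpa using this

/-- A property stable under the shift holds everywhere if it holds on the fundamental domain. -/
theorem induction_shift {P : Strip n → Prop} (h : ∀ v, P (shift n v) ↔ P v)
    (h0 : ∀ v, v.level = 0 → P v) (v : Strip n) : P v := by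
  have key : ∀ (k : ℤ) (v : Strip n), P (v.iter k) ↔ P v := by
    intro k v
    induction k using Int.induction_on with
    | zero => simp [iter]
    | succ k ih => rw [← shift_iter, h, ih]
    | pred k ih =>
      have := h (v.iter (-k - 1))
      rw [shift_iter, sub_add_cancel] at this
      rw [← this, ih]
  rw [← key (-v.level)]
  apply h0
  rw [level_iter]
  omega

/-- A family over the strip with bijective transition maps along the shift has an equivariant
section with prescribed values on the fundamental domain. -/
theorem exists_equivariant {E : Strip n → Type*} (step : ∀ v, E v → E (shift n v))
    (hstep : ∀ v, Function.Bijective (step v)) (e : ∀ v, E v) :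
    ∃ g : ∀ v, E v, (∀ v, g (shift n v) = step v (g v)) ∧ ∀ v, v.level = 0 → g v = e v := by
  -- the powers of the permutation of the total space given by `step` transport prescribed values
  let f : (Σ v, E v) → Σ v, E v := fun x => ⟨shift n x.1, step x.1 x.2⟩
  have hf : Function.Bijective f := by
    constructor
    · rintro ⟨v, a⟩ ⟨w, b⟩ h
      have h1 : v = w := (shift n).injective (congrArg Sigma.fst h)
      subst h1
      have h2 : step v a = step v b := eq_of_heq (Sigma.mk.inj h).2
      rw [(hstep v).1 h2]
    · rintro ⟨w, b⟩
      obtain ⟨v, rfl⟩ := (shift n).surjective w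
      obtain ⟨a, rfl⟩ := (hstep v).2 b
      exact ⟨⟨v, a⟩, rfl⟩
  let σ : Equiv.Perm (Σ v, E v) := Equiv.ofBijective f hf
  have hσ : ∀ x, (σ x).1 = shift n x.1 := fun _ => rfl
  have hk : ∀ (k : ℤ) (x : Σ v, E v), ((σ ^ k) x).1 = x.1.iter k := by
    intro k
    induction k using Int.induction_on with
    | zero => intro x; simp [iter]
    | succ k ih =>
      intro x
      rw [zpow_add_one, Equiv.Perm.mul_apply, ih, hσ, iter_succ]
    | pred k ih =>
      intro x
      have h1 : x.1 = shift n (σ⁻¹ x).1 := by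
        rw [← hσ]; exact congrArg Sigma.fst (σ.apply_symm_apply x).symm
      rw [zpow_sub_one, Equiv.Perm.mul_apply, ih, h1, ← iter_succ, sub_add_cancel]
  let G : Strip n → Σ v, E v := fun v => (σ ^ v.level) ⟨v.iter (-v.level), e _⟩
  have hG : ∀ v, ∃ a : E v, (⟨v, a⟩ : Σ v, E v) = G v := by
    intro v
    have : (G v).1 = v := by
      rw [hk]
      change (shift n ^ v.level) ((shift n ^ (-v.level)) v) = v
      rw [← RelIso.mul_apply, ← zpow_add]
      simp
    exact ⟨this ▸ (G v).2, by rw [Sigma.ext_iff]; exact ⟨this.symm, by simp⟩⟩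
  choose g hg using hG
  refine ⟨g, fun v => ?_, fun v hv => ?_⟩
  · have h1 : G (shift n v) = σ (G v) := by
      change (σ ^ (shift n v).level) ⟨(shift n v).iter (-(shift n v).level), e _⟩ =
        σ ((σ ^ v.level) ⟨v.iter (-v.level), e _⟩)
      have h2 : (shift n v).iter (-(shift n v).level) = v.iter (-v.level) := by
        rw [← iter_succ, level_shift]
        congr 1
        ring
      rw [h2, level_shift, ← Equiv.Perm.mul_apply, add_comm, zpow_add, zpow_one]
    rw [← hg, ← hg] at h1
    exact eq_of_heq (Sigma.mk.inj h1).2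
  · have h1 : G v = ⟨v, e v⟩ := by
      change (σ ^ v.level) ⟨v.iter (-v.level), e _⟩ = _
      have h2 : v.iter (-0) = v := by simp [iter]
      rw [hv, h2, zpow_zero, Equiv.Perm.one_apply]
    rw [← hg] at h1
    exact eq_of_heq (Sigma.mk.inj h1).2

end Strip

/-! ### Exactness in weakly abelian categories and in pretriangles -/

section Exactness

variable {C : Type u} [Category.{v} C] [Preadditive C]

/-- In a weakly abelian category, a sequence exact in the covariant sense is exact in the
contravariant sense. -/
theorem IsWeakKernel.isWeakCokernel [WeaklyAbelian C] {K X Y : C} {i : K ⟶ X} {f : X ⟶ Y}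
    (h : IsWeakKernel i f) : IsWeakCokernel f i := by
  obtain ⟨Z, g, hg⟩ := WeaklyAbelian.isWeakCokernel f
  obtain ⟨g', rfl⟩ := h.2 g hg.1
  refine ⟨h.1, fun T t ht => hg.2 t ?_⟩
  rw [Category.assoc, ht, comp_zero]

/-- A weak square is a weak pushout. -/
theorem IsWeakSquare.exists_desc [WeaklyAbelian C] {A B A' B' : C}
    {f : A ⟶ B} {g : A ⟶ A'} {h : B ⟶ B'} {k : A' ⟶ B'} (H : IsWeakSquare f g h k) {T : C}
    (b : B ⟶ T) (a : A' ⟶ T) (e : f ≫ b = g ≫ a) : ∃ t : B' ⟶ T, h ≫ t = b ∧ k ≫ t = a := by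
  obtain ⟨t, ht⟩ := H.2.isWeakCokernel.2 (biprod.desc a (-b)) (by simp [e])
  refine ⟨t, ?_, ?_⟩
  · have := congrArg (biprod.inr ≫ ·) ht
    simpa using this
  · have := congrArg (biprod.inl ≫ ·) ht
    simpa using this

theorem IsWeakSquare.exists_lift [WeaklyAbelian C] {A B A' B' : C}
    {f : A ⟶ B} {g : A ⟶ A'} {h : B ⟶ B'} {k : A' ⟶ B'} (H : IsWeakSquare f g h k) {T : C}
    (b : T ⟶ B) (a : T ⟶ A') (e : b ≫ h = a ≫ k) : ∃ t : T ⟶ A, t ≫ f = b ∧ t ≫ g = a :=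
  ((isWeakSquare_iff _ _ _ _).1 H).2 b a e

variable {n : ℕ}

omit [Preadditive C] in
theorem arr_self (X : Strip n ⥤ C) {v : Strip n} (h : v ≤ v) : arr X h = 𝟙 _ := X.map_id v

theorem arr_eq_zero (X : Strip n ⥤ C) {v w : Strip n} (h : v ≤ w) (z : Strip n) (h1 : v ≤ z)
    (h2 : z ≤ w) (hz : IsZero (X.obj z)) : arr X h = 0 := by
  rw [← arr_comp X h1 h2, hz.eq_of_tgt (arr X h1) 0, zero_comp]

/-- The diagram `X` is exact at the middle one of the places `u ≤ v ≤ w`: morphisms into `X` at `v`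
that vanish at `w` factor over `X` at `u`. -/
def ExactAt (X : Strip n ⥤ C) {u v w : Strip n} (h : u ≤ v) (h' : v ≤ w) : Prop :=
  ∀ ⦃T : C⦄ (t : T ⟶ X.obj v), t ≫ arr X h' = 0 → ∃ s : T ⟶ X.obj u, s ≫ arr X h = t

variable [WeaklyAbelian C] {X Y : Strip n ⥤ C}

theorem IsPretriangle.arr_eq_zero_of_tgt (hX : IsPretriangle X) {v w : Strip n} (h : v ≤ w)
    (h' : v.src + (n + 1) ≤ w.tgt) : arr X h = 0 :=
  arr_eq_zero X h ⟨v.src, v.src + (n + 1), by omega, le_refl _⟩ ⟨le_refl _, v.le_shift⟩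
    ⟨h.1, h'⟩ (hX.isZero_shift _)

theorem IsPretriangle.arr_eq_zero_of_src (hX : IsPretriangle X) {v w : Strip n} (h : v ≤ w)
    (h' : v.tgt ≤ w.src) : arr X h = 0 :=
  arr_eq_zero X h ⟨v.tgt, v.tgt, le_refl _, by omega⟩ ⟨v.le, le_refl _⟩
    ⟨h', h.2⟩ (hX.isZero_diag _)

/-- Exactness at the middle one of the places `γ/α ≤ δ/α ≤ δ/γ`. -/
theorem IsPretriangle.exactAt_tgt (hX : IsPretriangle X) {a c d : ℤ} (h1 : a ≤ c) (h2 : c ≤ d)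
    (h3 : d ≤ a + (n + 1)) :
    ExactAt X (u := ⟨a, c, by omega, by omega⟩) (v := ⟨a, d, by omega, by omega⟩)
      (w := ⟨c, d, by omega, by omega⟩) ⟨by dsimp; omega, by dsimp; omega⟩
      ⟨by dsimp; omega, by dsimp; omega⟩ := by
  intro T t ht
  obtain ⟨s, hs, -⟩ := (hX.isWeakSquare a c c d (by omega) h1 le_rfl h2 h3).exists_lift t 0
    (by rw [ht, zero_comp])
  exact ⟨s, hs⟩

/-- Exactness at the middle one of the places `γ/ε ≤ γ/α ≤ ε⁺¹/α`. -/
theorem IsPretriangle.exactAt_src (hX : IsPretriangle X) {e a c : ℤ} (h1 : e ≤ a) (h2 : a ≤ c)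
    (h3 : c ≤ e + (n + 1)) :
    ExactAt X (u := ⟨e, c, by omega, by omega⟩) (v := ⟨a, c, by omega, by omega⟩)
      (w := ⟨a, e + (n + 1), by omega, by omega⟩) ⟨by dsimp; omega, by dsimp; omega⟩
      ⟨by dsimp; omega, by dsimp; omega⟩ := by
  intro T t ht
  obtain ⟨s, -, hs⟩ := (hX.isWeakSquare e a c (e + (n + 1)) (by omega) h1 h2 h3
    le_rfl).exists_lift 0 t (by rw [ht, zero_comp])
  exact ⟨s, hs⟩

/-- A family of morphisms between the entries of two pretriangles is natural if it is natural along
the unit steps of the strip. -/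
theorem IsPretriangle.naturality_of_steps (hX : IsPretriangle X) (hY : IsPretriangle Y)
    (f : ∀ v, X.obj v ⟶ Y.obj v)
    (hr : ∀ (a b : ℤ) (h1 : a ≤ b) (h2 : b + 1 ≤ a + (n + 1)),
      arr X (v := ⟨a, b, h1, by omega⟩) (w := ⟨a, b + 1, by omega, h2⟩)
        ⟨le_refl a, Int.le_add_one le_rfl⟩ ≫ f _ =
      f _ ≫ arr Y ⟨le_refl a, Int.le_add_one le_rfl⟩)
    (hc : ∀ (a b : ℤ) (h1 : a + 1 ≤ b) (h2 : b ≤ a + (n + 1)),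
      arr X (v := ⟨a, b, by omega, h2⟩) (w := ⟨a + 1, b, h1, by omega⟩)
        ⟨Int.le_add_one le_rfl, le_refl b⟩ ≫ f _ =
      f _ ≫ arr Y ⟨Int.le_add_one le_rfl, le_refl b⟩)
    {v w : Strip n} (h : v ≤ w) : arr X h ≫ f w = f v ≫ arr Y h := by
  have comp : ∀ {u v w : Strip n} (h : u ≤ v) (h' : v ≤ w), arr X h ≫ f v = f u ≫ arr Y h →
      arr X h' ≫ f w = f v ≫ arr Y h' → arr X (h.trans h') ≫ f w = f u ≫ arr Y (h.trans h') := by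
    intro u v w h h' e e'
    rw [← arr_comp X h h', ← arr_comp Y h h', Category.assoc, e', ← Category.assoc, e,
      Category.assoc]
  have rows : ∀ (j : ℕ) (a b : ℤ) (h1 : a ≤ b) (h2 : b + j ≤ a + (n + 1)),
      arr X (v := ⟨a, b, h1, by omega⟩) (w := ⟨a, b + j, by omega, h2⟩)
        ⟨le_refl a, Int.le_add_of_nonneg_right (Int.natCast_nonneg j)⟩ ≫ f _ =
      f _ ≫ arr Y ⟨le_refl a, Int.le_add_of_nonneg_right (Int.natCast_nonneg j)⟩ := by
    intro j
    induction j with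
    | zero =>
      intro a b h1 h2
      have : (⟨a, b + ((0 : ℕ) : ℤ), by omega, h2⟩ : Strip n) = ⟨a, b, h1, by omega⟩ := by
        ext <;> simp
      rw! [this]
      rw [arr_self, arr_self]
      simp
    | succ j ih =>
      intro a b h1 h2
      have : (⟨a, b + ((j + 1 : ℕ) : ℤ), by omega, h2⟩ : Strip n) =
          ⟨a, b + j + 1, by omega, by push_cast at h2; omega⟩ := by
        ext <;> simp [add_assoc]
      rw! [this]
      push_cast at h2
      exact comp _ _ (ih a b h1 (by omega)) (hr a (b + j) (by omega) (by omega))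
  have cols : ∀ (j : ℕ) (a b : ℤ) (h1 : a + j ≤ b) (h2 : b ≤ a + (n + 1)),
      arr X (v := ⟨a, b, by omega, h2⟩) (w := ⟨a + j, b, h1, by omega⟩)
        ⟨Int.le_add_of_nonneg_right (Int.natCast_nonneg j), le_refl b⟩ ≫ f _ =
      f _ ≫ arr Y ⟨Int.le_add_of_nonneg_right (Int.natCast_nonneg j), le_refl b⟩ := by
    intro j
    induction j with
    | zero =>
      intro a b h1 h2
      have : (⟨a + ((0 : ℕ) : ℤ), b, h1, by omega⟩ : Strip n) = ⟨a, b, by omega, h2⟩ := by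
        ext <;> simp
      rw! [this]
      rw [arr_self, arr_self]
      simp
    | succ j ih =>
      intro a b h1 h2
      have : (⟨a + ((j + 1 : ℕ) : ℤ), b, h1, by omega⟩ : Strip n) =
          ⟨a + j + 1, b, by push_cast at h1; omega, by omega⟩ := by
        ext <;> simp [add_assoc]
      rw! [this]
      push_cast at h1
      exact comp _ _ (ih a b (by omega) h2) (hc (a + j) b (by omega) (by omega))
  -- Unless the morphism factors over the zero object at the end of the row of `v`, it is composed
  -- of steps along the row and steps across rows.
  by_cases hw : v.src + (n + 1) ≤ w.tgt
  · rw [hX.arr_eq_zero_of_tgt h hw, hY.arr_eq_zero_of_tgt h hw, zero_comp, comp_zero]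
  obtain ⟨a, b, h1, h2⟩ := v
  obtain ⟨a', b', h1', h2'⟩ := w
  obtain ⟨i, rfl⟩ := Int.le.dest (show a ≤ a' from h.1)
  obtain ⟨j, rfl⟩ := Int.le.dest (show b ≤ b' from h.2)
  dsimp at hw
  exact comp _ _ (rows j a b h1 (by omega)) (cols i a (b + j) h1' (by omega))

end Exactness

/-! ### Successive choices -/

section Chains

theorem exists_nat_chain {α : Type*} (P : ℕ → α → Prop) (R : ℕ → α → α → Prop) (a : α)
    (ha : P 0 a) (h : ∀ k a, P k a → ∃ b, P (k + 1) b ∧ R k a b) :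
    ∃ s : ℕ → α, s 0 = a ∧ ∀ k, P k (s k) ∧ R k (s k) (s (k + 1)) := by
  have : Nonempty α := ⟨a⟩
  choose! g hg1 hg2 using h
  let s : ℕ → α := fun k => Nat.rec a (fun k b => g k b) k
  have hs : ∀ k, P k (s k) := fun k => by
    induction k with
    | zero => exact ha
    | succ k ih => exact hg1 k _ ih
  exact ⟨s, rfl, fun k => ⟨hs k, hg2 k _ (hs k)⟩⟩

/-- Successive choices in both directions, starting with `a` at `0`. -/
theorem exists_int_chain {α : Type*} (P : ℤ → α → Prop) (R : ℤ → α → α → Prop) (a : α)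
    (ha : P 0 a) (h : ∀ k a, P k a → ∃ b, P (k + 1) b ∧ R k a b)
    (h' : ∀ k b, P (k + 1) b → ∃ a, P k a ∧ R k a b) :
    ∃ s : ℤ → α, s 0 = a ∧ ∀ k, R k (s k) (s (k + 1)) := by
  obtain ⟨s, hs, hs'⟩ := exists_nat_chain (fun k => P k) (fun k => R k) a ha
    (fun k a hk => by simpa using h k a hk)
  obtain ⟨r, hr, hr'⟩ := exists_nat_chain (fun k => P (-k)) (fun k a b => R (-k - 1) b a) a
    (by simpa using ha) (fun k a hk => by
      have := h' (-k - 1) a (by simpa using hk)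
      simpa [sub_eq_add_neg, add_comm] using this)
  refine ⟨fun k => if 0 ≤ k then s k.toNat else r (-k).toNat, by simp [hs], fun k => ?_⟩
  by_cases hk : 0 ≤ k
  · obtain ⟨j, rfl⟩ := Int.eq_ofNat_of_zero_le hk
    have h1 : (0 : ℤ) ≤ j + 1 := by omega
    have h2 : ((j : ℤ) + 1).toNat = j + 1 := by omega
    simp only [hk, h1, if_true, h2, Int.toNat_natCast]
    exact (hs' j).2
  · obtain ⟨j, rfl⟩ : ∃ j : ℕ, k = -(j : ℤ) - 1 := ⟨(-k - 1).toNat, by omega⟩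
    have h2 : (-(-(j : ℤ) - 1)).toNat = j + 1 := by omega
    have h3 : (- -(j : ℤ)).toNat = j := by omega
    have h4 := (hr' j).2
    rw [sub_add_cancel]
    by_cases hj : j = 0
    · subst hj
      simpa [hs, hr] using h4
    · have h5 : ¬ (0 : ℤ) ≤ -j := by omega
      simp only [hk, h5, if_false, h2, h3]
      exact h4

end Chains

/-! ### Extension of morphisms from a row to the whole strip -/

section Extension

variable {C : Type u} [Category.{v} C] [Preadditive C] [WeaklyAbelian C] {n : ℕ}
  {X Y : Strip n ⥤ C}

/-- The family `f` is natural along the entries `β/α` of the row with index `α`. -/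
def IsNaturalOnRow (X Y : Strip n ⥤ C) (a : ℤ) (f : ∀ v, X.obj v ⟶ Y.obj v) : Prop :=
  ∀ (b : ℤ) (h1 : a ≤ b) (h2 : b + 1 ≤ a + (n + 1)),
    arr X (v := ⟨a, b, h1, by omega⟩) (w := ⟨a, b + 1, by omega, h2⟩)
      ⟨le_refl a, Int.le_add_one le_rfl⟩ ≫ f _ = f _ ≫ arr Y ⟨le_refl a, Int.le_add_one le_rfl⟩

/-- The families `f` on the row `α` and `g` on the row `α + 1` are compatible. -/
def IsNaturalBetweenRows (X Y : Strip n ⥤ C) (a : ℤ) (f g : ∀ v, X.obj v ⟶ Y.obj v) : Prop :=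
  ∀ (b : ℤ) (h1 : a + 1 ≤ b) (h2 : b ≤ a + (n + 1)),
    arr X (v := ⟨a, b, by omega, h2⟩) (w := ⟨a + 1, b, h1, by omega⟩)
      ⟨Int.le_add_one le_rfl, le_refl b⟩ ≫ g _ = f _ ≫ arr Y ⟨Int.le_add_one le_rfl, le_refl b⟩

omit [WeaklyAbelian C] in
/-- A morphism between single entries, as a member of a family defined at all places. -/
theorem exists_family_apply_eq {v : Strip n} (x : X.obj v ⟶ Y.obj v) :
    ∃ f : ∀ v, X.obj v ⟶ Y.obj v, f v = x := by
  classical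
  exact ⟨Function.update (fun _ => 0) v x, Function.update_self _ _ _⟩

/-- Weak squares are weak pushouts, so a morphism on a row extends to the next row. -/
theorem IsPretriangle.exists_next_row (hX : IsPretriangle X) (hY : IsPretriangle Y) (a : ℤ)
    (f : ∀ v, X.obj v ⟶ Y.obj v) (hf : IsNaturalOnRow X Y a f) :
    ∃ g, IsNaturalOnRow X Y (a + 1) g ∧ IsNaturalBetweenRows X Y a f g := by
  obtain ⟨s, -, hs⟩ := exists_nat_chain (α := ∀ v, X.obj v ⟶ Y.obj v)
    (fun j g => ∀ (b : ℤ) (h1 : a + 1 ≤ b) (h2 : b ≤ a + (n + 1)), b = a + 1 + j →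
      arr X (v := ⟨a, b, by omega, h2⟩) (w := ⟨a + 1, b, h1, by omega⟩)
        ⟨Int.le_add_one le_rfl, le_refl b⟩ ≫ g _ =
      f _ ≫ arr Y ⟨Int.le_add_one le_rfl, le_refl b⟩)
    (fun j g g' => ∀ (b : ℤ) (h1 : a + 1 ≤ b) (h2 : b + 1 ≤ a + 1 + (n + 1)), b = a + 1 + j →
      arr X (v := ⟨a + 1, b, h1, by omega⟩) (w := ⟨a + 1, b + 1, by omega, h2⟩)
        ⟨le_refl _, Int.le_add_one le_rfl⟩ ≫ g' _ =
      g _ ≫ arr Y (v := ⟨a + 1, b, h1, by omega⟩) (w := ⟨a + 1, b + 1, by omega, h2⟩)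
        ⟨le_refl _, Int.le_add_one le_rfl⟩)
    (fun _ => 0)
    (by
      intro b h1 h2 hb
      have hb : b = a + 1 := by simpa using hb
      subst hb
      exact (hY.isZero_diag _).eq_of_tgt _ _)
    (by
      intro j g hg
      by_cases hj : a + 1 + j + 1 ≤ a + (n + 1)
      · obtain ⟨x, hx1, hx2⟩ := (hX.isWeakSquare a (a + 1) (a + 1 + j) (a + 1 + j + 1) (by omega)
          (by omega) (by omega) (by omega) hj).exists_desc
            (f ⟨a, a + 1 + j + 1, by omega, hj⟩ ≫ arr Y (w := ⟨a + 1, a + 1 + j + 1, by omega,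
              by omega⟩) ⟨Int.le_add_one le_rfl, le_refl _⟩)
            (g ⟨a + 1, a + 1 + j, by omega, by omega⟩ ≫ arr Y ⟨le_refl _, Int.le_add_one le_rfl⟩)
            (by
              have h1 := hf (a + 1 + j) (by omega) hj
              have h2 := hg (a + 1 + j) (by omega) (by omega) rfl
              rw [← Category.assoc, ← Category.assoc, h1, h2, Category.assoc, Category.assoc,
                arr_comp, arr_comp])
        obtain ⟨g', hg'⟩ := exists_family_apply_eq (X := X) (Y := Y) x
        refine ⟨g', ?_, ?_⟩
        · intro b h1 h2 hb
          have hb : b = a + 1 + j + 1 := by rw [hb]; push_cast; ring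
          subst hb
          rw [hg']
          exact hx1
        · intro b h1 h2 hb
          subst hb
          rw [hg']
          exact hx2
      · refine ⟨fun _ => 0, ?_, ?_⟩
        · intro b h1 h2 hb
          push_cast at hb
          omega
        · intro b h1 h2 hb
          have hb' : b + 1 = a + 1 + (n + 1) := by omega
          rw! [hb']
          exact (hY.isZero_shift _).eq_of_tgt _ _)
  refine ⟨fun v => s (v.tgt - (a + 1)).toNat v, ?_, ?_⟩
  · intro b h1 h2
    have e1 : (b + 1 - (a + 1)).toNat = (b - (a + 1)).toNat + 1 := by omega
    dsimp only
    rw [e1]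
    exact (hs (b - (a + 1)).toNat).2 b h1 h2 (by omega)
  · intro b h1 h2
    exact (hs (b - (a + 1)).toNat).1 b h1 h2 (by omega)

/-- Weak squares are weak pullbacks, so a morphism on a row extends to the previous row. -/
theorem IsPretriangle.exists_previous_row (hX : IsPretriangle X) (hY : IsPretriangle Y) (a : ℤ)
    (g : ∀ v, X.obj v ⟶ Y.obj v) (hg : IsNaturalOnRow X Y (a + 1) g) :
    ∃ f, IsNaturalOnRow X Y a f ∧ IsNaturalBetweenRows X Y a f g := by
  obtain ⟨s, -, hs⟩ := exists_nat_chain (α := ∀ v, X.obj v ⟶ Y.obj v)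
    (fun j f => ∀ (b : ℤ) (h1 : a + 1 ≤ b) (h2 : b ≤ a + (n + 1)), b = a + (n + 1) - j →
      arr X (v := ⟨a, b, by omega, h2⟩) (w := ⟨a + 1, b, h1, by omega⟩)
        ⟨Int.le_add_one le_rfl, le_refl b⟩ ≫ g _ =
      f _ ≫ arr Y ⟨Int.le_add_one le_rfl, le_refl b⟩)
    (fun j f f' => ∀ (b : ℤ) (h1 : a ≤ b) (h2 : b + 1 ≤ a + (n + 1)), b + 1 = a + (n + 1) - j →
      arr X (v := ⟨a, b, h1, by omega⟩) (w := ⟨a, b + 1, by omega, h2⟩)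
        ⟨le_refl _, Int.le_add_one le_rfl⟩ ≫ f _ =
      f' _ ≫ arr Y (v := ⟨a, b, h1, by omega⟩) (w := ⟨a, b + 1, by omega, h2⟩)
        ⟨le_refl _, Int.le_add_one le_rfl⟩)
    (fun _ => 0)
    (by
      intro b h1 h2 hb
      have hb : b = a + (n + 1) := by simpa using hb
      subst hb
      exact (hX.isZero_shift _).eq_of_src _ _)
    (by
      intro j f hf
      obtain ⟨b, hb⟩ : ∃ b, b + 1 = a + (n + 1) - j := ⟨a + (n + 1) - j - 1, by ring⟩
      by_cases hj : a + 1 ≤ b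
      · obtain ⟨x, hx1, hx2⟩ := (hY.isWeakSquare a (a + 1) b (b + 1) (by omega)
          (by omega) (by omega) (by omega) (by omega)).exists_lift
            (arr X (v := ⟨a, b, by omega, by omega⟩) ⟨le_refl a, Int.le_add_one le_rfl⟩ ≫
              f ⟨a, b + 1, by omega, by omega⟩)
            (arr X ⟨Int.le_add_one le_rfl, le_refl b⟩ ≫ g ⟨a + 1, b, by omega, by omega⟩)
            (by
              have h1 := hf (b + 1) (by omega) (by omega) hb
              have h2 := hg b (by omega) (by omega)
              rw [Category.assoc, Category.assoc, ← h1, ← h2, ← Category.assoc, ← Category.assoc,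
                arr_comp, arr_comp])
        obtain ⟨f', hf'⟩ := exists_family_apply_eq (X := X) (Y := Y) x
        refine ⟨f', ?_, ?_⟩
        · intro b' h1 h2 hb'
          have hb : b' = b := by push_cast at hb'; omega
          subst hb
          rw [hf']
          exact hx2.symm
        · intro b' h1 h2 hb'
          have hb : b' = b := by omega
          subst hb
          rw [hf']
          exact hx1.symm
      · refine ⟨fun _ => 0, ?_, ?_⟩
        · intro b' h1 h2 hb'
          push_cast at hb'
          omega
        · intro b' h1 h2 hb'
          have hb' : b' = a := by omega
          rw! [hb']
          exact (hX.isZero_diag _).eq_of_src _ _)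
  refine ⟨fun v => s (a + (n + 1) - v.tgt).toNat v, ?_, ?_⟩
  · intro b h1 h2
    have e1 : (a + (n + 1) - b).toNat = (a + (n + 1) - (b + 1)).toNat + 1 := by omega
    dsimp only
    rw [e1]
    exact (hs (a + (n + 1) - (b + 1)).toNat).2 b h1 h2 (by omega)
  · intro b h1 h2
    exact (hs (a + (n + 1) - b).toNat).1 b h1 h2 (by omega)

/-- The restriction functor from pretriangles to diagrams on `{1, …, n}` is full. -/
theorem IsPretriangle.exists_extension (hX : IsPretriangle X) (hY : IsPretriangle Y)
    (t : dotEmb n ⋙ X ⟶ dotEmb n ⋙ Y) : ∃ f : X ⟶ Y, Functor.whiskerLeft (dotEmb n) f = t := by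
  have hex : ∀ v, ∃ x : X.obj v ⟶ Y.obj v, ∀ i, (dotEmb n).obj i = v → x ≍ t.app i := by
    intro v
    by_cases hv : ∃ i, (dotEmb n).obj i = v
    · obtain ⟨i, rfl⟩ := hv
      refine ⟨t.app i, fun j hj => ?_⟩
      obtain rfl : j = i := Subtype.ext (congrArg Strip.tgt hj)
      rfl
    · exact ⟨0, fun i hi => (hv ⟨i, hi⟩).elim⟩
  choose f₀ hf₀' using hex
  -- `f₀` is `t` on the row `0` and is continued row by row in both directions
  have hf₀ : ∀ i : DotDelta n, f₀ ((dotEmb n).obj i) = t.app i :=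
    fun i => eq_of_heq (hf₀' _ i rfl)
  obtain ⟨s, hs0, hs⟩ := exists_int_chain (fun a f => IsNaturalOnRow X Y a f)
    (fun a f g => IsNaturalOnRow X Y a f ∧ IsNaturalBetweenRows X Y a f g) f₀
    (by
      intro b h1 h2
      by_cases hb : b = 0
      · subst hb
        exact (hX.isZero_diag _).eq_of_src _ _
      by_cases hb' : b = n
      · subst hb'
        have := hY.isZero_shift 0
        rw! (castMode := .all) [zero_add] at this
        exact this.eq_of_tgt _ _
      have e1 := hf₀ ⟨b, by omega, by omega⟩
      have e2 := hf₀ ⟨b + 1, by omega, by omega⟩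
      have e3 := t.naturality (X := ⟨b, by omega, by omega⟩) (Y := ⟨b + 1, by omega, by omega⟩)
        (homOfLE (Int.le_add_one le_rfl : b ≤ b + 1))
      rw [← e1, ← e2] at e3
      exact e3)
    (fun a f hf => by
      obtain ⟨g, h1, h2⟩ := hX.exists_next_row hY a f hf
      exact ⟨g, h1, hf, h2⟩)
    (fun a g hg => by
      obtain ⟨f, h1, h2⟩ := hX.exists_previous_row hY a g hg
      exact ⟨f, h1, h1, h2⟩)
  refine ⟨⟨fun v => s v.src v, ?_⟩, ?_⟩
  · intro v w h
    exact hX.naturality_of_steps hY (fun v => s v.src v) (fun a b h1 h2 => (hs a).1 b h1 h2)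
      (fun a b h1 h2 => (hs a).2 b h1 h2) (leOfHom h)
  · ext i
    change s 0 ((dotEmb n).obj i) = t.app i
    rw [hs0, hf₀]

end Extension

/-! ### Splitting morphisms through split pretriangles -/

section Split

variable {C : Type u} [Category.{v} C] [Preadditive C] {n : ℕ}

omit [Preadditive C] in
/-- The restriction of a von Neumann regular morphism to compatible images of idempotents has a
quasi-inverse. -/
theorem exists_quasiInverse {A B : C} {z : A ⟶ B} {e : A ⟶ A} {e' : B ⟶ B} {s₀ : B ⟶ A}
    (he : e ≫ e = e) (he' : e' ≫ e' = e') (hz : z ≫ e' = e ≫ z) (hs : z ≫ s₀ ≫ z = z) :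
    ∃ s : B ⟶ A, s ≫ e = s ∧ e' ≫ s = s ∧ z ≫ s ≫ z = e ≫ z ∧ s ≫ z ≫ s = s := by
  obtain ⟨s, h1, h2, h3⟩ : ∃ s : B ⟶ A, s ≫ e = s ∧ e' ≫ s = s ∧ z ≫ s ≫ z = e ≫ z := by
    refine ⟨e' ≫ s₀ ≫ e, by simp [he], by simp [reassoc_of% he'], ?_⟩
    calc z ≫ (e' ≫ s₀ ≫ e) ≫ z = (z ≫ e') ≫ s₀ ≫ (e ≫ z) := by simp only [Category.assoc]
      _ = e ≫ (z ≫ s₀ ≫ z) ≫ e' := by rw [← hz, hz]; simp only [Category.assoc, hz]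
      _ = e ≫ z := by rw [hs, hz, reassoc_of% he]
  refine ⟨s ≫ z ≫ s, by simp [h1], by simp [reassoc_of% h2], ?_, ?_⟩
  · simp only [Category.assoc]
    rw [h3, reassoc_of% h1, h3]
  · simp only [Category.assoc]
    rw [reassoc_of% h3, reassoc_of% h1, reassoc_of% h3, reassoc_of% h1]

omit [Preadditive C] in
theorem arr_naturality {X Y : Strip n ⥤ C} (f : X ⟶ Y) {v w : Strip n} (h : v ≤ w) :
    arr X h ≫ f.app w = f.app v ≫ arr Y h := f.naturality _

/-- The place `α⁺¹⁻/β⁻` for `v = β/α`, where `⁻` denotes the predecessor. A pretriangle with a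
constant entry `W` on the interval `[v, v.cap]` and zero entries elsewhere is split. -/
def Strip.cap (v : Strip n) : Strip n :=
  ⟨v.tgt - 1, v.src + n, by have := v.le_shift; omega, by have := v.le; omega⟩

variable [WeaklyAbelian C]

/-- The contravariant version of the exactness at the middle one of `γ/α ≤ δ/α ≤ δ/γ`. -/
theorem IsPretriangle.coexactAt_tgt {X : Strip n ⥤ C} (hX : IsPretriangle X) {a c d : ℤ}
    (h1 : a ≤ c) (h2 : c ≤ d) (h3 : d ≤ a + (n + 1)) {T : C}
    (t : X.obj ⟨a, d, by omega, by omega⟩ ⟶ T)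
    (ht : arr X (v := ⟨a, c, by omega, by omega⟩) ⟨le_refl a, h2⟩ ≫ t = 0) :
    ∃ s : X.obj ⟨c, d, h2, by omega⟩ ⟶ T,
      arr X (v := ⟨a, d, by omega, by omega⟩) ⟨h1, le_refl d⟩ ≫ s = t := by
  obtain ⟨s, hs, -⟩ := (hX.isWeakSquare a c c d (by omega) h1 le_rfl h2 h3).exists_desc t 0
    (by rw [ht, comp_zero])
  exact ⟨s, hs⟩

/-- The endomorphism of a pretriangle that factors over the pretriangle with constant entry `Z_v`
on the interval `[v, v.cap]` and zero entries elsewhere, given by a morphism `s`. -/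
def intervalHom {Z : Strip n ⥤ C} (hZ : IsPretriangle Z) (v : Strip n)
    (s : Z.obj v.cap ⟶ Z.obj v) : Z ⟶ Z where
  app w := open Classical in
    if h : v ≤ w ∧ w ≤ v.cap then arr Z h.2 ≫ s ≫ arr Z h.1 else 0
  naturality := by
    intro w w' hw
    replace hw := leOfHom hw
    change arr Z hw ≫ _ = _ ≫ arr Z hw
    by_cases h : v ≤ w ∧ w ≤ v.cap
    · rw [dif_pos h]
      by_cases h' : v ≤ w' ∧ w' ≤ v.cap
      · rw [dif_pos h', ← Category.assoc, arr_comp, Category.assoc, Category.assoc, arr_comp]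
      · rw [dif_neg h', comp_zero, Category.assoc, Category.assoc, arr_comp]
        have h3 : ¬ w' ≤ v.cap := fun h3 => h' ⟨h.1.trans hw, h3⟩
        rw [Strip.le_iff] at h3
        dsimp only [Strip.cap] at h3
        have : arr Z (h.1.trans hw) = 0 := by
          by_cases h4 : v.tgt ≤ w'.src
          · exact hZ.arr_eq_zero_of_src _ h4
          · exact hZ.arr_eq_zero_of_tgt _ (by omega)
        rw [this, comp_zero, comp_zero]
    · rw [dif_neg h, zero_comp]
      by_cases h' : v ≤ w' ∧ w' ≤ v.cap
      · rw [dif_pos h', ← Category.assoc, arr_comp]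
        have h3 : ¬ v ≤ w := fun h3 => h ⟨h3, hw.trans h'.2⟩
        rw [Strip.le_iff] at h3
        have : arr Z (hw.trans h'.2) = 0 := by
          by_cases h4 : w.tgt ≤ v.cap.src
          · exact hZ.arr_eq_zero_of_src _ h4
          · exact hZ.arr_eq_zero_of_tgt _ (by dsimp only [Strip.cap] at h4 ⊢; omega)
        rw [this, zero_comp]
      · rw [dif_neg h', comp_zero]

theorem intervalHom_app {Z : Strip n ⥤ C} (hZ : IsPretriangle Z) {v w : Strip n}
    (s : Z.obj v.cap ⟶ Z.obj v) (h : v ≤ w) (h' : w ≤ v.cap) :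
    (intervalHom hZ v s).app w = arr Z h' ≫ s ≫ arr Z h := dif_pos ⟨h, h'⟩

theorem intervalHom_app_of_not_le {Z : Strip n ⥤ C} (hZ : IsPretriangle Z) {v w : Strip n}
    (s : Z.obj v.cap ⟶ Z.obj v) (h : ¬ (v ≤ w ∧ w ≤ v.cap)) :
    (intervalHom hZ v s).app w = 0 := dif_neg h

/-- In a split pretriangle, finitely many interval summands can be split off. The summand belonging
to `v` is the image of the morphism from `v` to `v.cap`. -/
theorem IsSplitDiagram.exists_idempotent {Z : Strip n ⥤ C} (hZ : IsPretriangle Z)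
    (hs : IsSplitDiagram Z) (A : Set (Strip n)) (hf : A.Finite) (hA : ∀ v ∈ A, 0 < v.tgt) :
    ∃ e : Z ⟶ Z, e ≫ e = e ∧ (∀ w : Strip n, w.tgt ≤ 0 → e.app w = 𝟙 _) ∧
      ∀ v ∈ A, ∀ h : v ≤ v.cap, e.app v ≫ arr Z h = 0 := by
  induction A, hf using Set.Finite.induction_on with
  | empty => exact ⟨𝟙 Z, by simp, by simp, by simp⟩
  | @insert v A hv _ ih =>
    obtain ⟨e, he, he1, he2⟩ := ih fun v hv => hA v (Set.mem_insert_of_mem _ hv)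
    by_cases h : v ≤ v.cap
    swap
    · refine ⟨e, he, he1, ?_⟩
      rintro w (rfl | hw) hw'
      · exact absurd hw' h
      · exact he2 w hw hw'
    -- What is left after splitting off the summands of `A` is the image of `e`. A quasi-inverse `s`
    -- of its morphism from `v` to `v.cap` yields the idempotent belonging to the next summand.
    obtain ⟨s₀, hs₀⟩ := (isSplitInFreyd_iff _).1 (hs h)
    have he' : ∀ w, e.app w ≫ e.app w = e.app w := fun w => by
      rw [← NatTrans.comp_app, he]
    obtain ⟨s, hse, hes, hs1, hs2⟩ :=
      exists_quasiInverse (he' v) (he' v.cap) (arr_naturality e h) hs₀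
    have hRe : intervalHom hZ v s ≫ e = intervalHom hZ v s := by
      ext w
      rw [NatTrans.comp_app]
      by_cases hw : v ≤ w ∧ w ≤ v.cap
      · rw [intervalHom_app hZ s hw.1 hw.2, Category.assoc, Category.assoc, arr_naturality,
          reassoc_of% hse]
      · rw [intervalHom_app_of_not_le hZ s hw, zero_comp]
    have heR : e ≫ intervalHom hZ v s = intervalHom hZ v s := by
      ext w
      rw [NatTrans.comp_app]
      by_cases hw : v ≤ w ∧ w ≤ v.cap
      · rw [intervalHom_app hZ s hw.1 hw.2, ← Category.assoc, ← arr_naturality, Category.assoc,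
          reassoc_of% hes]
      · rw [intervalHom_app_of_not_le hZ s hw, comp_zero]
    have hRR : intervalHom hZ v s ≫ intervalHom hZ v s = intervalHom hZ v s := by
      ext w
      rw [NatTrans.comp_app]
      by_cases hw : v ≤ w ∧ w ≤ v.cap
      · rw [intervalHom_app hZ s hw.1 hw.2]
        have : arr Z hw.1 ≫ arr Z hw.2 = arr Z h := arr_comp _ _ _
        simp only [Category.assoc]
        rw [reassoc_of% this, reassoc_of% hs2]
      · rw [intervalHom_app_of_not_le hZ s hw, comp_zero]
    refine ⟨e - intervalHom hZ v s, ?_, ?_, ?_⟩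
    · rw [Preadditive.sub_comp, Preadditive.comp_sub, Preadditive.comp_sub, he, heR, hRe, hRR]
      abel
    · intro w hw
      have : ¬ (v ≤ w ∧ w ≤ v.cap) := fun h' => by
        have h1 := h'.1.2
        have h2 := hA v (Set.mem_insert _ _)
        omega
      rw [NatTrans.app_sub, he1 w hw, intervalHom_app_of_not_le hZ s this, sub_zero]
    · rintro w (rfl | hw) hw'
      · rw [NatTrans.app_sub, Preadditive.sub_comp, intervalHom_app hZ s le_rfl h, arr_self,
          Category.comp_id, Category.assoc, hs1, sub_self]
      · rw [NatTrans.app_sub, Preadditive.sub_comp, he2 w hw hw', ← hRe, NatTrans.comp_app,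
          Category.assoc, he2 w hw hw', comp_zero, sub_zero]

/-- A split pretriangle has an endomorphism which is the identity at the places `i/0` and zero at
the places `β/α` with `β ≤ 0`: the entries `i/0` and `0/i⁻¹` belong to different interval
summands. -/
theorem IsSplitDiagram.exists_projection {Z : Strip n ⥤ C} (hZ : IsPretriangle Z)
    (hs : IsSplitDiagram Z) :
    ∃ p : Z ⟶ Z, (∀ w : Strip n, w.tgt ≤ 0 → p.app w = 0) ∧
      ∀ w : Strip n, w.src = 0 → p.app w = 𝟙 _ := by
  have hfin : {v : Strip n | v.src ≤ 0 ∧ 0 < v.tgt}.Finite := by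
    have hinj : Function.Injective (fun v : Strip n => (v.src, v.tgt)) := by
      intro v w h
      exact Strip.ext (congrArg Prod.fst h) (congrArg Prod.snd h)
    refine ((Set.finite_Icc (-(n + 1 : ℤ), (0 : ℤ)) (0, n + 1)).preimage hinj.injOn).subset ?_
    intro v hv
    have h1 := v.le
    have h2 := v.le_shift
    have h3 : v.src ≤ 0 ∧ 0 < v.tgt := hv
    change (_ ≤ _ ∧ _ ≤ _) ∧ (_ ≤ _ ∧ _ ≤ _)
    dsimp only
    omega
  obtain ⟨e, he, he1, he2⟩ := hs.exists_idempotent hZ _ hfin (fun v hv => hv.2)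
  have he' : ∀ w, e.app w ≫ e.app w = e.app w := fun w => by
    rw [← NatTrans.comp_app, he]
  -- In the image of `e`, the entries at `i/0` vanish: by induction on `i` and, for fixed `i`,
  -- descending induction on `j`, the morphism from `i/0` to `j/0` is zero. If it is zero for
  -- `(i, j + 1)` and `(i - 1, j)`, then for `(i, j)` it factors over the morphism from some `v` to
  -- `v.cap` that was split off.
  have key : ∀ (i : ℕ) (j : ℤ) (h1 : (i : ℤ) ≤ j) (h2 : j ≤ n + 1),
      e.app ⟨0, i, by omega, by omega⟩ ≫ arr Z (w := ⟨0, j, by omega, by omega⟩)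
        ⟨le_refl _, h1⟩ = 0 := by
    intro i
    induction i with
    | zero =>
      intro j h1 h2
      exact (hZ.isZero_diag 0).eq_of_src _ _
    | succ i ih =>
      intro j h1 h2
      obtain ⟨k, hk⟩ := Int.le.dest h2
      push_cast at h1
      induction k generalizing j with
      | zero =>
        apply IsZero.eq_of_tgt
        have := hZ.isZero_shift 0
        have hj : j = 0 + (n + 1) := by omega
        subst hj
        exact this
      | succ k ihk =>
        have H1 := ihk (j + 1) (by push_cast at hk; omega) (by push_cast at hk ⊢; omega)
          (by omega)
        have H0 := ih j (by omega) h2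
        push_cast at hk
        obtain ⟨l, hl⟩ := hZ.exactAt_src (e := j - n) (a := 0) (c := i + 1) (by omega) (by omega)
          (by omega) (e.app ⟨0, i + 1, by omega, by omega⟩) (by
            have : (⟨0, j - n + (n + 1), by omega, by omega⟩ : Strip n) =
              ⟨0, j + 1, by omega, by omega⟩ := by ext <;> dsimp only; omega
            rw! [this]
            exact H1 (by omega))
        obtain ⟨m, hm⟩ := hZ.coexactAt_tgt (a := 0) (c := i) (d := j) (by omega) (by omega)
          (by omega) (e.app ⟨0, j, by omega, by omega⟩) (by
            rw [arr_naturality]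
            exact H0)
        let v : Strip n := ⟨j - n, i + 1, by omega, by omega⟩
        let w : Strip n := ⟨i, j, by omega, by omega⟩
        have hvw : w = v.cap := by
          ext <;> dsimp only [v, w, Strip.cap] <;> omega
        have hv : v ≤ v.cap := by
          rw [← hvw]; constructor <;> dsimp only [v, w] <;> omega
        have h3 := he2 v ⟨by dsimp only [v]; omega, by dsimp only [v]; omega⟩ hv
        have h3' : e.app v ≫ arr Z (hv.trans hvw.ge) = 0 := by
          rw [← arr_comp Z hv hvw.ge, reassoc_of% h3, zero_comp]
        let x : Strip n := ⟨0, i + 1, by omega, by omega⟩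
        let y : Strip n := ⟨0, j, by omega, by omega⟩
        have hxy : x ≤ y := ⟨le_refl _, h1⟩
        change e.app x ≫ arr Z hxy = 0
        have hvx : v ≤ x := ⟨by dsimp only [v, x]; omega, le_refl _⟩
        have hyw : y ≤ w := ⟨by dsimp only [w, y]; omega, le_refl _⟩
        replace hl : l ≫ arr Z hvx = e.app x := hl
        replace hm : arr Z hyw ≫ m = e.app y := hm
        have e3 : l ≫ e.app v ≫ arr Z hvx = e.app x := by
          rw [← arr_naturality, reassoc_of% hl, he']
        calc e.app x ≫ arr Z hxy = e.app x ≫ arr Z hxy ≫ e.app y := by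
              rw [arr_naturality, reassoc_of% (he' x)]
          _ = l ≫ (e.app v ≫ arr Z (hv.trans hvw.ge)) ≫ m := by
              rw [← hm, ← e3, Category.assoc, Category.assoc, Category.assoc,
                ← Category.assoc (arr Z hxy), arr_comp, ← Category.assoc (arr Z hvx), arr_comp]
          _ = 0 := by rw [h3', zero_comp, comp_zero]
  refine ⟨𝟙 Z - e, fun w hw => ?_, fun w hw => ?_⟩
  · rw [NatTrans.app_sub, he1 w hw, NatTrans.id_app, sub_self]
  · obtain ⟨a, b, h1, h2⟩ := w
    dsimp only at hw
    subst hw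
    obtain ⟨i, rfl⟩ := Int.eq_ofNat_of_zero_le h1
    have := key i i le_rfl (by omega)
    rw [arr_self, Category.comp_id] at this
    rw [NatTrans.app_sub, this, NatTrans.id_app, sub_zero]

/-- If two morphisms of pretriangles agree in the stable category, then their difference on the
places `i/0` extends to a morphism that vanishes on the places `β/α` with `β ≤ 0`, hence on the
places `0/i⁻¹`. -/
theorem exists_correction {X Y : Pretriangle C n} {f g : X ⟶ Y}
    (h : (toStable C n).map f = (toStable C n).map g) :
    ∃ d : X ⟶ Y, (∀ w : Strip n, w.tgt ≤ 0 → d.hom.app w = 0) ∧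
      ∀ w : Strip n, w.src = 0 → d.hom.app w = f.hom.app w - g.hom.app w := by
  have h' : Relation.EqvGen (@HomRel.CompClosure _ _ (stableRel C n) X Y) f g :=
    Quot.eqvGen_exact (r := @HomRel.CompClosure _ _ (stableRel C n) X Y) h
  clear h
  induction h' with
  | rel f g h =>
    obtain ⟨x, y, l, m₁, m₂, r, Z, hZ, a, b, hab⟩ := h
    obtain ⟨p, hp, hp'⟩ := hZ.exists_projection Z.property
    refine ⟨l ≫ a ≫ ⟨p⟩ ≫ b ≫ r, fun w hw => ?_, fun w hw => ?_⟩
    · simp [hp w hw]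
    · have h1 : m₁.hom.app w - m₂.hom.app w = a.hom.app w ≫ b.hom.app w :=
        congrArg (fun t => t.hom.app w) hab
      have h2 : l.hom.app w ≫ a.hom.app w ≫ p.app w ≫ b.hom.app w ≫ r.hom.app w =
          l.hom.app w ≫ m₁.hom.app w ≫ r.hom.app w - l.hom.app w ≫ m₂.hom.app w ≫ r.hom.app w := by
        rw [hp' w hw, Category.id_comp, ← Preadditive.comp_sub, ← Preadditive.sub_comp, h1,
          Category.assoc]
      exact h2
  | refl f => exact ⟨0, fun w _ => rfl, fun w _ => (sub_self _).symm⟩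
  | symm f g _ ih =>
    obtain ⟨d, h1, h2⟩ := ih
    refine ⟨-d, fun w hw => ?_, fun w hw => ?_⟩
    · change -d.hom.app w = 0
      rw [h1 w hw, neg_zero]
    · change -d.hom.app w = _
      rw [h2 w hw, neg_sub]
  | trans f g k _ _ ih ih' =>
    obtain ⟨d, h1, h2⟩ := ih
    obtain ⟨d', h1', h2'⟩ := ih'
    refine ⟨d + d', fun w hw => ?_, fun w hw => ?_⟩
    · change d.hom.app w + d'.hom.app w = 0
      rw [h1 w hw, h1' w hw, add_zero]
    · change d.hom.app w + d'.hom.app w = _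
      rw [h2 w hw, h2' w hw, sub_add_sub_cancel]

end Split

/-! ### Periodic morphisms -/

section Periodic

variable {C : Type u} [Category.{v} C] [Preadditive C] {n : ℕ} (T : CatAut C)

theorem Strip.shift_mono {v w : Strip n} (h : v ≤ w) : Strip.shift n v ≤ Strip.shift n w :=
  (Strip.shift n).monotone h

/-- An isomorphism between the outer and the inner shift of a diagram on the strip. -/
structure Periodicity (T : CatAut C) (X : Strip n ⥤ C) where
  iso : ∀ v, X.obj (Strip.shift n v) ≅ T.functor.obj (X.obj v)
  naturality : ∀ {v w : Strip n} (h : v ≤ w),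
    arr X (Strip.shift_mono h) ≫ (iso w).hom = (iso v).hom ≫ T.functor.map (arr X h)

/-- The outer and the inner shift of `f` agree up to the isomorphisms `eX` and `eY`. -/
def Periodicity.IsHom {T : CatAut C} {X Y : Strip n ⥤ C} (eX : Periodicity T X)
    (eY : Periodicity T Y) (f : X ⟶ Y) : Prop :=
  ∀ v, f.app (Strip.shift n v) ≫ (eY.iso v).hom = (eX.iso v).hom ≫ T.functor.map (f.app v)

omit [Preadditive C] in
/-- The outer shift is full. -/
theorem exists_whiskerLeft_shift_eq {X Y : Strip n ⥤ C}
    (g : Strip.shiftFunctor n ⋙ X ⟶ Strip.shiftFunctor n ⋙ Y) :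
    ∃ f : X ⟶ Y, Functor.whiskerLeft (Strip.shiftFunctor n) f = g := by
  have hex : ∀ v, ∃ x : X.obj v ⟶ Y.obj v, ∀ w, Strip.shift n w = v → x ≍ g.app w := by
    intro v
    obtain ⟨w, rfl⟩ := (Strip.shift n).surjective v
    refine ⟨g.app w, fun w' hw' => ?_⟩
    obtain rfl : w' = w := (Strip.shift n).injective hw'
    rfl
  choose f hf' using hex
  have hf : ∀ w, f (Strip.shift n w) = g.app w := fun w => eq_of_heq (hf' _ w rfl)
  refine ⟨⟨f, ?_⟩, by ext w; exact hf w⟩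
  intro v w h
  obtain ⟨v, rfl⟩ := (Strip.shift n).surjective v
  obtain ⟨w, rfl⟩ := (Strip.shift n).surjective w
  have h' : v ≤ w := (Strip.shift n).le_iff_le.1 (leOfHom h)
  rw [hf, hf]
  exact g.naturality (homOfLE h')

variable [WeaklyAbelian C] {T} {X Y : Strip n ⥤ C}

/-- A morphism of pretriangles which is periodic on the places `i/0` may be changed outside of
these places into a periodic morphism. -/
theorem IsPretriangle.exists_periodic (hX : IsPretriangle X) (hY : IsPretriangle Y)
    (eX : Periodicity T X) (eY : Periodicity T Y) (f : X ⟶ Y)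
    (hf : ∀ i : DotDelta n, f.app (Strip.shift n ((dotEmb n).obj i)) ≫ (eY.iso _).hom =
      (eX.iso _).hom ≫ T.functor.map (f.app ((dotEmb n).obj i))) :
    ∃ g : X ⟶ Y, eX.IsHom eY g ∧ ∀ v : Strip n, v.level = 0 → g.app v = f.app v := by
  let step : ∀ v, (X.obj v ⟶ Y.obj v) → (X.obj (Strip.shift n v) ⟶ Y.obj (Strip.shift n v)) :=
    fun v x => (eX.iso v).hom ≫ T.functor.map x ≫ (eY.iso v).inv
  have hstep : ∀ v, Function.Bijective (step v) := by
    intro v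
    constructor
    · intro x y hxy
      apply T.functor.map_injective
      dsimp only [step] at hxy
      rwa [cancel_epi, cancel_mono] at hxy
    · intro y
      obtain ⟨x, hx⟩ := T.functor.map_surjective ((eX.iso v).inv ≫ y ≫ (eY.iso v).hom)
      refine ⟨x, ?_⟩
      dsimp only [step]
      rw [hx]
      simp
  obtain ⟨g, hg1, hg2⟩ := Strip.exists_equivariant step hstep fun v => f.app v
  -- `g` continues `f` periodically from the fundamental domain; its naturality is the point
  have hper : ∀ v, g (Strip.shift n v) ≫ (eY.iso v).hom = (eX.iso v).hom ≫ T.functor.map (g v) := by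
    intro v
    rw [hg1]
    simp [step]
  have hshift : ∀ {v w : Strip n} (h : v ≤ w),
      arr X (Strip.shift_mono h) ≫ g (Strip.shift n w) =
        g (Strip.shift n v) ≫ arr Y (Strip.shift_mono h) ↔
      arr X h ≫ g w = g v ≫ arr Y h := by
    intro v w h
    rw [← cancel_mono (eY.iso w).hom, Category.assoc, Category.assoc, hper w, eY.naturality,
      reassoc_of% (eX.naturality h), reassoc_of% (hper v), cancel_epi, ← T.functor.map_comp,
      ← T.functor.map_comp]
    exact T.functor.map_injective.eq_iff
  have hnat : ∀ v w : Strip n, ∀ h : v ≤ w, arr X h ≫ g w = g v ≫ arr Y h := by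
    intro v
    induction v using Strip.induction_shift with
    | h v =>
      constructor
      · intro H w h
        exact (hshift h).1 (H _ _)
      · intro H w h
        obtain ⟨w, rfl⟩ := (Strip.shift n).surjective w
        exact (hshift ((Strip.shift n).le_iff_le.1 h)).2 (H _ _)
    | h0 v hv =>
      intro w h
      have hw := Strip.level_mono h
      obtain ⟨hv1, hv2⟩ := Strip.level_eq_zero_iff.1 hv
      have hv3 := v.le
      rw [hv] at hw
      rcases (by omega : w.level = 0 ∨ w.level = 1 ∨ 2 ≤ w.level) with h0 | h1 | h2
      · rw [hg2 v hv, hg2 w h0]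
        exact arr_naturality f h
      · -- the morphism from `v` to `w` factors over the shift of a place `i/0`
        obtain ⟨hw1, hw2, hw3⟩ := Strip.of_level_eq_one h1
        obtain ⟨w, rfl⟩ := (Strip.shift n).surjective w
        rw [Strip.level_shift] at h1
        have h1' : w.level = 0 := by omega
        let y : Strip n := ⟨0, v.src, hv1, by omega⟩
        have hy : y.level = 0 := Strip.level_eq_zero_iff.2
          ⟨le_refl _, by change v.src < _; omega⟩
        have hyw : y ≤ w := by
          have h2 : v.src ≤ w.tgt := h.1
          exact ⟨(Strip.level_eq_zero_iff.1 h1').1, h2⟩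
        have hvy : v ≤ Strip.shift n y := ⟨le_refl _, by
          change v.tgt ≤ 0 + (n + 1); omega⟩
        have hgy : g (Strip.shift n y) = f.app (Strip.shift n y) := by
          by_cases hs : v.src = 0
          · refine IsZero.eq_of_src (IsZero.of_iso (hX.isZero_shift 0) (X.mapIso (eqToIso ?_))) _ _
            ext
            · exact hs
            · rfl
          · have := hf ⟨v.src, by omega, by omega⟩
            rw [← cancel_mono ((eY.iso y).hom), hper, hg2 y hy]
            exact this.symm
        have e1 : arr X hvy ≫ g (Strip.shift n y) = g v ≫ arr Y hvy := by
          rw [hgy, hg2 v hv]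
          exact arr_naturality f hvy
        have e2 := (hshift hyw).2 (by
          rw [hg2 y hy, hg2 w h1']
          exact arr_naturality f hyw)
        rw [← arr_comp X hvy (Strip.shift_mono hyw),
          ← arr_comp Y hvy (Strip.shift_mono hyw), Category.assoc, e2,
          reassoc_of% e1]
      · have := Strip.of_two_le_level h2
        rw [hX.arr_eq_zero_of_src h (by omega), hY.arr_eq_zero_of_src h (by omega), zero_comp,
          comp_zero]
  exact ⟨⟨g, fun v w h => hnat v w (leOfHom h)⟩, hper, hg2⟩

/-- The five lemma for morphisms of pretriangles. -/
theorem IsPretriangle.isIso_app (hX : IsPretriangle X) (hY : IsPretriangle Y) (f : X ⟶ Y)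
    {e a b : ℤ} (h1 : e ≤ a) (h2 : a ≤ b) (h3 : b ≤ e + (n + 1))
    (i1 : IsIso (f.app ⟨e, a, by omega, by omega⟩)) (i2 : IsIso (f.app ⟨e, b, by omega, by omega⟩))
    (i3 : IsIso (f.app ⟨a, e + (n + 1), by omega, by omega⟩))
    (i4 : IsIso (f.app ⟨b, e + (n + 1), by omega, by omega⟩)) :
    IsIso (f.app ⟨a, b, by omega, by omega⟩) := by
  let A : Strip n := ⟨e, a, by omega, by omega⟩
  let B : Strip n := ⟨e, b, by omega, by omega⟩
  let M : Strip n := ⟨a, b, by omega, by omega⟩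
  let D : Strip n := ⟨a, e + (n + 1), by omega, by omega⟩
  let E : Strip n := ⟨b, e + (n + 1), by omega, by omega⟩
  have hAB : A ≤ B := ⟨le_refl _, h2⟩
  have hBM : B ≤ M := ⟨h1, le_refl _⟩
  have hMD : M ≤ D := ⟨le_refl _, h3⟩
  have hDE : D ≤ E := ⟨h2, le_refl _⟩
  change IsIso (f.app A) at i1
  change IsIso (f.app B) at i2
  change IsIso (f.app D) at i3
  change IsIso (f.app E) at i4
  change IsIso (f.app M)
  have xM : ExactAt X hBM hMD := hX.exactAt_src h1 h2 h3
  have yM : ExactAt Y hBM hMD := hY.exactAt_src h1 h2 h3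
  have yB : ExactAt Y hAB hBM := hY.exactAt_tgt h1 h2 h3
  have xD : ExactAt X hMD hDE := hX.exactAt_tgt h2 h3 (by omega)
  have hinj : ∀ {S : C} (t : S ⟶ X.obj M), t ≫ f.app M = 0 → t = 0 := by
    intro S t ht
    obtain ⟨s, hs⟩ := xM t (by
      rw [← cancel_mono (f.app D), Category.assoc, arr_naturality, reassoc_of% ht, zero_comp,
        zero_comp])
    obtain ⟨r, hr⟩ := yB (s ≫ f.app B) (by
      rw [Category.assoc, ← arr_naturality, reassoc_of% hs, ht])
    have : s = (r ≫ inv (f.app A)) ≫ arr X hAB := by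
      rw [← cancel_mono (f.app B), ← hr, Category.assoc, Category.assoc, arr_naturality,
        IsIso.inv_hom_id_assoc]
    rw [← hs, this, Category.assoc, arr_comp, hX.arr_eq_zero_of_src _ le_rfl, comp_zero]
  obtain ⟨s, hs⟩ : ∃ s : Y.obj M ⟶ X.obj M, s ≫ f.app M = 𝟙 _ := by
    obtain ⟨q, hq⟩ := xD (arr Y hMD ≫ inv (f.app D)) (by
      rw [← cancel_mono (f.app E), Category.assoc, Category.assoc, arr_naturality,
        IsIso.inv_hom_id_assoc, arr_comp, hY.arr_eq_zero_of_src _ le_rfl, zero_comp])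
    obtain ⟨r, hr⟩ := yM (𝟙 _ - q ≫ f.app M) (by
      rw [Preadditive.sub_comp, Category.id_comp, Category.assoc, ← arr_naturality,
        reassoc_of% hq, IsIso.inv_hom_id, Category.comp_id, sub_self])
    refine ⟨q + (r ≫ inv (f.app B)) ≫ arr X hBM, ?_⟩
    rw [Preadditive.add_comp, Category.assoc, Category.assoc, arr_naturality,
      IsIso.inv_hom_id_assoc, hr]
    abel
  refine ⟨s, ?_, hs⟩
  rw [← sub_eq_zero]
  apply hinj
  rw [Preadditive.sub_comp, Category.assoc, hs, Category.comp_id, Category.id_comp, sub_self]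

end Periodic

namespace PerPretriangle

variable {C : Type u} [Category.{v} C] [Preadditive C] [WeaklyAbelian C] {n : ℕ} {T : CatAut C}

/-- The identity `[X]⁺¹ = [X⁺¹]` of a periodic pretriangle, as an isomorphism. -/
def periodicity (X : PerPretriangle T n) : Periodicity T X.obj.obj where
  iso v :=
    { hom := (eqToHom X.periodic).hom.app v
      inv := (eqToHom X.periodic.symm).hom.app v
      hom_inv_id := congrArg (fun t => t.hom.app v) (eqToHom_trans X.periodic X.periodic.symm)
      inv_hom_id := congrArg (fun t => t.hom.app v) (eqToHom_trans X.periodic.symm X.periodic) }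
  naturality h := (eqToHom X.periodic).hom.naturality (homOfLE h)

theorem periodic_iff {X Y : PerPretriangle T n} (f : X.obj ⟶ Y.obj) :
    (outer C n).map f ≫ eqToHom Y.periodic = eqToHom X.periodic ≫ (inner T n).map f ↔
      X.periodicity.IsHom Y.periodicity f.hom := by
  constructor
  · intro h v
    exact congrArg (fun t => t.hom.app v) h
  · intro h
    ext v
    exact h v

theorem hom_app_shift {X Y : PerPretriangle T n} (f : X ⟶ Y) (v : Strip n) :
    f.hom.hom.app (Strip.shift n v) ≫ (Y.periodicity.iso v).hom =
        (X.periodicity.iso v).hom ≫ T.functor.map (f.hom.hom.app v) :=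
  (periodic_iff f.hom).1 f.periodic v

theorem isIso_of_isIso_hom {X Y : PerPretriangle T n} (f : X ⟶ Y) (hf : IsIso f.hom) :
    IsIso f := by
  refine ⟨⟨inv f.hom, ?_⟩, ?_, ?_⟩
  · rw [Functor.map_inv, Functor.map_inv, IsIso.inv_comp_eq, ← Category.assoc, f.periodic,
      Category.assoc]
    simp
  · ext1
    simp
  · ext1
    simp

theorem isIso_hom_of_isIso_app {X Y : Pretriangle C n} (f : X ⟶ Y)
    (hf : ∀ v, IsIso (f.hom.app v)) : IsIso f := by
  have : IsIso f.hom := NatIso.isIso_of_isIso_app _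
  have : IsIso ((ObjectProperty.ι _).map f) := this
  exact (ObjectProperty.fullyFaithfulι _).isIso_of_isIso_map f

/-- The entry at `β/α` is reached by the five lemma from the entries `α/0`, `β/0` and their
shifts. -/
theorem isIso_of_isIso_toDot {X Y : PerPretriangle T n} (f : X ⟶ Y)
    (hf : IsIso ((PerPretriangle.toDot T n).map f)) : IsIso f := by
  apply isIso_of_isIso_hom
  apply isIso_hom_of_isIso_app
  have hX := X.obj.property
  have hY := Y.obj.property
  have hshift : ∀ v, IsIso (f.hom.hom.app (Strip.shift n v)) ↔ IsIso (f.hom.hom.app v) := by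
    intro v
    have h := hom_app_shift f v
    constructor
    · intro _
      have : IsIso (T.functor.map (f.hom.hom.app v)) := by
        rw [← IsIso.inv_comp_eq] at h
        rw [← h]
        infer_instance
      exact isIso_of_reflects_iso _ T.functor
    · intro _
      rw [← IsIso.eq_comp_inv] at h
      rw [h]
      infer_instance
  have hrow : ∀ (a : ℤ) (h1 : 0 ≤ a) (h2 : a < n + 1),
      IsIso (f.hom.hom.app ⟨0, a, h1, by omega⟩) := by
    intro a h1 h2
    by_cases ha : a = 0
    · subst ha
      exact (hX.isZero_diag 0).isIso (hY.isZero_diag 0) _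
    · exact inferInstanceAs
        (IsIso (((PerPretriangle.toDot T n).map f).app ⟨a, by omega, by omega⟩))
  intro v
  induction v using Strip.induction_shift with
  | h v => exact hshift v
  | h0 v hv =>
    obtain ⟨a, b, h1, h2⟩ := v
    obtain ⟨h3, h4⟩ := Strip.level_eq_zero_iff.1 hv
    dsimp only at h3 h4
    exact hX.isIso_app hY f.hom.hom h3 h1 (by omega) (hrow a h3 (by omega))
      (hrow b (by omega) h4) ((hshift _).2 (hrow a h3 (by omega)))
      ((hshift _).2 (hrow b (by omega) h4))

end PerPretriangle

/-! ### Morphisms and direct sums of triangles -/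

section Triangle

variable {C : Type u} [Category.{v} C] [Preadditive C] [WeaklyAbelian C] {T : CatAut C}
  (H : HellerTriangulation T) {n m : ℕ}

/-- The component of a Heller triangulation at a pretriangle. -/
def HellerTriangulation.app (X : Pretriangle C n) :
    (toStable C n).obj ((outer C n).obj X) ⟶ (toStable C n).obj ((inner T n).obj X) :=
  (H.θ n).hom.app ((toStable C n).obj X)

theorem HellerTriangulation.naturality {X Y : Pretriangle C n} (f : X ⟶ Y) :
    (toStable C n).map ((outer C n).map f) ≫ H.app Y =
      H.app X ≫ (toStable C n).map ((inner T n).map f) :=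
  (H.θ n).hom.naturality ((toStable C n).map f)

variable {H}

theorem isTriangle_iff {X : PerPretriangle T n} :
    IsTriangle H X ↔ H.app X.obj = (toStable C n).map (eqToHom X.periodic) := Iff.rfl

/-- A morphism between triangles is periodic in the stable category. -/
theorem IsTriangle.stable_periodic {X Y : PerPretriangle T n} (hX : IsTriangle H X)
    (hY : IsTriangle H Y) (f : X.obj ⟶ Y.obj) :
    (toStable C n).map ((outer C n).map f ≫ eqToHom Y.periodic) =
      (toStable C n).map (eqToHom X.periodic ≫ (inner T n).map f) := by
  have h := H.naturality f
  rwa [isTriangle_iff.1 hX, isTriangle_iff.1 hY, ← Functor.map_comp, ← Functor.map_comp] at h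

/-- Every morphism between the restrictions of triangles to `{1, …, n}` extends to a morphism of
triangles. -/
theorem IsTriangle.exists_extension {X Y : PerPretriangle T n} (hX : IsTriangle H X)
    (hY : IsTriangle H Y)
    (t : (PerPretriangle.toDot T n).obj X ⟶ (PerPretriangle.toDot T n).obj Y) :
    ∃ f : X ⟶ Y, (PerPretriangle.toDot T n).map f = t := by
  obtain ⟨f, hf⟩ := X.obj.property.exists_extension Y.obj.property t
  obtain ⟨d, hd1, hd2⟩ := exists_correction (hX.stable_periodic hY ⟨f⟩)
  have hd2' : ∀ i : DotDelta n, d.hom.app ((dotEmb n).obj i) =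
      f.app (Strip.shift n ((dotEmb n).obj i)) ≫ (Y.periodicity.iso _).hom -
        (X.periodicity.iso _).hom ≫ T.functor.map (f.app ((dotEmb n).obj i)) :=
    fun i => hd2 _ rfl
  let d' : ∀ v, X.obj.obj.obj (Strip.shift n v) ⟶ T.functor.obj (Y.obj.obj.obj v) :=
    fun v => d.hom.app v
  -- `k` is `d` read along the inverse of the outer shift; `f - k` is periodic on the places `i/0`
  obtain ⟨k, hk⟩ : ∃ k : X.obj.obj ⟶ Y.obj.obj, Functor.whiskerLeft (Strip.shiftFunctor n) k =
      (d ≫ eqToHom Y.periodic.symm).hom := exists_whiskerLeft_shift_eq _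
  have hk' : ∀ v, k.app (Strip.shift n v) = d' v ≫ (Y.periodicity.iso v).inv :=
    fun v => congrArg (fun t => t.app v) hk
  have hk0 : ∀ v : Strip n, v.src = 0 → k.app v = 0 := by
    intro v hv
    obtain ⟨v, rfl⟩ := (Strip.shift n).surjective v
    have hv' : v.tgt = 0 := hv
    have : d' v = 0 := hd1 v hv'.le
    rw [hk', this, zero_comp]
  obtain ⟨g, hg1, hg2⟩ := X.obj.property.exists_periodic Y.obj.property X.periodicity
    Y.periodicity (f - k : X.obj.obj ⟶ Y.obj.obj) (by
      intro i
      have h1 : d' ((dotEmb n).obj i) = _ := hd2' i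
      rw [NatTrans.app_sub, NatTrans.app_sub, hk', hk0 _ rfl, sub_zero, Preadditive.sub_comp,
        Category.assoc, Iso.inv_hom_id, h1, Category.comp_id]
      exact sub_sub_cancel _ _)
  refine ⟨⟨⟨g⟩, (PerPretriangle.periodic_iff _).2 hg1⟩, ?_⟩
  rw [← hf]
  ext i
  have hi : ((dotEmb n).obj i).level = 0 := by
    have h := i.2
    exact Strip.level_eq_zero_iff.2 ⟨le_refl _, Int.lt_add_one_of_le i.2.2⟩
  change g.app ((dotEmb n).obj i) = f.app ((dotEmb n).obj i)
  rw [hg2 _ hi, NatTrans.app_sub, hk0 _ rfl, sub_zero]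

/-- Isomorphisms between the restrictions of triangles to `{1, …, n}` lift. -/
theorem Triangle.exists_iso {X Y : Triangle H n}
    (w : (Triangle.toDot H n).obj X ≅ (Triangle.toDot H n).obj Y) :
    ∃ w' : X ≅ Y, (Triangle.toDot H n).mapIso w' = w := by
  obtain ⟨f, hf⟩ := X.property.exists_extension Y.property w.hom
  have : IsIso f := PerPretriangle.isIso_of_isIso_toDot f (by rw [hf]; infer_instance)
  refine ⟨(ObjectProperty.fullyFaithfulι _).preimageIso (asIso f), ?_⟩
  ext1
  exact hf

/-- A direct summand of a triangle is a triangle. -/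
theorem IsTriangle.of_retract {X Y : PerPretriangle T n} (i : X ⟶ Y) (p : Y ⟶ X)
    (hip : i ≫ p = 𝟙 X) (hY : IsTriangle H Y) : IsTriangle H X := by
  have h2 : i.hom ≫ p.hom = 𝟙 _ := congrArg (fun t => t.hom) hip
  have h3 : (inner T n).map i.hom ≫ (inner T n).map p.hom = 𝟙 _ := by
    rw [← Functor.map_comp, h2, CategoryTheory.Functor.map_id]
  rw [isTriangle_iff] at hY ⊢
  calc H.app X.obj
      = H.app X.obj ≫ (toStable C n).map ((inner T n).map i.hom ≫ (inner T n).map p.hom) := by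
        rw [h3, CategoryTheory.Functor.map_id, Category.comp_id]
    _ = (toStable C n).map (((outer C n).map i.hom ≫ eqToHom Y.periodic) ≫
          (inner T n).map p.hom) := by
        rw [Functor.map_comp, ← Category.assoc, ← H.naturality, hY, ← Functor.map_comp,
          ← Functor.map_comp]
    _ = (toStable C n).map (eqToHom X.periodic) := by
        rw [i.periodic, Category.assoc, h3, Category.comp_id]

theorem toStable_map_eq {X Y : Pretriangle C n} {f g : X ⟶ Y} {Z : Pretriangle C n}
    (hZ : IsSplitDiagram Z.obj) (a : X ⟶ Z) (b : Z ⟶ Y) (h : f - g = a ≫ b) :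
    (toStable C n).map f = (toStable C n).map g :=
  CategoryTheory.Quotient.sound _ ⟨Z, hZ, a, b, h⟩

/-- The congruence defining the stable category is compatible with addition. The equivalence
relation generated by `stableRel` has to be unfolded for this. -/
theorem toStable_map_add_right {X Y : Pretriangle C n} {f g : X ⟶ Y}
    (h : (toStable C n).map f = (toStable C n).map g) (k : X ⟶ Y) :
    (toStable C n).map (f + k) = (toStable C n).map (g + k) := by
  have h' : Relation.EqvGen (@HomRel.CompClosure _ _ (stableRel C n) X Y) f g :=
    Quot.eqvGen_exact (r := @HomRel.CompClosure _ _ (stableRel C n) X Y) h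
  clear h
  induction h' with
  | rel f g h =>
    obtain ⟨x, y, l, m₁, m₂, r, Z, hZ, a, b, hab⟩ := h
    refine toStable_map_eq hZ (l ≫ a) (b ≫ r) ?_
    rw [add_sub_add_right_eq_sub, ← Preadditive.comp_sub, ← Preadditive.sub_comp, hab]
    simp
  | refl f => rfl
  | symm f g _ ih => exact ih.symm
  | trans f g k _ _ ih ih' => exact ih.trans ih'

theorem toStable_map_add {X Y : Pretriangle C n} {f g f' g' : X ⟶ Y}
    (h : (toStable C n).map f = (toStable C n).map g)
    (h' : (toStable C n).map f' = (toStable C n).map g') :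
    (toStable C n).map (f + f') = (toStable C n).map (g + g') := by
  rw [toStable_map_add_right h, add_comm g f', add_comm g g', toStable_map_add_right h']

/-- A direct sum of triangles is a triangle. -/
theorem IsTriangle.of_sum {X Y Z : PerPretriangle T n} (p : Z ⟶ X) (q : Z ⟶ Y) (i : X ⟶ Z)
    (j : Y ⟶ Z) (h : p ≫ i + q ≫ j = 𝟙 Z) (hX : IsTriangle H X) (hY : IsTriangle H Y) :
    IsTriangle H Z := by
  obtain ⟨t, ht⟩ : ∃ t : (outer C n).obj Z.obj ⟶ (inner T n).obj Z.obj,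
      (toStable C n).map t = H.app Z.obj := (toStable C n).map_surjective _
  have h1 : p.hom ≫ i.hom + q.hom ≫ j.hom = 𝟙 _ := congrArg (fun t => t.hom) h
  have h2 : ((inner T n).map p.hom ≫ (inner T n).map i.hom) +
      ((inner T n).map q.hom ≫ (inner T n).map j.hom) = 𝟙 _ := by
    rw [← Functor.map_comp, ← Functor.map_comp, ← Functor.map_add, h1,
      CategoryTheory.Functor.map_id]
  have key : ∀ {W : PerPretriangle T n} (r : Z ⟶ W), IsTriangle H W →
      (toStable C n).map (t ≫ (inner T n).map r.hom) =
        (toStable C n).map (eqToHom Z.periodic ≫ (inner T n).map r.hom) := by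
    intro W r hW
    rw [← r.periodic, Functor.map_comp, Functor.map_comp, ht, ← H.naturality,
      isTriangle_iff.1 hW]
  -- `t` and the identity agree after composition with each of the projections, hence agree
  rw [isTriangle_iff, ← ht, ← Category.comp_id t, ← Category.comp_id (eqToHom Z.periodic), ← h2,
    Preadditive.comp_add, Preadditive.comp_add, ← Category.assoc, ← Category.assoc,
    ← Category.assoc, ← Category.assoc]
  refine toStable_map_add ?_ ?_
  · rw [Functor.map_comp, key p hX, ← Functor.map_comp]
  · rw [Functor.map_comp, key q hY, ← Functor.map_comp]

/-- Both shifts of a split pretriangle are split, so all morphisms between them are identified in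
the stable category. -/
theorem IsTriangle.of_isSplitDiagram {X : PerPretriangle T n} (hX : IsSplitDiagram X.obj.obj) :
    IsTriangle H X := by
  obtain ⟨t, ht⟩ : ∃ t : (outer C n).obj X.obj ⟶ (inner T n).obj X.obj,
      (toStable C n).map t = H.app X.obj := (toStable C n).map_surjective _
  rw [isTriangle_iff, ← ht]
  exact toStable_map_eq (Z := (outer C n).obj X.obj) (fun _ _ h => hX (Strip.shift_mono h)) (𝟙 _)
    (t - eqToHom X.periodic) (Category.id_comp _).symm

theorem IsTriangle.of_isZero {X : PerPretriangle T n} (hX : IsZero X) : IsTriangle H X := by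
  apply IsTriangle.of_isSplitDiagram
  intro v w h
  have h1 : 𝟙 (X.obj.obj.obj v) = 0 :=
    congrArg (fun t : X ⟶ X => t.hom.hom.app v) (hX.eq_of_src (𝟙 X) 0)
  refine (isSplitInFreyd_iff _).2 ⟨0, ?_⟩
  rw [zero_comp, comp_zero, ← Category.id_comp (arr _ h), h1, zero_comp]

theorem IsTriangle.restrict {X : PerPretriangle T n} (p : PeriodicMap m n) (hX : IsTriangle H X) :
    IsTriangle H (PerPretriangle.restrict p X) := by
  have h := H.restrict_comm p X.obj
  rw [hX] at h
  have h' : (toStable C m).map ((Heller.restrict C p).map (eqToHom X.periodic)) =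
    (toStable C m).map (eqToHom (restrict_outer p X.obj)) ≫
      H.app ((Heller.restrict C p).obj X.obj) ≫
        (toStable C m).map (eqToHom (restrict_inner T p X.obj).symm) := h
  rw [isTriangle_iff]
  have e1 : (toStable C m).map (eqToHom (restrict_outer p X.obj).symm) ≫
      (toStable C m).map (eqToHom (restrict_outer p X.obj)) = 𝟙 _ := by
    rw [← Functor.map_comp, eqToHom_trans, eqToHom_refl, CategoryTheory.Functor.map_id]
  have e2 : (toStable C m).map (eqToHom (restrict_inner T p X.obj).symm) ≫
      (toStable C m).map (eqToHom (restrict_inner T p X.obj)) = 𝟙 _ := by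
    rw [← Functor.map_comp, eqToHom_trans, eqToHom_refl, CategoryTheory.Functor.map_id]
  have h2 := congrArg (fun t => (toStable C m).map (eqToHom (restrict_outer p X.obj).symm) ≫ t ≫
    (toStable C m).map (eqToHom (restrict_inner T p X.obj))) h'
  simp only [Category.assoc] at h2
  rw [reassoc_of% e1, e2, Category.comp_id, ← Functor.map_comp, ← Functor.map_comp,
    eqToHom_map, eqToHom_trans, eqToHom_trans] at h2
  exact h2.symm

theorem IsTriangle.of_folding {X : PerPretriangle T (2 * n + 1)} {Y : PerPretriangle T (n + 1)}
    (F : Folding X.obj.obj Y.obj.obj) (hF : F.IsPeriodic) (hX : IsTriangle H X) :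
    IsTriangle H Y :=
  (H.fold_comm X.obj Y.obj F _ _ hF hX.symm).symm

end Triangle

/-! ### Strictification -/

section Strictification

variable {C : Type u} [Category.{v} C] {n : ℕ} {T : CatAut C}

theorem CatAut.exists_obj_eq (T : CatAut C) (B : C) : ∃ A, T.functor.obj A = B :=
  ⟨T.inverse.obj B, congrArg (fun G : C ⥤ C => G.obj B) T.inverse_functor⟩

theorem CatAut.obj_injective (T : CatAut C) : Function.Injective T.functor.obj := by
  intro A B h
  have hA : T.inverse.obj (T.functor.obj A) = A :=
    congrArg (fun G : C ⥤ C => G.obj A) T.functor_inverse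
  have hB : T.inverse.obj (T.functor.obj B) = B :=
    congrArg (fun G : C ⥤ C => G.obj B) T.functor_inverse
  rw [← hA, h, hB]

theorem sigma_iso_hom {B : C} {x y : Σ A : C, A ≅ B} (h : x = y) :
    x.2.hom = eqToHom (congrArg Sigma.fst h) ≫ y.2.hom := by
  subst h
  simp

theorem sigma_iso_inv {B : C} {x y : Σ A : C, A ≅ B} (h : x = y) :
    x.2.inv = y.2.inv ≫ eqToHom (congrArg Sigma.fst h).symm := by
  subst h
  simp

/-- A diagram whose outer shift is isomorphic to its inner shift is isomorphic to a diagram whose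
outer shift is equal to its inner shift. -/
theorem Periodicity.exists_strict {W : Strip n ⥤ C} (P : Periodicity T W) :
    ∃ (Y : Strip n ⥤ C) (σ : Y ≅ W) (h : Strip.shiftFunctor n ⋙ Y = Y ⋙ T.functor),
      ∀ v, (σ.app (Strip.shift n v)).hom ≫ (P.iso v).hom =
        (eqToHom h).app v ≫ T.functor.map (σ.app v).hom := by
  -- An entry of `Y` is an object with an isomorphism to the entry of `W`. That `T` is bijective on
  -- objects makes these data bijectively transportable along the shift.
  let step : ∀ v, (Σ A : C, A ≅ W.obj v) → Σ A : C, A ≅ W.obj (Strip.shift n v) :=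
    fun v x => ⟨T.functor.obj x.1, T.functor.mapIso x.2 ≪≫ (P.iso v).symm⟩
  have hstep : ∀ v, Function.Bijective (step v) := by
    intro v
    constructor
    · rintro ⟨A, φ⟩ ⟨A', φ'⟩ h
      have h1 : T.functor.obj A = T.functor.obj A' := congrArg Sigma.fst h
      obtain rfl := T.obj_injective h1
      have h2 := eq_of_heq (Sigma.mk.inj h).2
      have h3 : T.functor.map φ.hom ≫ (P.iso v).inv = T.functor.map φ'.hom ≫ (P.iso v).inv :=
        congrArg Iso.hom h2
      rw [cancel_mono] at h3
      have h4 : φ = φ' := Iso.ext (T.functor.map_injective h3)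
      rw [h4]
    · rintro ⟨B, ψ⟩
      obtain ⟨A, rfl⟩ := T.exists_obj_eq B
      refine ⟨⟨A, T.functor.preimageIso (ψ ≪≫ P.iso v)⟩, ?_⟩
      dsimp only [step]
      congr 1
      ext
      simp
  obtain ⟨g, hg, -⟩ := Strip.exists_equivariant step hstep fun v => ⟨W.obj v, Iso.refl _⟩
  have hhom : ∀ v, (g (Strip.shift n v)).2.hom = eqToHom (congrArg Sigma.fst (hg v)) ≫
      T.functor.map (g v).2.hom ≫ (P.iso v).inv := fun v => sigma_iso_hom (hg v)
  have hinv : ∀ v, (g (Strip.shift n v)).2.inv = ((P.iso v).hom ≫ T.functor.map (g v).2.inv) ≫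
      eqToHom (congrArg Sigma.fst (hg v)).symm := fun v => sigma_iso_inv (hg v)
  let Y : Strip n ⥤ C :=
    { obj := fun v => (g v).1
      map := fun {v w} h => (g v).2.hom ≫ W.map h ≫ (g w).2.inv }
  have hY : Strip.shiftFunctor n ⋙ Y = Y ⋙ T.functor := by
    refine CategoryTheory.Functor.ext (fun v => congrArg Sigma.fst (hg v)) fun v w h => ?_
    change (g (Strip.shift n v)).2.hom ≫ arr W (Strip.shift_mono (leOfHom h)) ≫
      (g (Strip.shift n w)).2.inv = _ ≫ T.functor.map ((g v).2.hom ≫ arr W (leOfHom h) ≫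
        (g w).2.inv) ≫ _
    rw [hhom, hinv]
    simp only [Category.assoc, Functor.map_comp]
    rw [reassoc_of% (P.naturality (leOfHom h)), Iso.inv_hom_id_assoc]
    erw [Category.assoc, Category.assoc]
    rfl
  refine ⟨Y, NatIso.ofComponents (fun v => (g v).2) fun {v w} h => ?_, hY, fun v => ?_⟩
  · change ((g v).2.hom ≫ W.map h ≫ (g w).2.inv) ≫ (g w).2.hom = _
    simp
  · change (g (Strip.shift n v)).2.hom ≫ (P.iso v).hom = _ ≫ T.functor.map (g v).2.hom
    rw [hhom, eqToHom_app]
    simp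

variable [Preadditive C] [WeaklyAbelian C]

theorem IsPretriangle.of_iso {X Y : Strip n ⥤ C} (e : X ≅ Y) (hY : IsPretriangle Y) :
    IsPretriangle X where
  isZero_diag α := (hY.isZero_diag α).of_iso (e.app _)
  isZero_shift α := (hY.isZero_shift α).of_iso (e.app _)
  isWeakSquare α β γ δ h1 h2 h3 h4 h5 := by
    have H := hY.isWeakSquare α β γ δ h1 h2 h3 h4 h5
    rw [isWeakSquare_iff]
    refine ⟨by rw [arr_comp, arr_comp], fun S b c hbc => ?_⟩
    obtain ⟨a, ha, ha'⟩ := H.exists_lift (b ≫ e.hom.app _) (c ≫ e.hom.app _) (by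
      rw [Category.assoc, Category.assoc, ← arr_naturality, ← arr_naturality,
        reassoc_of% hbc])
    refine ⟨a ≫ e.inv.app _, ?_, ?_⟩
    · rw [Category.assoc, ← arr_naturality, reassoc_of% ha, Iso.hom_inv_id_app, Category.comp_id]
    · rw [Category.assoc, ← arr_naturality, reassoc_of% ha', Iso.hom_inv_id_app, Category.comp_id]

theorem eqToHom_hom_app {X Y : Pretriangle C n} (h : X = Y) (v : Strip n) :
    (eqToHom h).hom.app v = eqToHom (by rw [h]) := by
  subst h
  rfl

/-- A pretriangle whose outer shift is isomorphic to its inner shift is isomorphic to a periodic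
pretriangle. -/
theorem Periodicity.exists_perPretriangle {W : Strip n ⥤ C} (P : Periodicity T W)
    (hW : IsPretriangle W) :
    ∃ (Y : PerPretriangle T n) (σ : Y.obj.obj ≅ W), Y.periodicity.IsHom P σ.hom := by
  obtain ⟨Y, σ, hY, hσ⟩ := P.exists_strict
  let S : PerPretriangle T n := ⟨⟨Y, hW.of_iso σ⟩, ObjectProperty.FullSubcategory.ext hY⟩
  refine ⟨S, σ, fun v => ?_⟩
  have h1 := hσ v
  rw [eqToHom_app] at h1
  refine h1.trans ?_
  congr 1
  exact (eqToHom_hom_app S.periodic v).symm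

end Strictification

/-! ### Direct sums of periodic pretriangles -/

section Biproducts

variable {C : Type u} [Category.{v} C] [Preadditive C] [WeaklyAbelian C] {n : ℕ} {T : CatAut C}

/-- A direct sum of pretriangles is a pretriangle. -/
theorem IsPretriangle.of_sum {X Y Z : Strip n ⥤ C} (hX : IsPretriangle X) (hY : IsPretriangle Y)
    (p : Z ⟶ X) (q : Z ⟶ Y) (i : X ⟶ Z) (j : Y ⟶ Z) (h : p ≫ i + q ≫ j = 𝟙 Z) :
    IsPretriangle Z := by
  have hv : ∀ v, p.app v ≫ i.app v + q.app v ≫ j.app v = 𝟙 _ :=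
    fun v => congrArg (fun t => t.app v) h
  have hzero : ∀ v, IsZero (X.obj v) → IsZero (Y.obj v) → IsZero (Z.obj v) := by
    intro v h1 h2
    rw [IsZero.iff_id_eq_zero, ← hv, h1.eq_of_tgt (p.app v) 0, h2.eq_of_tgt (q.app v) 0]
    simp
  refine ⟨fun α => hzero _ (hX.isZero_diag α) (hY.isZero_diag α),
    fun α => hzero _ (hX.isZero_shift α) (hY.isZero_shift α), ?_⟩
  intro α β γ δ h1 h2 h3 h4 h5
  rw [isWeakSquare_iff]
  refine ⟨by rw [arr_comp, arr_comp], fun S b c hbc => ?_⟩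
  obtain ⟨a, ha, ha'⟩ := (hX.isWeakSquare α β γ δ h1 h2 h3 h4 h5).exists_lift (b ≫ p.app _)
    (c ≫ p.app _) (by
      rw [Category.assoc, Category.assoc, ← arr_naturality, ← arr_naturality, reassoc_of% hbc])
  obtain ⟨d, hd, hd'⟩ := (hY.isWeakSquare α β γ δ h1 h2 h3 h4 h5).exists_lift (b ≫ q.app _)
    (c ≫ q.app _) (by
      rw [Category.assoc, Category.assoc, ← arr_naturality, ← arr_naturality, reassoc_of% hbc])
  refine ⟨a ≫ i.app _ + d ≫ j.app _, ?_, ?_⟩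
  · rw [Preadditive.add_comp, Category.assoc, Category.assoc, ← arr_naturality, ← arr_naturality,
      reassoc_of% ha, reassoc_of% hd, ← Preadditive.comp_add, hv, Category.comp_id]
  · rw [Preadditive.add_comp, Category.assoc, Category.assoc, ← arr_naturality, ← arr_naturality,
      reassoc_of% ha', reassoc_of% hd', ← Preadditive.comp_add, hv, Category.comp_id]

/-- The periodicity of a direct sum. -/
def Periodicity.sum {X Y Z : Strip n ⥤ C} (eX : Periodicity T X) (eY : Periodicity T Y)
    (p : Z ⟶ X) (q : Z ⟶ Y) (i : X ⟶ Z) (j : Y ⟶ Z) (hip : i ≫ p = 𝟙 X) (hiq : i ≫ q = 0)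
    (hjp : j ≫ p = 0) (hjq : j ≫ q = 𝟙 Y) (h : p ≫ i + q ≫ j = 𝟙 Z) : Periodicity T Z where
  iso v :=
    { hom := p.app _ ≫ (eX.iso v).hom ≫ T.functor.map (i.app v) +
        q.app _ ≫ (eY.iso v).hom ≫ T.functor.map (j.app v)
      inv := T.functor.map (p.app v) ≫ (eX.iso v).inv ≫ i.app _ +
        T.functor.map (q.app v) ≫ (eY.iso v).inv ≫ j.app _
      hom_inv_id := by
        have h1 := congrArg (fun t => t.app v) hip
        have h2 := congrArg (fun t => t.app v) hiq
        have h3 := congrArg (fun t => t.app v) hjp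
        have h4 := congrArg (fun t => t.app v) hjq
        have h5 := congrArg (fun t => t.app (Strip.shift n v)) h
        simp only [NatTrans.comp_app, NatTrans.id_app, NatTrans.app_zero, NatTrans.app_add]
          at h1 h2 h3 h4 h5
        simp only [Preadditive.add_comp, Preadditive.comp_add, Category.assoc]
        simp only [← T.functor.map_comp_assoc, h1, h2, h3, h4]
        simpa using h5
      inv_hom_id := by
        have h1 := congrArg (fun t => t.app (Strip.shift n v)) hip
        have h2 := congrArg (fun t => t.app (Strip.shift n v)) hiq
        have h3 := congrArg (fun t => t.app (Strip.shift n v)) hjp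
        have h4 := congrArg (fun t => t.app (Strip.shift n v)) hjq
        have h5 := congrArg (fun t => t.app v) h
        simp only [NatTrans.comp_app, NatTrans.id_app, NatTrans.app_zero, NatTrans.app_add]
          at h1 h2 h3 h4 h5
        simp only [Preadditive.add_comp, Preadditive.comp_add, Category.assoc]
        simp only [reassoc_of% h1, reassoc_of% h2, reassoc_of% h3, reassoc_of% h4,
          Iso.inv_hom_id_assoc, zero_comp, comp_zero, add_zero, zero_add]
        rw [← T.functor.map_comp, ← T.functor.map_comp, ← T.functor.map_add, h5,
          CategoryTheory.Functor.map_id] }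
  naturality {v w} h := by
    dsimp only
    rw [Preadditive.comp_add, Preadditive.add_comp]
    congr 1
    · rw [← Category.assoc, arr_naturality, Category.assoc, reassoc_of% (eX.naturality h),
        ← T.functor.map_comp, arr_naturality, T.functor.map_comp]
      simp only [Category.assoc]
    · rw [← Category.assoc, arr_naturality, Category.assoc, reassoc_of% (eY.naturality h),
        ← T.functor.map_comp, arr_naturality, T.functor.map_comp]
      simp only [Category.assoc]

theorem Periodicity.sum_isHom {X Y Z : Strip n ⥤ C} (eX : Periodicity T X) (eY : Periodicity T Y)
    (p : Z ⟶ X) (q : Z ⟶ Y) (i : X ⟶ Z) (j : Y ⟶ Z) (hip : i ≫ p = 𝟙 X) (hiq : i ≫ q = 0)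
    (hjp : j ≫ p = 0) (hjq : j ≫ q = 𝟙 Y) (h : p ≫ i + q ≫ j = 𝟙 Z) :
    (eX.sum eY p q i j hip hiq hjp hjq h).IsHom eX p ∧
      (eX.sum eY p q i j hip hiq hjp hjq h).IsHom eY q ∧
      eX.IsHom (eX.sum eY p q i j hip hiq hjp hjq h) i ∧
      eY.IsHom (eX.sum eY p q i j hip hiq hjp hjq h) j := by
  have h1 : ∀ v, i.app v ≫ p.app v = 𝟙 _ := fun v => congrArg (fun t => t.app v) hip
  have h2 : ∀ v, i.app v ≫ q.app v = 0 := fun v => congrArg (fun t => t.app v) hiq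
  have h3 : ∀ v, j.app v ≫ p.app v = 0 := fun v => congrArg (fun t => t.app v) hjp
  have h4 : ∀ v, j.app v ≫ q.app v = 𝟙 _ := fun v => congrArg (fun t => t.app v) hjq
  refine ⟨fun v => ?_, fun v => ?_, fun v => ?_, fun v => ?_⟩
  · simp [Periodicity.sum, ← T.functor.map_comp, h1, h3]
  · simp [Periodicity.sum, ← T.functor.map_comp, h2, h4]
  · simp [Periodicity.sum, reassoc_of% (h1 (Strip.shift n v)), reassoc_of% (h2 (Strip.shift n v))]
  · simp [Periodicity.sum, reassoc_of% (h3 (Strip.shift n v)), reassoc_of% (h4 (Strip.shift n v))]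

omit [Preadditive C] [WeaklyAbelian C] in
theorem Periodicity.IsHom.comp {X Y Z : Strip n ⥤ C} {eX : Periodicity T X} {eY : Periodicity T Y}
    {eZ : Periodicity T Z} {f : X ⟶ Y} {g : Y ⟶ Z} (hf : eX.IsHom eY f) (hg : eY.IsHom eZ g) :
    eX.IsHom eZ (f ≫ g) := by
  intro v
  rw [NatTrans.comp_app, NatTrans.comp_app, Category.assoc, hg, reassoc_of% (hf v),
    T.functor.map_comp]

omit [Preadditive C] [WeaklyAbelian C] in
theorem Periodicity.IsHom.inv {X Y : Strip n ⥤ C} {eX : Periodicity T X} {eY : Periodicity T Y}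
    {f : X ≅ Y} (hf : eX.IsHom eY f.hom) : eY.IsHom eX f.inv := by
  intro v
  rw [← cancel_epi (f.hom.app _), Iso.hom_inv_id_app_assoc, reassoc_of% (hf v),
    ← T.functor.map_comp, Iso.hom_inv_id_app, CategoryTheory.Functor.map_id, Category.comp_id]

namespace PerPretriangle

/-- The periodic morphism given by a morphism of diagrams compatible with the periodicities. -/
def homMk {X Y : PerPretriangle T n} (f : X.obj.obj ⟶ Y.obj.obj)
    (hf : X.periodicity.IsHom Y.periodicity f) : X ⟶ Y :=
  ⟨⟨f⟩, (periodic_iff _).2 hf⟩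

theorem homMk_ext {X Y : PerPretriangle T n} {f g : X ⟶ Y} (h : f.hom.hom = g.hom.hom) :
    f = g := by
  ext1
  ext1
  exact h

instance : HasZeroObject (PerPretriangle T n) := by
  obtain ⟨Z, hZ⟩ := HasZeroObject.zero (C := C)
  let W : Strip n ⥤ C := (Functor.const _).obj Z
  have hW : IsPretriangle W :=
    ⟨fun _ => hZ, fun _ => hZ, fun _ _ _ _ _ _ _ _ _ => by
      rw [isWeakSquare_iff]
      exact ⟨hZ.eq_of_tgt _ _, fun S b c _ => ⟨b, hZ.eq_of_tgt _ _, hZ.eq_of_tgt _ _⟩⟩⟩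
  let P : Periodicity T W :=
    { iso := fun v => hZ.iso (T.functor.map_isZero hZ)
      naturality := fun h => hZ.eq_of_src _ _ }
  obtain ⟨Y, σ, -⟩ := P.exists_perPretriangle hW
  refine ⟨Y, ?_⟩
  rw [IsZero.iff_id_eq_zero]
  ext v
  exact (hZ.of_iso (σ.app v)).eq_of_src _ _

instance : HasBinaryBiproducts (PerPretriangle T n) := by
  refine ⟨fun X Y => ?_⟩
  have : HasBinaryBiproducts (Strip n ⥤ C) := HasBinaryBiproducts.of_hasBinaryProducts
  let F : Strip n ⥤ C := X.obj.obj
  let G : Strip n ⥤ C := Y.obj.obj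
  obtain ⟨Z, p, q, i, j, hip, hiq, hjp, hjq, h⟩ : ∃ (Z : Strip n ⥤ C) (p : Z ⟶ F) (q : Z ⟶ G)
      (i : F ⟶ Z) (j : G ⟶ Z), i ≫ p = 𝟙 F ∧ i ≫ q = 0 ∧ j ≫ p = 0 ∧ j ≫ q = 𝟙 G ∧
        p ≫ i + q ≫ j = 𝟙 Z :=
    ⟨F ⊞ G, biprod.fst, biprod.snd, biprod.inl, biprod.inr, by simp, by simp, by simp, by simp,
      by simp⟩
  let P : Periodicity T Z := X.periodicity.sum Y.periodicity p q i j hip hiq hjp hjq h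
  have hZ : IsPretriangle Z := X.obj.property.of_sum Y.obj.property p q i j h
  obtain ⟨S, σ, hσ⟩ := P.exists_perPretriangle hZ
  obtain ⟨hp, hq, hi, hj⟩ := X.periodicity.sum_isHom Y.periodicity p q i j hip hiq hjp hjq h
  refine hasBinaryBiproduct_of_total
    { pt := S
      fst := homMk (σ.hom ≫ p) (hσ.comp hp)
      snd := homMk (σ.hom ≫ q) (hσ.comp hq)
      inl := homMk (i ≫ σ.inv) (hi.comp hσ.inv)
      inr := homMk (j ≫ σ.inv) (hj.comp hσ.inv)
      inl_fst := homMk_ext ?_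
      inl_snd := homMk_ext ?_
      inr_fst := homMk_ext ?_
      inr_snd := homMk_ext ?_ } (homMk_ext ?_)
  · change (i ≫ σ.inv) ≫ σ.hom ≫ p = 𝟙 _
    simpa using hip
  · change (i ≫ σ.inv) ≫ σ.hom ≫ q = 0
    simpa using hiq
  · change (j ≫ σ.inv) ≫ σ.hom ≫ p = 0
    simpa using hjp
  · change (j ≫ σ.inv) ≫ σ.hom ≫ q = 𝟙 _
    simpa using hjq
  · change (σ.hom ≫ p) ≫ i ≫ σ.inv + (σ.hom ≫ q) ≫ j ≫ σ.inv = 𝟙 _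
    have : σ.hom ≫ (p ≫ i + q ≫ j) ≫ σ.inv = 𝟙 _ := by rw [h]; simp
    rw [← this]
    simp

instance : HasFiniteBiproducts (PerPretriangle T n) :=
  have := hasFiniteProducts_of_has_binary_and_terminal (C := PerPretriangle T n)
  HasFiniteBiproducts.of_hasFiniteProducts

end PerPretriangle

variable {H : HellerTriangulation T}

theorem isTriangle_biproduct_iff {X Y : PerPretriangle T n} (b : BinaryBicone X Y)
    (hb : b.IsBilimit) : IsTriangle H b.pt ↔ IsTriangle H X ∧ IsTriangle H Y :=
  ⟨fun h => ⟨h.of_retract b.inl b.fst b.inl_fst, h.of_retract b.inr b.snd b.inr_snd⟩,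
    fun h => IsTriangle.of_sum b.fst b.snd b.inl b.inr (IsBilimit.binary_total hb) h.1 h.2⟩

instance : HasFiniteBiproducts (Triangle H n) := by
  have : HasZeroObject (Triangle H n) := by
    obtain ⟨Z, hZ⟩ := HasZeroObject.zero (C := PerPretriangle T n)
    refine ⟨⟨Z, IsTriangle.of_isZero hZ⟩, ?_⟩
    rw [IsZero.iff_id_eq_zero]
    ext1
    exact hZ.eq_of_src _ _
  have : HasBinaryBiproducts (Triangle H n) := by
    refine ⟨fun X Y => ?_⟩
    let b := BinaryBiproduct.bicone X.obj Y.obj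
    have hb := BinaryBiproduct.isBilimit X.obj Y.obj
    exact hasBinaryBiproduct_of_total (C := Triangle H n)
      { pt := ⟨b.pt, (isTriangle_biproduct_iff b hb).2 ⟨X.property, Y.property⟩⟩
        fst := ⟨b.fst⟩
        snd := ⟨b.snd⟩
        inl := ⟨b.inl⟩
        inr := ⟨b.inr⟩
        inl_fst := ObjectProperty.hom_ext _ b.inl_fst
        inl_snd := ObjectProperty.hom_ext _ b.inl_snd
        inr_fst := ObjectProperty.hom_ext _ b.inr_fst
        inr_snd := ObjectProperty.hom_ext _ b.inr_snd }
      (ObjectProperty.hom_ext _ (IsBilimit.binary_total hb))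
  have := hasFiniteProducts_of_has_binary_and_terminal (C := Triangle H n)
  exact HasFiniteBiproducts.of_hasFiniteProducts

end Biproducts

/-! ### A criterion for pretriangles -/

section Criterion

variable {C : Type u} [Category.{v} C] [Preadditive C] {n : ℕ}

/-- The places `u ≤ v ≤ w` are of the form `γ/α ≤ δ/α ≤ δ/γ`. -/
def Strip.IsTriple (u v w : Strip n) : Prop := u.src = v.src ∧ u.tgt = w.src ∧ v.tgt = w.tgt

/-- The places `u ≤ v ≤ w` are of the form `γ/α ≤ γ/β ≤ α⁺¹/β`. -/
def Strip.IsTriple' (u v w : Strip n) : Prop :=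
  u.tgt = v.tgt ∧ v.src = w.src ∧ w.tgt = u.src + (n + 1)

theorem Strip.isTriple_shift {u v w : Strip n} :
    IsTriple (shift n u) (shift n v) (shift n w) ↔ IsTriple' u v w := by
  change (u.tgt = v.tgt ∧ u.src + (n + 1) = w.tgt ∧ v.src + (n + 1) = w.src + (n + 1)) ↔
    (u.tgt = v.tgt ∧ v.src = w.src ∧ w.tgt = u.src + (n + 1))
  omega

theorem Strip.isTriple'_shift {u v w : Strip n} :
    IsTriple' (shift n u) (shift n v) (shift n w) ↔ IsTriple u v w := by
  change (u.src + (n + 1) = v.src + (n + 1) ∧ v.tgt = w.tgt ∧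
    w.src + (n + 1) = u.tgt + (n + 1)) ↔ (u.src = v.src ∧ u.tgt = w.src ∧ v.tgt = w.tgt)
  omega

theorem Strip.exists_eq {a b : ℤ} (h : a ≤ b) (h' : b ≤ a + (n + 1)) :
    ∃ v : Strip n, v.src = a ∧ v.tgt = b := ⟨⟨a, b, h, h'⟩, rfl, rfl⟩

theorem Strip.shift_src (v : Strip n) : (shift n v).src = v.tgt := rfl

theorem Strip.shift_tgt (v : Strip n) : (shift n v).tgt = v.src + (n + 1) := rfl

theorem IsPretriangle.exactAt_of_isTriple [WeaklyAbelian C] {X : Strip n ⥤ C}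
    (hX : IsPretriangle X) {u v w : Strip n} (h : u ≤ v) (h' : v ≤ w)
    (H : Strip.IsTriple u v w) : ExactAt X h h' := by
  obtain ⟨a, c, h1, h2⟩ := u
  obtain ⟨a', d, h3, h4⟩ := v
  obtain ⟨c', d', h5, h6⟩ := w
  obtain ⟨rfl, rfl, rfl⟩ := H
  exact hX.exactAt_tgt _ _ _

theorem IsPretriangle.exactAt_of_isTriple' [WeaklyAbelian C] {X : Strip n ⥤ C}
    (hX : IsPretriangle X) {u v w : Strip n} (h : u ≤ v) (h' : v ≤ w)
    (H : Strip.IsTriple' u v w) : ExactAt X h h' := by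
  obtain ⟨a, c, h1, h2⟩ := u
  obtain ⟨a', d, h3, h4⟩ := v
  obtain ⟨c', d', h5, h6⟩ := w
  obtain ⟨rfl, rfl, h7⟩ := H
  dsimp only at h7
  subst h7
  exact hX.exactAt_src h.1 h3 h2

theorem Periodicity.exactAt_shift_iff {T : CatAut C} [WeaklyAbelian C] {Y : Strip n ⥤ C}
    (P : Periodicity T Y) {u v w : Strip n} (h : u ≤ v) (h' : v ≤ w) :
    ExactAt Y (Strip.shift_mono h) (Strip.shift_mono h') ↔ ExactAt Y h h' := by
  constructor
  · intro H S t ht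
    obtain ⟨s, hs⟩ := H (T.functor.map t ≫ (P.iso v).inv) (by
      rw [← cancel_mono (P.iso w).hom, Category.assoc, Category.assoc, P.naturality h',
        Iso.inv_hom_id_assoc, ← T.functor.map_comp, ht, Functor.map_zero, zero_comp])
    obtain ⟨s', hs'⟩ := T.functor.map_surjective (s ≫ (P.iso u).hom)
    refine ⟨s', T.functor.map_injective ?_⟩
    rw [T.functor.map_comp, hs', Category.assoc, ← P.naturality h, reassoc_of% hs,
      Iso.inv_hom_id, Category.comp_id]
  · intro H S t ht
    obtain ⟨S, rfl⟩ := T.exists_obj_eq S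
    obtain ⟨t', ht'⟩ := T.functor.map_surjective (t ≫ (P.iso v).hom)
    obtain ⟨s, hs⟩ := H t' (T.functor.map_injective (by
      rw [T.functor.map_comp, ht', Category.assoc, ← P.naturality h', reassoc_of% ht, zero_comp,
        Functor.map_zero]))
    refine ⟨T.functor.map s ≫ (P.iso u).inv, ?_⟩
    rw [← cancel_mono (P.iso v).hom, Category.assoc, Category.assoc, P.naturality h,
      Iso.inv_hom_id_assoc, ← T.functor.map_comp, hs, ht']

/-- The exactness of a diagram at the triples `γ/α ≤ δ/α ≤ δ/γ` and `γ/α ≤ γ/β ≤ α⁺¹/β` yields the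
weak squares required of a pretriangle. -/
theorem isPretriangle_of_exactAt [WeaklyAbelian C] {Y : Strip n ⥤ C}
    (hd : ∀ v : Strip n, v.src = v.tgt → IsZero (Y.obj v))
    (hs : ∀ v : Strip n, v.tgt = v.src + (n + 1) → IsZero (Y.obj v))
    (hE : ∀ (u v w : Strip n) (h : u ≤ v) (h' : v ≤ w), Strip.IsTriple u v w → ExactAt Y h h')
    (hE' : ∀ (u v w : Strip n) (h : u ≤ v) (h' : v ≤ w), Strip.IsTriple' u v w → ExactAt Y h h') :
    IsPretriangle Y where
  isZero_diag α := hd _ rfl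
  isZero_shift α := hs _ rfl
  isWeakSquare := by
    intro a b c d h1 h2 h3 h4 h5
    rw [isWeakSquare_iff]
    refine ⟨by rw [arr_comp, arr_comp], fun S s t hst => ?_⟩
    let A : Strip n := ⟨a, c, by omega, by omega⟩
    let B : Strip n := ⟨a, d, by omega, by omega⟩
    let A' : Strip n := ⟨b, c, by omega, by omega⟩
    let B' : Strip n := ⟨b, d, by omega, by omega⟩
    let K : Strip n := ⟨d - (n + 1), c, by omega, by omega⟩
    let L : Strip n := ⟨c, d, by omega, by omega⟩
    have hAB : A ≤ B := ⟨le_refl _, h4⟩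
    have hAA' : A ≤ A' := ⟨h2, le_refl _⟩
    have hBB' : B ≤ B' := ⟨h2, le_refl _⟩
    have hA'B' : A' ≤ B' := ⟨le_refl _, h4⟩
    have hKA : K ≤ A := ⟨h1, le_refl _⟩
    have hB'L : B' ≤ L := ⟨h3, le_refl _⟩
    change S ⟶ Y.obj B at s
    change S ⟶ Y.obj A' at t
    change s ≫ arr Y hBB' = t ≫ arr Y hA'B' at hst
    have z1 : arr Y (hA'B'.trans hB'L) = 0 :=
      arr_eq_zero Y _ ⟨c, c, le_refl _, by omega⟩ ⟨h3, le_refl _⟩ ⟨le_refl _, h4⟩ (hd _ rfl)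
    have z2 : arr Y (hKA.trans hAB) = 0 :=
      arr_eq_zero Y _ ⟨d - (n + 1), d, by omega, by omega⟩ ⟨le_refl _, h4⟩ ⟨h1, le_refl _⟩
        (hs _ (by dsimp only; omega))
    obtain ⟨x, hx⟩ := hE A B L hAB (hBB'.trans hB'L) ⟨rfl, rfl, rfl⟩ s (by
      rw [← arr_comp Y hBB' hB'L, reassoc_of% hst, arr_comp, z1, comp_zero])
    obtain ⟨k, hk⟩ := hE' K A' B' (hKA.trans hAA') hA'B'
      ⟨rfl, rfl, by dsimp only [K, B']; omega⟩ (x ≫ arr Y hAA' - t) (by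
        rw [Preadditive.sub_comp, Category.assoc, arr_comp, ← hst, ← hx, Category.assoc, arr_comp,
          sub_self])
    refine ⟨x - k ≫ arr Y hKA, ?_, ?_⟩
    · change (x - k ≫ arr Y hKA) ≫ arr Y hAB = s
      rw [Preadditive.sub_comp, hx, Category.assoc, arr_comp, z2, comp_zero, sub_zero]
    · change (x - k ≫ arr Y hKA) ≫ arr Y hAA' = t
      rw [Preadditive.sub_comp, Category.assoc, arr_comp, hk, sub_sub_cancel]

/-- For a diagram whose outer shift is isomorphic to its inner shift, it suffices to know that the
sequences `γ/0 ⟶ δ/0 ⟶ δ/γ ⟶ 0⁺¹/γ ⟶ 0⁺¹/δ` are exact. The exactness of the sequences belonging to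
general `α ≤ γ ≤ δ` follows by a chase in the octahedron on `0 ≤ α ≤ γ ≤ δ`. -/
theorem Periodicity.isPretriangle [WeaklyAbelian C] {T : CatAut C} {Y : Strip n ⥤ C}
    (P : Periodicity T Y) (hd : ∀ v : Strip n, v.src = v.tgt → IsZero (Y.obj v))
    (E₁ : ∀ {u v w : Strip n} (h : u ≤ v) (h' : v ≤ w), Strip.IsTriple u v w → v.src = 0 →
      v.tgt ≤ n → ExactAt Y h h')
    (E₂ : ∀ {u v w : Strip n} (h : u ≤ v) (h' : v ≤ w), Strip.IsTriple' u v w → u.src = 0 →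
      u.tgt ≤ n → ExactAt Y h h')
    (E₃ : ∀ {u v w : Strip n} (h : u ≤ v) (h' : v ≤ w), Strip.IsTriple u v w → 0 ≤ v.src →
      u.tgt ≤ n → v.tgt = n + 1 → ExactAt Y h h') : IsPretriangle Y := by
  have hs : ∀ v : Strip n, v.tgt = v.src + (n + 1) → IsZero (Y.obj v) := by
    intro v hv
    obtain ⟨v, rfl⟩ := (Strip.shift n).surjective v
    rw [Strip.shift_src, Strip.shift_tgt] at hv
    exact (T.functor.map_isZero (hd v (by omega))).of_iso (P.iso v)
  have zero : ∀ {v w : Strip n} (h : v ≤ w), v.tgt ≤ w.src → arr Y h = 0 := fun {v w} h h' =>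
    arr_eq_zero Y h ⟨v.tgt, v.tgt, le_refl _, by omega⟩ ⟨v.le, le_refl _⟩ ⟨h', h.2⟩ (hd _ rfl)
  -- the shifts of the first two exactness properties
  have E₁' : ∀ {u v w : Strip n} (h : u ≤ v) (h' : v ≤ w), Strip.IsTriple' u v w →
      v.tgt = n + 1 → v.src ≤ n → ExactAt Y h h' := by
    intro u v w h h' H h1 h2
    obtain ⟨u, rfl⟩ := (Strip.shift n).surjective u
    obtain ⟨v, rfl⟩ := (Strip.shift n).surjective v
    obtain ⟨w, rfl⟩ := (Strip.shift n).surjective w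
    rw [Strip.shift_tgt] at h1
    exact (P.exactAt_shift_iff ((Strip.shift n).le_iff_le.1 h) ((Strip.shift n).le_iff_le.1 h')).2
      (E₁ _ _ (Strip.isTriple'_shift.1 H) (by omega) h2)
  have E₂' : ∀ {u v w : Strip n} (h : u ≤ v) (h' : v ≤ w), Strip.IsTriple u v w →
      u.tgt = n + 1 → u.src ≤ n → ExactAt Y h h' := by
    intro u v w h h' H h1 h2
    obtain ⟨u, rfl⟩ := (Strip.shift n).surjective u
    obtain ⟨v, rfl⟩ := (Strip.shift n).surjective v
    obtain ⟨w, rfl⟩ := (Strip.shift n).surjective w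
    rw [Strip.shift_tgt] at h1
    exact (P.exactAt_shift_iff ((Strip.shift n).le_iff_le.1 h) ((Strip.shift n).le_iff_le.1 h')).2
      (E₂ _ _ (Strip.isTriple_shift.1 H) (by omega) h2)
  -- `F₁` and `F₂` concern the places of the fundamental domain, `F₃` the triples
  -- `γ/α ≤ δ/α ≤ δ/γ` with `γ ≤ n < δ`
  have F₁ : ∀ {u v w : Strip n} (h : u ≤ v) (h' : v ≤ w), Strip.IsTriple u v w → 0 ≤ v.src →
      v.tgt ≤ n → ExactAt Y h h' := by
    intro yx zx zy h h' H h1 h2 S t ht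
    have l1 := yx.le
    have l2 := zy.le
    obtain ⟨e1, e2, e3⟩ := H
    obtain ⟨y0, y0s, y0t⟩ := Strip.exists_eq (n := n) (a := 0) (b := yx.tgt) (by omega) (by omega)
    obtain ⟨z0, z0s, z0t⟩ := Strip.exists_eq (n := n) (a := 0) (b := zx.tgt) (by omega) (by omega)
    obtain ⟨Nx, Nxs, Nxt⟩ := Strip.exists_eq (n := n) (a := zx.src) (b := n + 1) (by omega)
      (by omega)
    obtain ⟨Ny, Nys, Nyt⟩ := Strip.exists_eq (n := n) (a := zy.src) (b := n + 1) (by omega)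
      (by omega)
    have h3 : zx ≤ Nx := ⟨by omega, by omega⟩
    have h4 : Nx ≤ Ny := ⟨by omega, by omega⟩
    have h5 : yx ≤ Nx := h.trans h3
    have h6 : zy ≤ Ny := ⟨by omega, by omega⟩
    have h7 : z0 ≤ zx := ⟨by omega, by omega⟩
    have h8 : y0 ≤ z0 := ⟨by omega, by omega⟩
    have h9 : y0 ≤ yx := ⟨by omega, by omega⟩
    obtain ⟨p, hp⟩ := E₃ h5 h4 ⟨by omega, by omega, by omega⟩ (by omega) (by omega) (by omega)
      (t ≫ arr Y h3) (by
        rw [Category.assoc, arr_comp, ← arr_comp Y h' h6, reassoc_of% ht, zero_comp])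
    obtain ⟨r, hr⟩ := E₂ h7 h3 ⟨by omega, by omega, by omega⟩ (by omega) (by omega)
      (t - p ≫ arr Y h) (by
        rw [Preadditive.sub_comp, Category.assoc, arr_comp, hp, sub_self])
    obtain ⟨r', hr'⟩ := E₁ h8 (h7.trans h') ⟨by omega, by omega, by omega⟩ (by omega) (by omega)
      r (by
        rw [← arr_comp Y h7 h', reassoc_of% hr, Preadditive.sub_comp, ht, Category.assoc, arr_comp,
          zero (h.trans h') (by omega), comp_zero, sub_zero])
    refine ⟨p + r' ≫ arr Y h9, ?_⟩
    rw [Preadditive.add_comp, Category.assoc, arr_comp, ← arr_comp Y h8 h7, reassoc_of% hr', hr]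
    abel
  have F₂ : ∀ {u v w : Strip n} (h : u ≤ v) (h' : v ≤ w), Strip.IsTriple' u v w → 0 ≤ u.src →
      u.tgt ≤ n → ExactAt Y h h' := by
    intro zx zy xy h h' H h1 h2 S t ht
    have l1 := zx.le
    have l2 := zy.le
    have l3 := xy.le
    obtain ⟨e1, e2, e3⟩ := H
    have l4 : zx.src ≤ zy.src := h.1
    obtain ⟨z0, z0s, z0t⟩ := Strip.exists_eq (n := n) (a := 0) (b := zx.tgt) (by omega) (by omega)
    obtain ⟨Nx, Nxs, Nxt⟩ := Strip.exists_eq (n := n) (a := zx.src) (b := n + 1) (by omega)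
      (by omega)
    obtain ⟨Ny, Nys, Nyt⟩ := Strip.exists_eq (n := n) (a := zy.src) (b := n + 1) (by omega)
      (by omega)
    obtain ⟨Nz, Nzs, Nzt⟩ := Strip.exists_eq (n := n) (a := zx.tgt) (b := n + 1) (by omega)
      (by omega)
    have h3 : zy ≤ Ny := ⟨by omega, by omega⟩
    have h4 : Ny ≤ xy := ⟨by omega, by omega⟩
    have h5 : Nx ≤ Ny := ⟨by omega, by omega⟩
    have h6 : Ny ≤ Nz := ⟨by omega, by omega⟩
    have h7 : zx ≤ Nx := ⟨by omega, by omega⟩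
    have h8 : z0 ≤ zx := ⟨by omega, by omega⟩
    obtain ⟨r, hr⟩ := E₁' h5 h4 ⟨by omega, by omega, by omega⟩ (by omega) (by omega)
      (t ≫ arr Y h3) (by rw [Category.assoc, arr_comp, ht])
    obtain ⟨p, hp⟩ := E₃ h7 (h5.trans h6) ⟨by omega, by omega, by omega⟩ (by omega) (by omega)
      (by omega) r (by
        rw [← arr_comp Y h5 h6, reassoc_of% hr, arr_comp, zero _ (by omega), comp_zero])
    obtain ⟨s, hs'⟩ := E₂ (h8.trans h) h3 ⟨by omega, by omega, by omega⟩ (by omega) (by omega)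
      (t - p ≫ arr Y h) (by
        rw [Preadditive.sub_comp, Category.assoc, arr_comp, ← arr_comp Y h7 h5, reassoc_of% hp, hr,
          sub_self])
    refine ⟨p + s ≫ arr Y h8, ?_⟩
    rw [Preadditive.add_comp, Category.assoc, arr_comp, hs']
    abel
  have F₃ : ∀ {u v w : Strip n} (h : u ≤ v) (h' : v ≤ w), Strip.IsTriple u v w → u.tgt ≤ n →
      n + 1 ≤ v.tgt → ExactAt Y h h' := by
    intro zy xy xz h h' H h1 h2 S t ht
    have l1 := zy.le
    have l2 := xy.le
    have l3 := xz.le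
    have l4 := xy.le_shift
    obtain ⟨e1, e2, e3⟩ := H
    obtain ⟨xN, xNs, xNt⟩ := Strip.exists_eq (n := n) (a := n + 1) (b := xy.tgt) (by omega)
      (by omega)
    obtain ⟨Nx, Nxs, Nxt⟩ := Strip.exists_eq (n := n) (a := xy.tgt - (n + 1)) (b := n + 1)
      (by omega) (by omega)
    obtain ⟨Ny, Nys, Nyt⟩ := Strip.exists_eq (n := n) (a := zy.src) (b := n + 1) (by omega)
      (by omega)
    obtain ⟨Nz, Nzs, Nzt⟩ := Strip.exists_eq (n := n) (a := xz.src) (b := n + 1) (by omega)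
      (by omega)
    have h3 : Ny ≤ xy := ⟨by omega, by omega⟩
    have h4 : xz ≤ xN := ⟨by omega, by omega⟩
    have h5 : Nx ≤ Ny := ⟨by omega, by omega⟩
    have h6 : Ny ≤ Nz := ⟨by omega, by omega⟩
    have h7 : Nz ≤ xz := ⟨by omega, by omega⟩
    have h8 : zy ≤ Ny := ⟨by omega, by omega⟩
    obtain ⟨r, hr⟩ := E₂' h3 (h'.trans h4) ⟨by omega, by omega, by omega⟩ (by omega) (by omega) t
      (by rw [← arr_comp Y h' h4, reassoc_of% ht, zero_comp])
    obtain ⟨r', hr'⟩ := E₁' (h5.trans h6) h7 ⟨by omega, by omega, by omega⟩ (by omega) (by omega)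
      (r ≫ arr Y h6) (by
        rw [Category.assoc, arr_comp, ← arr_comp Y h3 h', reassoc_of% hr, ht])
    obtain ⟨p, hp⟩ := E₃ h8 h6 ⟨by omega, by omega, by omega⟩ (by omega) (by omega) (by omega)
      (r - r' ≫ arr Y h5) (by
        rw [Preadditive.sub_comp, Category.assoc, arr_comp, hr', sub_self])
    have z : arr Y (h5.trans h3) = 0 :=
      arr_eq_zero Y _ ⟨Nx.src, Nx.src + (n + 1), by omega, le_refl _⟩ ⟨le_refl _, Nx.le_shift⟩
        ⟨(h5.trans h3).1, by dsimp only; omega⟩ (hs _ rfl)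
    refine ⟨p, ?_⟩
    rw [← arr_comp Y h8 h3, reassoc_of% hp, Preadditive.sub_comp, hr, Category.assoc, arr_comp, z,
      comp_zero, sub_zero]
  have key : ∀ (v u w : Strip n) (h : u ≤ v) (h' : v ≤ w),
      Strip.IsTriple u v w ∨ Strip.IsTriple' u v w → ExactAt Y h h' := by
    intro v
    induction v using Strip.induction_shift with
    | h v =>
      constructor
      · intro H u w h h' hT
        exact (P.exactAt_shift_iff h h').1 (H _ _ _ _ (by
          rw [Strip.isTriple_shift, Strip.isTriple'_shift]; exact hT.symm))
      · intro H u w h h' hT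
        obtain ⟨u, rfl⟩ := (Strip.shift n).surjective u
        obtain ⟨w, rfl⟩ := (Strip.shift n).surjective w
        rw [Strip.isTriple_shift, Strip.isTriple'_shift] at hT
        exact (P.exactAt_shift_iff ((Strip.shift n).le_iff_le.1 h)
          ((Strip.shift n).le_iff_le.1 h')).2 (H _ _ _ _ hT.symm)
    | h0 v hv =>
      obtain ⟨h1, h2⟩ := Strip.level_eq_zero_iff.1 hv
      have l1 := v.le
      rintro u w h h' (hT | hT)
      · exact F₁ h h' hT h1 (by omega)
      · by_cases hu : 0 ≤ u.src
        · exact F₂ h h' hT hu (by have := hT.1; omega)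
        · refine (P.exactAt_shift_iff h h').1 (F₃ _ _ (Strip.isTriple_shift.2 hT) ?_ ?_)
          · rw [Strip.shift_tgt]; omega
          · rw [Strip.shift_tgt]; omega
  exact isPretriangle_of_exactAt hd hs (fun u v w h h' hT => key v u w h h' (Or.inl hT))
    (fun u v w h h' hT => key v u w h h' (Or.inr hT))

end Criterion

/-! ### The places of a folding -/

section FoldPlace

variable {n : ℕ}

/-- The map inserting `ρ` into each half period: `0 ↦ -1` and `α ↦ α - 1` for `1 ≤ α ≤ n + 1`,
continued so as to send the period `n + 2` to the period `2 * (n + 1)`. -/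
def foldIndex (n : ℕ) (α : ℤ) : ℤ := 2 * ((n + 1) * (α / (n + 2))) + α % (n + 2) - 1

theorem foldIndex_bounds (α : ℤ) : 2 * ((n + 1) * (α / (n + 2))) - 1 ≤ foldIndex n α ∧
    foldIndex n α ≤ 2 * ((n + 1) * (α / (n + 2))) + n := by
  have h1 := Int.emod_nonneg α (b := n + 2) (by omega)
  have h2 := Int.emod_lt_of_pos α (b := n + 2) (by omega)
  unfold foldIndex
  omega

theorem foldIndex_mono {α β : ℤ} (h : α ≤ β) : foldIndex n α ≤ foldIndex n β := by
  have h1 := Int.ediv_le_ediv (c := n + 2) (by omega) h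
  have h2 := Int.mul_ediv_add_emod α (n + 2)
  have h3 := Int.mul_ediv_add_emod β (n + 2)
  rcases h1.eq_or_lt with h1 | h1
  · unfold foldIndex
    rw [h1] at h2 ⊢
    omega
  · have h4 := (foldIndex_bounds (n := n) α).2
    have h5 := (foldIndex_bounds (n := n) β).1
    have : ((n : ℤ) + 1) * (α / (n + 2) + 1) ≤ (n + 1) * (β / (n + 2)) :=
      mul_le_mul_of_nonneg_left (by omega) (by omega)
    rw [mul_add] at this
    omega

theorem foldIndex_add (α : ℤ) : foldIndex n (α + (n + 2)) = foldIndex n α + 2 * (n + 1) := by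
  unfold foldIndex
  rw [Int.add_emod_right, Int.add_ediv_of_dvd_right (dvd_refl _), Int.ediv_self (by omega)]
  ring

theorem foldIndex_of_lt {α : ℤ} (h : 0 ≤ α) (h' : α < n + 2) : foldIndex n α = α - 1 := by
  rw [foldIndex, Int.ediv_eq_zero_of_lt h h', Int.emod_eq_of_lt h h']
  ring

theorem foldIndex_period : foldIndex n (n + 2) = 2 * n + 1 := by
  have := foldIndex_add (n := n) 0
  rw [foldIndex_of_lt (le_refl _) (by omega), zero_add] at this
  omega

namespace Strip

/-- The place `β⁺¹/α⁺¹` belonging to `β/α`. -/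
def foldLeft (v : Strip (n + 1)) : Strip (2 * n + 1) where
  src := foldIndex n v.src + (n + 1)
  tgt := foldIndex n v.tgt + (n + 1)
  le := by have := foldIndex_mono (n := n) v.le; omega
  le_shift := by
    have := foldIndex_mono (n := n) v.le_shift
    rw [Nat.cast_succ, add_assoc (n : ℤ) 1 1, one_add_one_eq_two, foldIndex_add] at this
    push_cast
    omega

/-- The place `α⁺²/β` belonging to `β/α`. -/
def foldRight (v : Strip (n + 1)) : Strip (2 * n + 1) where
  src := foldIndex n v.tgt
  tgt := foldIndex n v.src + 2 * (n + 1)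
  le := by
    have := foldIndex_mono (n := n) v.le_shift
    rw [Nat.cast_succ, add_assoc (n : ℤ) 1 1, one_add_one_eq_two, foldIndex_add] at this
    omega
  le_shift := by have := foldIndex_mono (n := n) v.le; push_cast; omega

/-- The infimum of `foldLeft v` and `foldRight v`. At `α/ρ` it is `α⁺¹/α`, and at `ρ⁺¹/γ` it is
`γ⁺²/γ⁺¹`. -/
def foldMid (v : Strip (n + 1)) : Strip (2 * n + 1) where
  src := min v.foldLeft.src v.foldRight.src
  tgt := min v.foldLeft.tgt v.foldRight.tgt
  le := by have := v.foldLeft.le; have := v.foldRight.le; omega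
  le_shift := by have := v.foldLeft.le_shift; have := v.foldRight.le_shift; omega

/-- The places `α/ρ`, `ρ⁺¹/γ` and their shifts. -/
def IsFront (v : Strip (n + 1)) : Prop := (n + 2 : ℤ) ∣ v.src ∨ (n + 2 : ℤ) ∣ v.tgt

/-- The places `ρ/ρ`, `ρ⁺¹/ρ` and their shifts, at which a folding vanishes. -/
def IsCorner (v : Strip (n + 1)) : Prop := (n + 2 : ℤ) ∣ v.src ∧ (n + 2 : ℤ) ∣ v.tgt

open Classical in
/-- The place of the entry of `X` used in the definition of the entry at `v` of the folding of `X`.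
If `v` is not a front place, there are two of them, and `c` says which one is meant. -/
def foldPlace (c : Bool) (v : Strip (n + 1)) : Strip (2 * n + 1) :=
  if v.IsFront then v.foldMid else bif c then v.foldLeft else v.foldRight

theorem foldPlace_front {v : Strip (n + 1)} (h : v.IsFront) (c : Bool) :
    foldPlace c v = v.foldMid := if_pos h

theorem foldPlace_true {v : Strip (n + 1)} (h : ¬ v.IsFront) :
    foldPlace true v = v.foldLeft := if_neg h

theorem foldPlace_false {v : Strip (n + 1)} (h : ¬ v.IsFront) :
    foldPlace false v = v.foldRight := if_neg h

theorem foldMid_le_left (v : Strip (n + 1)) : v.foldMid ≤ v.foldLeft :=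
  ⟨min_le_left _ _, min_le_left _ _⟩

theorem foldMid_le_right (v : Strip (n + 1)) : v.foldMid ≤ v.foldRight :=
  ⟨min_le_right _ _, min_le_right _ _⟩

theorem le_foldMid {u : Strip (2 * n + 1)} {v : Strip (n + 1)} (h : u ≤ v.foldLeft)
    (h' : u ≤ v.foldRight) : u ≤ v.foldMid :=
  ⟨le_min h.1 h'.1, le_min h.2 h'.2⟩

theorem foldMid_le_foldPlace (c : Bool) (v : Strip (n + 1)) : v.foldMid ≤ foldPlace c v := by
  unfold foldPlace
  split_ifs
  · exact le_refl _
  · cases c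
    · exact v.foldMid_le_right
    · exact v.foldMid_le_left

theorem foldLeft_mono {v w : Strip (n + 1)} (h : v ≤ w) : v.foldLeft ≤ w.foldLeft :=
  ⟨add_le_add_left (foldIndex_mono h.1) _, add_le_add_left (foldIndex_mono h.2) _⟩

theorem foldRight_mono {v w : Strip (n + 1)} (h : v ≤ w) : v.foldRight ≤ w.foldRight :=
  ⟨foldIndex_mono h.2, add_le_add_left (foldIndex_mono h.1) _⟩

theorem level_eq (v : Strip (n + 1)) : v.level = v.src / (n + 2) + v.tgt / (n + 2) := by
  rw [level, Nat.cast_succ, add_assoc (n : ℤ) 1 1, one_add_one_eq_two]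

theorem ediv_bounds (v : Strip (n + 1)) :
    v.src / (n + 2 : ℤ) ≤ v.tgt / (n + 2) ∧ v.tgt / (n + 2 : ℤ) ≤ v.src / (n + 2) + 1 := by
  have h1 := v.ediv_src_le
  have h2 := v.ediv_tgt_le
  rw [Nat.cast_succ, add_assoc (n : ℤ) 1 1, one_add_one_eq_two] at h1 h2
  exact ⟨h1, h2⟩

/-- The level determines the periods in which the two components of a place lie. -/
theorem ediv_of_level_eq {v w : Strip (n + 1)} (h : w.level = v.level) :
    w.src / (n + 2 : ℤ) = v.src / (n + 2) ∧ w.tgt / (n + 2 : ℤ) = v.tgt / (n + 2) := by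
  have h1 := v.ediv_bounds
  have h2 := w.ediv_bounds
  rw [level_eq, level_eq] at h
  omega

theorem ediv_of_level_eq_add_one {v w : Strip (n + 1)} (h : w.level = v.level + 1) :
    w.src / (n + 2 : ℤ) = v.tgt / (n + 2) ∧ w.tgt / (n + 2 : ℤ) = v.src / (n + 2) + 1 := by
  have h1 := v.ediv_bounds
  have h2 := w.ediv_bounds
  rw [level_eq, level_eq] at h
  omega

theorem dvd_of_le_of_ediv_eq {a b m : ℤ} (hm : 0 < m) (h : a ≤ b) (h' : b / m = a / m)
    (hb : m ∣ b) : a = b := by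
  obtain ⟨k, rfl⟩ := hb
  rw [Int.mul_ediv_cancel_left _ hm.ne'] at h'
  subst h'
  exact le_antisymm h (Int.mul_ediv_self_le hm.ne')

/-- Within a level, the front places form a lower set. -/
theorem IsFront.of_le {v w : Strip (n + 1)} (hw : w.IsFront) (h : v ≤ w)
    (hl : w.level = v.level) : v.IsFront := by
  obtain ⟨h1, h2⟩ := ediv_of_level_eq hl
  refine hw.imp (fun hd => ?_) fun hd => ?_
  · rwa [dvd_of_le_of_ediv_eq (by omega) h.1 h1 hd]
  · rwa [dvd_of_le_of_ediv_eq (by omega) h.2 h2 hd]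

theorem IsCorner.of_le {v w : Strip (n + 1)} (hw : w.IsCorner) (h : v ≤ w)
    (hl : w.level = v.level) : v.IsCorner := by
  obtain ⟨h1, h2⟩ := ediv_of_level_eq hl
  refine hw.imp (fun hd => ?_) fun hd => ?_
  · rwa [dvd_of_le_of_ediv_eq (by omega) h.1 h1 hd]
  · rwa [dvd_of_le_of_ediv_eq (by omega) h.2 h2 hd]

theorem IsCorner.isFront {v : Strip (n + 1)} (h : v.IsCorner) : v.IsFront := Or.inl h.1

theorem IsCorner.isFront_of_le {v w : Strip (n + 1)} (hw : w.IsCorner) (h : v ≤ w)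
    (hl : w.level = v.level + 1) : v.IsFront := by
  obtain ⟨h1, h2⟩ := ediv_of_level_eq_add_one hl
  have h3 := v.ediv_bounds
  obtain h4 | h4 : w.src / (n + 2 : ℤ) = v.src / (n + 2) ∨
    w.tgt / (n + 2 : ℤ) = v.tgt / (n + 2) := by omega
  · refine Or.inl ?_
    rw [dvd_of_le_of_ediv_eq (by omega) h.1 h4 hw.1]
    exact hw.1
  · refine Or.inr ?_
    rw [dvd_of_le_of_ediv_eq (by omega) h.2 h4 hw.2]
    exact hw.2

theorem foldPlace_mono {v w : Strip (n + 1)} (h : v ≤ w) (hl : w.level = v.level) (c : Bool) :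
    foldPlace c v ≤ foldPlace c w := by
  by_cases hv : v.IsFront
  · rw [foldPlace_front hv]
    exact (le_foldMid (v.foldMid_le_left.trans (foldLeft_mono h))
      (v.foldMid_le_right.trans (foldRight_mono h))).trans (foldMid_le_foldPlace c w)
  · have hw : ¬ w.IsFront := fun hw => hv (hw.of_le h hl)
    cases c
    · rw [foldPlace_false hv, foldPlace_false hw]
      exact foldRight_mono h
    · rw [foldPlace_true hv, foldPlace_true hw]
      exact foldLeft_mono h

/-- If the level increases by `1`, then both entries of `X` belonging to `v` map to both entries
belonging to `w`; see also `foldRight_le_foldMid`. -/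
theorem foldLeft_le_foldMid {v w : Strip (n + 1)} (h : v ≤ w) (hl : w.level = v.level + 1) :
    v.foldLeft ≤ w.foldMid := by
  refine le_foldMid (foldLeft_mono h) ?_
  obtain ⟨h1, h2⟩ := ediv_of_level_eq_add_one hl
  have b1 := foldIndex_bounds (n := n) v.src
  have b2 := foldIndex_bounds (n := n) v.tgt
  have b3 := foldIndex_bounds (n := n) w.src
  have b4 := foldIndex_bounds (n := n) w.tgt
  rw [h1] at b3
  rw [h2, mul_add] at b4
  constructor <;> dsimp only [foldLeft, foldRight] <;> omega

theorem foldRight_le_foldMid {v w : Strip (n + 1)} (h : v ≤ w) (hl : w.level = v.level + 1) :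
    v.foldRight ≤ w.foldMid := by
  refine le_foldMid ?_ (foldRight_mono h)
  obtain ⟨h1, h2⟩ := ediv_of_level_eq_add_one hl
  have b1 := foldIndex_bounds (n := n) v.src
  have b2 := foldIndex_bounds (n := n) v.tgt
  have b3 := foldIndex_bounds (n := n) w.src
  have b4 := foldIndex_bounds (n := n) w.tgt
  rw [h1] at b3
  rw [h2, mul_add] at b4
  constructor <;> dsimp only [foldLeft, foldRight] <;> omega

theorem foldPlace_le {v w : Strip (n + 1)} (h : v ≤ w) (hl : w.level = v.level + 1)
    (c c' : Bool) : foldPlace c v ≤ foldPlace c' w := by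
  refine le_trans ?_ (foldMid_le_foldPlace c' w)
  by_cases hv : v.IsFront
  · rw [foldPlace_front hv]
    exact v.foldMid_le_left.trans (foldLeft_le_foldMid h hl)
  · cases c
    · rw [foldPlace_false hv]
      exact foldRight_le_foldMid h hl
    · rw [foldPlace_true hv]
      exact foldLeft_le_foldMid h hl

theorem isFront_shift {v : Strip (n + 1)} : (shift (n + 1) v).IsFront ↔ v.IsFront := by
  have : (n + 2 : ℤ) ∣ v.src + ((n + 1 : ℕ) + 1) ↔ (n + 2 : ℤ) ∣ v.src := by
    rw [Nat.cast_succ, add_assoc (n : ℤ) 1 1, one_add_one_eq_two]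
    exact dvd_add_self_right
  change (_ ∨ (n + 2 : ℤ) ∣ v.src + ((n + 1 : ℕ) + 1)) ↔ _
  rw [this]
  exact or_comm

theorem isCorner_shift {v : Strip (n + 1)} : (shift (n + 1) v).IsCorner ↔ v.IsCorner := by
  have : (n + 2 : ℤ) ∣ v.src + ((n + 1 : ℕ) + 1) ↔ (n + 2 : ℤ) ∣ v.src := by
    rw [Nat.cast_succ, add_assoc (n : ℤ) 1 1, one_add_one_eq_two]
    exact dvd_add_self_right
  change (_ ∧ (n + 2 : ℤ) ∣ v.src + ((n + 1 : ℕ) + 1)) ↔ _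
  rw [this]
  exact and_comm

theorem foldLeft_shift (v : Strip (n + 1)) :
    (shift (n + 1) v).foldLeft = shift (2 * n + 1) v.foldLeft := by
  ext
  · rfl
  · change foldIndex n (v.src + ((n + 1 : ℕ) + 1)) + (n + 1) =
      foldIndex n v.src + (n + 1) + ((2 * n + 1 : ℕ) + 1)
    rw [Nat.cast_succ, add_assoc (n : ℤ) 1 1, one_add_one_eq_two, foldIndex_add]
    push_cast
    ring

theorem foldRight_shift (v : Strip (n + 1)) :
    (shift (n + 1) v).foldRight = shift (2 * n + 1) v.foldRight := by
  ext
  · change foldIndex n (v.src + ((n + 1 : ℕ) + 1)) = foldIndex n v.src + 2 * (n + 1)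
    rw [Nat.cast_succ, add_assoc (n : ℤ) 1 1, one_add_one_eq_two, foldIndex_add]
  · change foldIndex n v.tgt + 2 * (n + 1) = foldIndex n v.tgt + ((2 * n + 1 : ℕ) + 1)
    push_cast
    ring

theorem foldMid_shift (v : Strip (n + 1)) :
    (shift (n + 1) v).foldMid = shift (2 * n + 1) v.foldMid := by
  ext
  · change min (shift (n + 1) v).foldLeft.src (shift (n + 1) v).foldRight.src =
      min v.foldLeft.tgt v.foldRight.tgt
    rw [foldLeft_shift, foldRight_shift]
    rfl
  · change min (shift (n + 1) v).foldLeft.tgt (shift (n + 1) v).foldRight.tgt =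
      min v.foldLeft.src v.foldRight.src + ((2 * n + 1 : ℕ) + 1)
    rw [foldLeft_shift, foldRight_shift, ← min_add_add_right]
    rfl

theorem foldPlace_shift (c : Bool) (v : Strip (n + 1)) :
    foldPlace c (shift (n + 1) v) = shift (2 * n + 1) (foldPlace c v) := by
  by_cases hv : v.IsFront
  · rw [foldPlace_front hv, foldPlace_front (isFront_shift.2 hv), foldMid_shift]
  · cases c
    · rw [foldPlace_false hv, foldPlace_false (mt isFront_shift.1 hv), foldRight_shift]
    · rw [foldPlace_true hv, foldPlace_true (mt isFront_shift.1 hv), foldLeft_shift]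

theorem foldPlace_iter (c : Bool) (k : ℤ) (v : Strip (n + 1)) :
    foldPlace c (v.iter k) = (foldPlace c v).iter k := by
  induction k using Int.induction_on with
  | zero => simp [iter]
  | succ k ih => rw [← shift_iter, foldPlace_shift, ih, shift_iter]
  | pred k ih =>
    have := foldPlace_shift c (v.iter (-k - 1))
    rw [shift_iter, sub_add_cancel, ih] at this
    apply (shift (2 * n + 1)).injective
    rw [← this, shift_iter, sub_add_cancel]

theorem isFront_iter {k : ℤ} {v : Strip (n + 1)} : (v.iter k).IsFront ↔ v.IsFront := by
  induction k using Int.induction_on with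
  | zero => simp [iter]
  | succ k ih => rw [← shift_iter, isFront_shift, ih]
  | pred k ih => rw [← ih, ← isFront_shift, shift_iter, sub_add_cancel]

theorem isCorner_iter {k : ℤ} {v : Strip (n + 1)} : (v.iter k).IsCorner ↔ v.IsCorner := by
  induction k using Int.induction_on with
  | zero => simp [iter]
  | succ k ih => rw [← shift_iter, isCorner_shift, ih]
  | pred k ih => rw [← ih, ← isCorner_shift, shift_iter, sub_add_cancel]

theorem not_dvd_of_lt {a m : ℤ} (h : 0 < a) (h' : a < m) : ¬ m ∣ a :=
  fun hd => absurd (Int.le_of_dvd h hd) (by omega)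

/-- The place `α⁺¹/α` belonging to `α/ρ`. -/
theorem foldPlace_of_src_eq_zero {v : Strip (n + 1)} (h : v.src = 0) (h1 : 1 ≤ v.tgt)
    (h2 : v.tgt ≤ n + 1) (c : Bool) :
    (foldPlace c v).src = v.tgt - 1 ∧ (foldPlace c v).tgt = v.tgt + n := by
  have e1 : foldIndex n v.src = v.src - 1 := foldIndex_of_lt (by omega) (by omega)
  have e2 : foldIndex n v.tgt = v.tgt - 1 := foldIndex_of_lt (by omega) (by omega)
  rw [foldPlace_front (Or.inl (h ▸ dvd_zero _))]
  dsimp only [foldMid, foldLeft, foldRight]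
  rw [e1, e2]
  omega

/-- The place `γ⁺²/γ⁺¹` belonging to `ρ⁺¹/γ`. -/
theorem foldPlace_of_tgt_eq {v : Strip (n + 1)} (h : v.tgt = n + 2) (h1 : 1 ≤ v.src)
    (h2 : v.src ≤ n + 1) (c : Bool) :
    (foldPlace c v).src = v.src + n ∧ (foldPlace c v).tgt = v.src + 2 * n + 1 := by
  have e1 : foldIndex n v.src = v.src - 1 := foldIndex_of_lt (by omega) (by omega)
  have e2 : foldIndex n v.tgt = 2 * n + 1 := by rw [h, foldIndex_period]
  rw [foldPlace_front (Or.inr (h ▸ dvd_refl _))]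
  dsimp only [foldMid, foldLeft, foldRight]
  rw [e1, e2]
  omega

theorem not_isFront {v : Strip (n + 1)} (h1 : 1 ≤ v.src) (h2 : v.tgt ≤ n + 1) :
    ¬ v.IsFront := by
  have := v.le
  exact not_or_intro (not_dvd_of_lt (by omega) (by omega)) (not_dvd_of_lt (by omega) (by omega))

theorem foldPlace_true_of_le {v : Strip (n + 1)} (h1 : 1 ≤ v.src) (h2 : v.tgt ≤ n + 1) :
    (foldPlace true v).src = v.src + n ∧ (foldPlace true v).tgt = v.tgt + n := by
  have := v.le
  have e1 : foldIndex n v.src = v.src - 1 := foldIndex_of_lt (by omega) (by omega)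
  have e2 : foldIndex n v.tgt = v.tgt - 1 := foldIndex_of_lt (by omega) (by omega)
  rw [foldPlace_true (not_isFront h1 h2)]
  dsimp only [foldLeft]
  rw [e1, e2]
  omega

theorem foldPlace_false_of_le {v : Strip (n + 1)} (h1 : 1 ≤ v.src) (h2 : v.tgt ≤ n + 1) :
    (foldPlace false v).src = v.tgt - 1 ∧ (foldPlace false v).tgt = v.src + 2 * n + 1 := by
  have := v.le
  have e1 : foldIndex n v.src = v.src - 1 := foldIndex_of_lt (by omega) (by omega)
  have e2 : foldIndex n v.tgt = v.tgt - 1 := foldIndex_of_lt (by omega) (by omega)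
  rw [foldPlace_false (not_isFront h1 h2)]
  dsimp only [foldRight]
  rw [e1, e2]
  omega

end Strip

end FoldPlace

/-! ### Construction of foldings -/

section FoldRep

open Strip

variable {C : Type u} [Category.{v} C] [Preadditive C] {n : ℕ} {X : Strip (2 * n + 1) ⥤ C}

/-- The condition on a pair of morphisms from an object to the entries of `X` belonging to the place
`v` of a folding to define a morphism to the entry of the folding: at a front place, both morphisms
agree, and at a corner, they vanish. -/
def FoldFamily (X : Strip (2 * n + 1) ⥤ C) (v : Strip (n + 1)) {S : C}
    (f : ∀ c, S ⟶ X.obj (foldPlace c v)) : Prop :=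
  (∀ (h : v.IsFront) (c c' : Bool),
    f c ≫ arr X ((foldPlace_front h c).trans (foldPlace_front h c').symm).le = f c') ∧
  (v.IsCorner → ∀ c, f c = 0)

/-- The universal property of the entry at `v` of a folding of `X`. -/
structure IsFoldLimit (X : Strip (2 * n + 1) ⥤ C) (v : Strip (n + 1)) {O : C}
    (π : ∀ c, O ⟶ X.obj (foldPlace c v)) : Prop where
  family : FoldFamily X v π
  hom_ext : ∀ {S : C} {a b : S ⟶ O}, (∀ c, a ≫ π c = b ≫ π c) → a = b
  exists_lift : ∀ {S : C} (f : ∀ c, S ⟶ X.obj (foldPlace c v)), FoldFamily X v f →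
    ∃ a : S ⟶ O, ∀ c, a ≫ π c = f c

theorem FoldFamily.comp {v : Strip (n + 1)} {S S' : C} {f : ∀ c, S ⟶ X.obj (foldPlace c v)}
    (hf : FoldFamily X v f) (a : S' ⟶ S) : FoldFamily X v (fun c => a ≫ f c) :=
  ⟨fun h c c' => by rw [Category.assoc, hf.1 h], fun h c => by dsimp only; rw [hf.2 h, comp_zero]⟩

/-- The entry is zero at a corner, an entry of `X` at the other front places, and a direct sum of
two entries of `X` elsewhere. -/
theorem exists_isFoldLimit [WeaklyAbelian C] (X : Strip (2 * n + 1) ⥤ C) (v : Strip (n + 1)) :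
    ∃ (O : C) (π : ∀ c, O ⟶ X.obj (foldPlace c v)), IsFoldLimit X v π := by
  by_cases hc : v.IsCorner
  · have : HasZeroObject C := hasZeroObject_of_hasFiniteBiproducts C
    obtain ⟨O, hO⟩ := HasZeroObject.zero (C := C)
    refine ⟨O, fun c => 0, ⟨by simp, by simp⟩, fun _ => hO.eq_of_tgt _ _, fun f hf =>
      ⟨0, fun c => ?_⟩⟩
    rw [hf.2 hc, comp_zero]
  by_cases hv : v.IsFront
  · refine ⟨X.obj v.foldMid, fun c => arr X (foldPlace_front hv c).ge,
      ⟨fun h c c' => arr_comp _ _ _, fun h => absurd h hc⟩, fun {S a b} h => ?_, fun {S} f hf =>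
      ⟨f true ≫ arr X (foldPlace_front hv true).le, fun c => ?_⟩⟩
    · have := h true =≫ arr X (foldPlace_front hv true).le
      rwa [Category.assoc, Category.assoc, arr_comp, arr_self, Category.comp_id,
        Category.comp_id] at this
    · rw [Category.assoc, arr_comp, hf.1 hv]
  · refine ⟨X.obj (foldPlace true v) ⊞ X.obj (foldPlace false v), fun c =>
      match c with
      | true => biprod.fst
      | false => biprod.snd, ⟨fun h => absurd h hv, fun h => absurd h hc⟩, fun {S a b} h => ?_,
      fun {S} f hf => ⟨biprod.lift (f true) (f false), fun c => ?_⟩⟩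
    · exact biprod.hom_ext _ _ (h true) (h false)
    · cases c
      · exact biprod.lift_snd _ _
      · exact biprod.lift_fst _ _

/-- `a` is the morphism of a folding of `X` belonging to `v ≤ w`. Within a level, it is given by a
diagonal matrix of morphisms of `X`. If the level increases by `1`, then all its components are
differences of the morphisms of `X` starting at the two entries belonging to `v`. If the level
increases further, it is zero. -/
structure IsFoldArr {v w : Strip (n + 1)} (h : v ≤ w) {O O' : C}
    (π : ∀ c, O ⟶ X.obj (foldPlace c v)) (π' : ∀ c, O' ⟶ X.obj (foldPlace c w))
    (a : O ⟶ O') : Prop where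
  zero : ∀ (hl : w.level = v.level) (c : Bool), a ≫ π' c = π c ≫ arr X (foldPlace_mono h hl c)
  one : ∀ (hl : w.level = v.level + 1) (c : Bool),
    a ≫ π' c = π true ≫ arr X (foldPlace_le h hl true c) -
      π false ≫ arr X (foldPlace_le h hl false c)
  two : v.level + 2 ≤ w.level → a = 0

variable {u v w : Strip (n + 1)} {O O' O'' : C} {π : ∀ c, O ⟶ X.obj (foldPlace c v)}
  {π' : ∀ c, O' ⟶ X.obj (foldPlace c w)}

theorem IsFoldArr.ext {h : v ≤ w} (hπ' : IsFoldLimit X w π') {a b : O ⟶ O'}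
    (ha : IsFoldArr h π π' a) (hb : IsFoldArr h π π' b) : a = b := by
  have hl := level_mono h
  by_cases h0 : w.level = v.level
  · exact hπ'.hom_ext fun c => by rw [ha.zero h0, hb.zero h0]
  by_cases h1 : w.level = v.level + 1
  · exact hπ'.hom_ext fun c => by rw [ha.one h1, hb.one h1]
  · rw [ha.two (by omega), hb.two (by omega)]

theorem IsFoldArr.exists (h : v ≤ w) (hπ : FoldFamily X v π) (hπ' : IsFoldLimit X w π') :
    ∃ a, IsFoldArr h π π' a := by
  have hl := level_mono h
  by_cases h0 : w.level = v.level
  · obtain ⟨a, ha⟩ := hπ'.exists_lift (fun c => π c ≫ arr X (foldPlace_mono h h0 c))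
      ⟨fun hw c c' => by
        dsimp only
        rw [Category.assoc, arr_comp, ← hπ.1 (hw.of_le h h0) c c', Category.assoc, arr_comp],
      fun hw c => by dsimp only; rw [hπ.2 (hw.of_le h h0), zero_comp]⟩
    exact ⟨a, fun _ => ha, fun h1 => by omega, fun h2 => by omega⟩
  by_cases h1 : w.level = v.level + 1
  · obtain ⟨a, ha⟩ := hπ'.exists_lift (fun c => π true ≫ arr X (foldPlace_le h h1 true c) -
        π false ≫ arr X (foldPlace_le h h1 false c))
      ⟨fun hw c c' => by
        rw [Preadditive.sub_comp, Category.assoc, Category.assoc, arr_comp, arr_comp],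
      fun hw c => by
        dsimp only
        rw [← hπ.1 (hw.isFront_of_le h h1) true false, Category.assoc, arr_comp, sub_self]⟩
    exact ⟨a, fun h0 => by omega, fun _ => ha, fun h2 => by omega⟩
  · exact ⟨0, fun h0' => by omega, fun h1' => by omega, fun _ => rfl⟩

theorem IsFoldArr.id : IsFoldArr (le_refl v) π π (𝟙 O) :=
  ⟨fun _ c => by rw [arr_self, Category.id_comp, Category.comp_id], fun h => by omega,
    fun h => by omega⟩

theorem IsFoldArr.comp {π'' : ∀ c, O'' ⟶ X.obj (foldPlace c u)} {h : v ≤ w} {h' : w ≤ u}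
    (hπ'' : IsFoldLimit X u π'') {a : O ⟶ O'} {b : O' ⟶ O''} (ha : IsFoldArr h π π' a)
    (hb : IsFoldArr h' π' π'' b) : IsFoldArr (h.trans h') π π'' (a ≫ b) := by
  have l1 := level_mono h
  have l2 := level_mono h'
  refine ⟨fun hl c => ?_, fun hl c => ?_, fun hl => ?_⟩
  · rw [Category.assoc, hb.zero (by omega), reassoc_of% ha.zero (by omega), arr_comp]
  · rw [Category.assoc]
    by_cases h0 : w.level = v.level
    · rw [hb.one (by omega), Preadditive.comp_sub, reassoc_of% ha.zero h0, reassoc_of% ha.zero h0,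
        arr_comp, arr_comp]
    · rw [hb.zero (by omega), reassoc_of% ha.one (by omega), Preadditive.sub_comp, Category.assoc,
        Category.assoc, arr_comp, arr_comp]
  · by_cases h0 : v.level + 2 ≤ w.level
    · rw [ha.two h0, zero_comp]
    by_cases h0' : w.level + 2 ≤ u.level
    · rw [hb.two h0', comp_zero]
    -- both jumps are by `1`, and the two differences cancel
    refine hπ''.hom_ext fun c => ?_
    rw [Category.assoc, hb.one (by omega), Preadditive.comp_sub, reassoc_of% ha.one (by omega),
      reassoc_of% ha.one (by omega), Preadditive.sub_comp, Preadditive.sub_comp]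
    simp only [Category.assoc, arr_comp]
    rw [sub_self, zero_comp]

/-- A diagram `Y` obtained from `X` by folding, with the description of its entries and morphisms
uniform over all places. -/
structure FoldRep (X : Strip (2 * n + 1) ⥤ C) (Y : Strip (n + 1) ⥤ C) where
  π : ∀ v c, Y.obj v ⟶ X.obj (foldPlace c v)
  isFoldLimit : ∀ v, IsFoldLimit X v (π v)
  isFoldArr : ∀ {v w} (h : v ≤ w), IsFoldArr h (π v) (π w) (arr Y h)

theorem exists_foldRep [WeaklyAbelian C] (X : Strip (2 * n + 1) ⥤ C) :
    ∃ Y : Strip (n + 1) ⥤ C, Nonempty (FoldRep X Y) := by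
  choose O π hπ using exists_isFoldLimit X
  choose a ha using fun {v w} (h : v ≤ w) => IsFoldArr.exists h (hπ v).family (hπ w)
  exact ⟨{ obj := O
           map := fun h => a (leOfHom h)
           map_id := fun v => (ha _).ext (hπ v) .id
           map_comp := fun {v w z} h h' => (ha _).ext (hπ z) ((ha _).comp (hπ z) (ha _)) },
    ⟨⟨π, hπ, fun h => ha h⟩⟩⟩

namespace FoldRep

variable {Y : Strip (n + 1) ⥤ C} (R : FoldRep X Y)

/-- The transport along an isomorphism of diagrams. -/
def ofIso {Z : Strip (n + 1) ⥤ C} (σ : Z ≅ Y) : FoldRep X Z where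
  π v c := σ.hom.app v ≫ R.π v c
  isFoldLimit v :=
    { family := (R.isFoldLimit v).family.comp _
      hom_ext := fun {S a b} h => by
        rw [← cancel_mono (σ.hom.app v)]
        exact (R.isFoldLimit v).hom_ext fun c => by
          rw [Category.assoc, Category.assoc]; exact h c
      exists_lift := fun {S} f hf => by
        obtain ⟨a, ha⟩ := (R.isFoldLimit v).exists_lift f hf
        refine ⟨a ≫ σ.inv.app v, fun c => ?_⟩
        rw [Category.assoc, Iso.inv_hom_id_app_assoc, ha] }
  isFoldArr {v w} h := by
    have H := R.isFoldArr h
    refine ⟨fun hl c => ?_, fun hl c => ?_, fun hl => ?_⟩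
    · rw [reassoc_of% arr_naturality σ.hom h, H.zero hl, Category.assoc]
    · rw [reassoc_of% arr_naturality σ.hom h, H.one hl, Preadditive.comp_sub, Category.assoc,
        Category.assoc]
    · rw [← cancel_mono (σ.hom.app w), arr_naturality, H.two hl, comp_zero, zero_comp]

/-- The projection of the entry at `v` of a folding to an entry of `X`, the place `a` of the latter
being given up to equality. -/
def proj (c : Bool) {v : Strip (n + 1)} {a : Strip (2 * n + 1)} (h : foldPlace c v = a) :
    Y.obj v ⟶ X.obj a := R.π v c ≫ arr X h.le

theorem proj_zero {v w : Strip (n + 1)} (h : v ≤ w) (hl : w.level = v.level) {c : Bool}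
    {a b : Strip (2 * n + 1)} (ha : foldPlace c v = a) (hb : foldPlace c w = b) (hab : a ≤ b) :
    arr Y h ≫ R.proj c hb = R.proj c ha ≫ arr X hab := by
  rw [proj, proj, reassoc_of% (R.isFoldArr h).zero hl, Category.assoc, arr_comp, arr_comp]

theorem proj_one {v w : Strip (n + 1)} (h : v ≤ w) (hl : w.level = v.level + 1) {c : Bool}
    {a a' b : Strip (2 * n + 1)} (ha : foldPlace true v = a) (ha' : foldPlace false v = a')
    (hb : foldPlace c w = b) (hab : a ≤ b) (hab' : a' ≤ b) :
    arr Y h ≫ R.proj c hb = R.proj true ha ≫ arr X hab - R.proj false ha' ≫ arr X hab' := by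
  rw [proj, proj, proj, reassoc_of% (R.isFoldArr h).one hl, Preadditive.sub_comp]
  simp only [Category.assoc, arr_comp]

theorem proj_front {v : Strip (n + 1)} (hv : v.IsFront) {c c' : Bool} {a : Strip (2 * n + 1)}
    (ha : foldPlace c v = a) (ha' : foldPlace c' v = a) : R.proj c ha = R.proj c' ha' := by
  rw [proj, proj, ← (R.isFoldLimit v).family.1 hv c c', Category.assoc, arr_comp]

theorem hom_ext {v : Strip (n + 1)} {a b : Strip (2 * n + 1)} (ha : foldPlace true v = a)
    (hb : foldPlace false v = b) {S : C} {s t : S ⟶ Y.obj v}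
    (h : s ≫ R.proj true ha = t ≫ R.proj true ha)
    (h' : s ≫ R.proj false hb = t ≫ R.proj false hb) : s = t := by
  subst ha hb
  refine (R.isFoldLimit v).hom_ext fun c => ?_
  cases c
  · simpa only [proj, arr_self, Category.comp_id] using h'
  · simpa only [proj, arr_self, Category.comp_id] using h

theorem hom_ext_front {v : Strip (n + 1)} (hv : v.IsFront) {c : Bool} {a : Strip (2 * n + 1)}
    (ha : foldPlace c v = a) {S : C} {s t : S ⟶ Y.obj v} (h : s ≫ R.proj c ha = t ≫ R.proj c ha) :
    s = t := by
  have e : ∀ c', foldPlace c' v = a := fun c' =>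
    (foldPlace_front hv c').trans ((foldPlace_front hv c).symm.trans ha)
  refine R.hom_ext (e true) (e false) ?_ ?_
  · rwa [R.proj_front hv _ ha]
  · rwa [R.proj_front hv _ ha]

theorem exists_lift {v : Strip (n + 1)} (hv : ¬ v.IsFront) {a b : Strip (2 * n + 1)}
    (ha : foldPlace true v = a) (hb : foldPlace false v = b) {S : C} (f : S ⟶ X.obj a)
    (g : S ⟶ X.obj b) : ∃ s : S ⟶ Y.obj v, s ≫ R.proj true ha = f ∧ s ≫ R.proj false hb = g := by
  subst ha hb
  obtain ⟨s, hs⟩ := (R.isFoldLimit v).exists_lift (S := S)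
    (fun c => match c with
      | true => f
      | false => g) ⟨fun h => absurd h hv, fun h => absurd h.isFront hv⟩
  refine ⟨s, ?_, ?_⟩
  · rw [proj, arr_self, Category.comp_id]; exact hs true
  · rw [proj, arr_self, Category.comp_id]; exact hs false

theorem exists_lift_front {v : Strip (n + 1)} (hv : v.IsFront) (hv' : ¬ v.IsCorner) {c : Bool}
    {a : Strip (2 * n + 1)} (ha : foldPlace c v = a) {S : C} (f : S ⟶ X.obj a) :
    ∃ s : S ⟶ Y.obj v, s ≫ R.proj c ha = f := by
  have e : ∀ c', foldPlace c' v = a := fun c' =>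
    (foldPlace_front hv c').trans ((foldPlace_front hv c).symm.trans ha)
  obtain ⟨s, hs⟩ := (R.isFoldLimit v).exists_lift (fun c' => f ≫ arr X (e c').ge)
    ⟨fun h c c' => by rw [Category.assoc, arr_comp], fun h => absurd h hv'⟩
  refine ⟨s, ?_⟩
  rw [proj, reassoc_of% hs c, arr_comp, arr_self, Category.comp_id]

theorem isZero_of_isCorner (R : FoldRep X Y) {v : Strip (n + 1)} (hv : v.IsCorner) :
    IsZero (Y.obj v) := by
  rw [IsZero.iff_id_eq_zero]
  refine (R.isFoldLimit v).hom_ext fun c => ?_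
  rw [(R.isFoldLimit v).family.2 hv, comp_zero, comp_zero]

end FoldRep

end FoldRep

/-! ### Periodicity of foldings -/

section PeriodicFolding

open Strip

variable {n : ℕ}

theorem Fold.foldPlace_rho (c : Bool) (k : ℤ) (α : Fin (n + 1)) :
    foldPlace c ((rho α).iter k) = (loop α).iter k := by
  obtain ⟨h1, h2⟩ := foldPlace_of_src_eq_zero (v := rho α) rfl (by dsimp [rho]; omega)
    (by dsimp [rho]; omega) c
  rw [foldPlace_iter]
  congr 1
  ext
  · rw [h1]; dsimp [rho, loop]; omega
  · rw [h2]; dsimp [rho, loop]; omega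

theorem Fold.foldPlace_true_pair (k : ℤ) (α β : Fin (n + 1)) (h : α ≤ β) :
    foldPlace true ((pair α β h).iter k) = (left α β h).iter k := by
  obtain ⟨h1, h2⟩ := foldPlace_true_of_le (v := pair α β h) (by dsimp [pair]; omega)
    (by dsimp [pair]; omega)
  rw [foldPlace_iter]
  congr 1
  ext
  · rw [h1]; dsimp [pair, left]; omega
  · rw [h2]; dsimp [pair, left]; omega

theorem Fold.foldPlace_false_pair (k : ℤ) (α β : Fin (n + 1)) (h : α ≤ β) :
    foldPlace false ((pair α β h).iter k) = (right α β h).iter k := by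
  obtain ⟨h1, h2⟩ := foldPlace_false_of_le (v := pair α β h) (by dsimp [pair]; omega)
    (by dsimp [pair]; omega)
  rw [foldPlace_iter]
  congr 1
  ext
  · rw [h1]; dsimp [pair, right]; omega
  · rw [h2]; dsimp [pair, right]; omega

theorem Fold.isFront_rho (k : ℤ) (α : Fin (n + 1)) : ((rho α).iter k).IsFront :=
  isFront_iter.2 (Or.inl (dvd_zero _))

theorem Fold.not_isCorner_rho (k : ℤ) (α : Fin (n + 1)) : ¬ ((rho α).iter k).IsCorner :=
  fun h => not_dvd_of_lt (by dsimp [rho]; omega) (by dsimp [rho]; omega) (isCorner_iter.1 h).2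

theorem Fold.not_isFront_pair (k : ℤ) (α β : Fin (n + 1)) (h : α ≤ β) :
    ¬ ((pair α β h).iter k).IsFront :=
  mt isFront_iter.1 (not_isFront (by dsimp [pair]; omega) (by dsimp [pair]; omega))

theorem Fold.level_rho (k : ℤ) (α : Fin (n + 1)) : ((rho α).iter k).level = k := by
  rw [level_iter, level_eq_zero_iff.2 ⟨by dsimp [rho]; omega, by dsimp [rho]; omega⟩, zero_add]

theorem Fold.level_pair (k : ℤ) (α β : Fin (n + 1)) (h : α ≤ β) :
    ((pair α β h).iter k).level = k := by
  rw [level_iter, level_eq_zero_iff.2 ⟨by dsimp [pair]; omega, by dsimp [pair]; omega⟩, zero_add]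

variable {C : Type u} [Category.{v} C] [Preadditive C] {X : Strip (2 * n + 1) ⥤ C}
  {Y : Strip (n + 1) ⥤ C}

namespace FoldRep

theorem isIso_proj (R : FoldRep X Y) {v : Strip (n + 1)} (hv : v.IsFront) (hv' : ¬ v.IsCorner)
    {c : Bool} {a : Strip (2 * n + 1)} (ha : foldPlace c v = a) : IsIso (R.proj c ha) := by
  obtain ⟨s, hs⟩ := R.exists_lift_front hv hv' ha (𝟙 _)
  refine ⟨s, R.hom_ext_front hv ha ?_, hs⟩
  rw [Category.assoc, hs, Category.comp_id, Category.id_comp]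

theorem isDirectSum_proj (R : FoldRep X Y) {v : Strip (n + 1)} (hv : ¬ v.IsFront)
    {a b : Strip (2 * n + 1)} (ha : foldPlace true v = a) (hb : foldPlace false v = b) :
    IsDirectSum (R.proj true ha) (R.proj false hb) := by
  obtain ⟨i, h1, h2⟩ := R.exists_lift hv ha hb (𝟙 _) 0
  obtain ⟨j, h3, h4⟩ := R.exists_lift hv ha hb 0 (𝟙 _)
  refine ⟨i, j, h1, h2, h3, h4, R.hom_ext ha hb ?_ ?_⟩
  · simp [h1, h3]
  · simp [h2, h4]

/-- The folding of `X` given by a uniform description. -/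
def toFolding (R : FoldRep X Y) : Folding X Y where
  single k α :=
    have := R.isIso_proj (Fold.isFront_rho k α) (Fold.not_isCorner_rho k α)
      (Fold.foldPlace_rho true k α)
    asIso (R.proj true (Fold.foldPlace_rho true k α))
  fst k α β h := R.proj true (Fold.foldPlace_true_pair k α β h)
  snd k α β h := R.proj false (Fold.foldPlace_false_pair k α β h)
  isDirectSum k α β h := R.isDirectSum_proj (Fold.not_isFront_pair k α β h) _ _
  rho_rho k α β h := R.proj_zero _ (by rw [Fold.level_rho, Fold.level_rho])
    (Fold.foldPlace_rho true k α) (Fold.foldPlace_rho true k β) _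
  rho_pair_fst k α β h := R.proj_zero _ (by rw [Fold.level_rho, Fold.level_pair])
    (Fold.foldPlace_rho true k β) _ _
  rho_pair_snd k α β h := by
    refine (R.proj_zero _ (by rw [Fold.level_rho, Fold.level_pair])
      (Fold.foldPlace_rho false k β) _ (iter_mono k (Fold.loop_le_right α β h))).trans ?_
    rw [R.proj_front (Fold.isFront_rho k β) _ (Fold.foldPlace_rho true k β)]
    rfl
  pair_pair_fst k α β γ δ h h' h₁ h₂ :=
    R.proj_zero _ (by rw [Fold.level_pair, Fold.level_pair]) _ _ _
  pair_pair_snd k α β γ δ h h' h₁ h₂ :=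
    R.proj_zero _ (by rw [Fold.level_pair, Fold.level_pair]) _ _ _
  pair_rho k γ δ h := R.proj_one _ (by rw [Fold.level_rho, Fold.level_pair]) _ _
    (Fold.foldPlace_rho true (k + 1) γ) _ _

variable {T : CatAut C}

/-- The uniqueness part of the universal property of the image of an entry under `T`. -/
theorem map_hom_ext (R : FoldRep X Y) {v : Strip (n + 1)} {S : C}
    {a b : S ⟶ T.functor.obj (Y.obj v)}
    (h : ∀ c, a ≫ T.functor.map (R.π v c) = b ≫ T.functor.map (R.π v c)) : a = b := by
  obtain ⟨S, rfl⟩ := T.exists_obj_eq S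
  obtain ⟨a, rfl⟩ := T.functor.map_surjective a
  obtain ⟨b, rfl⟩ := T.functor.map_surjective b
  congr 1
  refine (R.isFoldLimit v).hom_ext fun c => T.functor.map_injective ?_
  rw [T.functor.map_comp, T.functor.map_comp, h]

variable [WeaklyAbelian C]

/-- The existence part of the universal property of the image of an entry under `T`. -/
theorem map_exists_lift (R : FoldRep X Y) {v : Strip (n + 1)} {S : C}
    (f : ∀ c, S ⟶ T.functor.obj (X.obj (foldPlace c v)))
    (hf : ∀ (h : v.IsFront) (c c' : Bool), f c ≫ T.functor.map
      (arr X ((foldPlace_front h c).trans (foldPlace_front h c').symm).le) = f c')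
    (hf' : v.IsCorner → ∀ c, f c = 0) :
    ∃ a : S ⟶ T.functor.obj (Y.obj v), ∀ c, a ≫ T.functor.map (R.π v c) = f c := by
  obtain ⟨S, rfl⟩ := T.exists_obj_eq S
  choose g hg using fun c => T.functor.map_surjective (f c)
  obtain ⟨a, ha⟩ := (R.isFoldLimit v).exists_lift g
    ⟨fun h c c' => T.functor.map_injective (by
        rw [T.functor.map_comp, hg, hg, hf h]),
      fun h c => T.functor.map_injective (by rw [hg, hf' h, Functor.map_zero])⟩
  exact ⟨T.functor.map a, fun c => by rw [← T.functor.map_comp, ha, hg]⟩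

/-- A periodicity of `X` induces one of every folding of `X`. -/
theorem exists_periodicity (R : FoldRep X Y) (P : Periodicity T X) :
    ∃ Q : Periodicity T Y, ∀ (v : Strip (n + 1)) (c : Bool),
      (Q.iso v).hom ≫ T.functor.map (R.π v c) =
        R.π (shift (n + 1) v) c ≫ arr X (foldPlace_shift c v).le ≫ (P.iso _).hom := by
  have hex : ∀ v, ∃ φ : Y.obj (shift (n + 1) v) ⟶ T.functor.obj (Y.obj v), ∀ c,
      φ ≫ T.functor.map (R.π v c) =
        R.π (shift (n + 1) v) c ≫ arr X (foldPlace_shift c v).le ≫ (P.iso _).hom := by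
    intro v
    have H := (R.isFoldLimit (shift (n + 1) v)).family
    refine R.map_exists_lift _ (fun h c c' => ?_) fun h c => ?_
    · rw [Category.assoc, Category.assoc, ← P.naturality, ← H.1 (isFront_shift.2 h) c c',
        Category.assoc, ← Category.assoc (arr X _) (arr X _), arr_comp,
        ← Category.assoc (arr X _) (arr X _), arr_comp]
    · rw [H.2 (isCorner_shift.2 h), zero_comp]
  choose φ hφ using hex
  have hex' : ∀ v, ∃ ψ : T.functor.obj (Y.obj v) ⟶ Y.obj (shift (n + 1) v), ∀ c,
      ψ ≫ R.π (shift (n + 1) v) c =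
        T.functor.map (R.π v c) ≫ (P.iso _).inv ≫ arr X (foldPlace_shift c v).ge := by
    intro v
    have H := (R.isFoldLimit v).family
    refine (R.isFoldLimit (shift (n + 1) v)).exists_lift _ ⟨fun h c c' => ?_, fun h c => ?_⟩
    · have hn : ∀ {a b : Strip (2 * n + 1)} (h : a ≤ b), (P.iso a).inv ≫ arr X (shift_mono h) =
          T.functor.map (arr X h) ≫ (P.iso b).inv := fun {a b} h => by
        rw [Iso.inv_comp_eq, ← Category.assoc, ← P.naturality h, Category.assoc, Iso.hom_inv_id,
          Category.comp_id]
      have h' := isFront_shift.1 h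
      dsimp only
      rw [← H.1 h' c c', T.functor.map_comp, Category.assoc, Category.assoc, Category.assoc,
        ← reassoc_of% hn, arr_comp, arr_comp]
    · dsimp only
      rw [H.2 (isCorner_shift.1 h), Functor.map_zero, zero_comp]
  choose ψ hψ using hex'
  refine ⟨{ iso := fun v => ⟨φ v, ψ v, ?_, ?_⟩, naturality := fun {v w} h => ?_ }, hφ⟩
  · refine (R.isFoldLimit _).hom_ext fun c => ?_
    rw [Category.assoc, hψ, reassoc_of% hφ, Iso.hom_inv_id_assoc, arr_comp, arr_self,
      Category.id_comp, Category.comp_id]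
  · refine R.map_hom_ext fun c => ?_
    rw [Category.assoc, hφ, reassoc_of% hψ, ← Category.assoc (arr X _) (arr X _), arr_comp,
      arr_self, Category.id_comp, Iso.inv_hom_id, Category.id_comp, Category.comp_id]
  · have H := R.isFoldArr h
    have H' := R.isFoldArr (shift_mono h)
    have hl := level_mono h
    by_cases h0 : w.level = v.level
    · refine R.map_hom_ext fun c => ?_
      rw [Category.assoc, Category.assoc, hφ, ← T.functor.map_comp, H.zero h0,
        T.functor.map_comp, reassoc_of% hφ,
        reassoc_of% H'.zero (by rw [level_shift, level_shift, h0]),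
        ← P.naturality, ← Category.assoc (arr X _) (arr X _), arr_comp,
        ← Category.assoc (arr X _) (arr X _), arr_comp]
    by_cases h1 : w.level = v.level + 1
    · refine R.map_hom_ext fun c => ?_
      rw [Category.assoc, Category.assoc, hφ, ← T.functor.map_comp, H.one h1,
        T.functor.map_sub, T.functor.map_comp, T.functor.map_comp, Preadditive.comp_sub,
        reassoc_of% hφ, reassoc_of% hφ,
        reassoc_of% H'.one (by rw [level_shift, level_shift, h1]), Preadditive.sub_comp]
      simp only [Category.assoc, ← P.naturality]
      congr 2 <;> rw [← Category.assoc (arr X _) (arr X _), arr_comp,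
        ← Category.assoc (arr X _) (arr X _), arr_comp]
    · rw [H.two (by omega), H'.two (by rw [level_shift, level_shift]; omega), Functor.map_zero,
        comp_zero, zero_comp]

end FoldRep

end PeriodicFolding

/-! ### Foldings are pretriangles -/

section FoldPretriangle

open Strip

variable {C : Type u} [Category.{v} C] [Preadditive C] [WeaklyAbelian C] {n : ℕ} {T : CatAut C}

theorem IsPretriangle.isZero_of_src_eq_tgt {X : Strip n ⥤ C} (hX : IsPretriangle X) {v : Strip n}
    (hv : v.src = v.tgt) : IsZero (X.obj v) := by
  obtain ⟨a, b, h, h'⟩ := v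
  obtain rfl : a = b := hv
  exact hX.isZero_diag a

theorem IsPretriangle.isZero_of_tgt_eq {X : Strip n ⥤ C} (hX : IsPretriangle X) {v : Strip n}
    (hv : v.tgt = v.src + (n + 1)) : IsZero (X.obj v) := by
  obtain ⟨a, b, h, h'⟩ := v
  obtain rfl : b = a + (n + 1) := hv
  exact hX.isZero_shift a

/-- The weak square on the corners of a rectangle in the strip. -/
theorem IsPretriangle.exists_lift {X : Strip n ⥤ C} (hX : IsPretriangle X)
    {A B A' B' : Strip n} (hf : A ≤ B) (hg : A ≤ A') (hh : B ≤ B') (hk : A' ≤ B')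
    (h1 : A.src = B.src) (h2 : A.tgt = A'.tgt) (h3 : B.tgt = B'.tgt) (h4 : A'.src = B'.src)
    {S : C} (b : S ⟶ X.obj B) (c : S ⟶ X.obj A') (hbc : b ≫ arr X hh = c ≫ arr X hk) :
    ∃ a : S ⟶ X.obj A, a ≫ arr X hf = b ∧ a ≫ arr X hg = c := by
  obtain ⟨a, γ, l1, l2⟩ := A
  obtain ⟨a', d, l3, l4⟩ := B
  obtain ⟨β, γ', l5, l6⟩ := A'
  obtain ⟨β', d', l7, l8⟩ := B'
  obtain rfl : a = a' := h1
  obtain rfl : γ = γ' := h2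
  obtain rfl : d = d' := h3
  obtain rfl : β = β' := h4
  have h5 : a ≤ β := hg.1
  have h6 : γ ≤ d := hf.2
  exact (hX.isWeakSquare a β γ d (by omega) h5 l5 h6 l4).exists_lift b c hbc

/-- A folding of a pretriangle is a pretriangle, provided that it is periodic up to isomorphism. -/
theorem FoldRep.isPretriangle {X : Strip (2 * n + 1) ⥤ C} {Y : Strip (n + 1) ⥤ C}
    (R : FoldRep X Y) (hX : IsPretriangle X) (Q : Periodicity T Y) : IsPretriangle Y := by
  have mk : ∀ a b : ℤ, a ≤ b → b ≤ a + 2 * n + 2 →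
      ∃ x : Strip (2 * n + 1), x.src = a ∧ x.tgt = b := fun a b h h' =>
    Strip.exists_eq h (by push_cast; omega)
  refine Q.isPretriangle (fun v hv => ?_) ?_ ?_ ?_
  · by_cases hf : v.IsFront
    · refine R.isZero_of_isCorner ?_
      rcases hf with h | h
      · exact ⟨h, hv ▸ h⟩
      · exact ⟨hv ▸ h, h⟩
    · have z1 : IsZero (X.obj v.foldLeft) :=
        hX.isZero_of_src_eq_tgt (by dsimp only [foldLeft]; rw [hv])
      have z2 : IsZero (X.obj v.foldRight) :=
        hX.isZero_of_tgt_eq (by dsimp only [foldRight]; rw [hv]; push_cast; ring)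
      rw [IsZero.iff_id_eq_zero]
      exact R.hom_ext (foldPlace_true hf) (foldPlace_false hf) (z1.eq_of_tgt _ _)
        (z2.eq_of_tgt _ _)
  · intro u v w h h' H hv hv' S t ht
    obtain ⟨e1, e2, e3⟩ := H
    have l1 := u.le
    have l2 := w.le
    push_cast at hv'
    by_cases hy : u.tgt = 0
    · obtain rfl : v = w := by ext <;> omega
      rw [arr_self, Category.comp_id] at ht
      exact ⟨0, by rw [ht, zero_comp]⟩
    have lu : u.level = 0 := level_eq_zero_iff.2 ⟨by omega, by push_cast; omega⟩
    have lv : v.level = 0 := level_eq_zero_iff.2 ⟨by omega, by push_cast; omega⟩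
    have lw : w.level = 0 := level_eq_zero_iff.2 ⟨by omega, by push_cast; omega⟩
    have fu : u.IsFront := Or.inl (by rw [e1, hv]; exact dvd_zero _)
    have fv : v.IsFront := Or.inl (by rw [hv]; exact dvd_zero _)
    have fu' : ¬ u.IsCorner := fun h => not_dvd_of_lt (by omega) (by omega) h.2
    obtain ⟨us, ut⟩ := foldPlace_of_src_eq_zero (v := u) (by omega) (by omega) (by omega) true
    obtain ⟨vs, vt⟩ := foldPlace_of_src_eq_zero (v := v) (by omega) (by omega) (by omega) true
    obtain ⟨vs', vt'⟩ := foldPlace_of_src_eq_zero (v := v) (by omega) (by omega) (by omega) false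
    obtain ⟨ws, wt⟩ := foldPlace_true_of_le (v := w) (by omega) (by omega)
    obtain ⟨ws', wt'⟩ := foldPlace_false_of_le (v := w) (by omega) (by omega)
    obtain ⟨d, ds, dt⟩ := mk (v.tgt - 1) (u.tgt + n) (by omega) (by omega)
    have evv : foldPlace false v = foldPlace true v := by ext <;> omega
    have h1 : foldPlace true v ≤ foldPlace true w := ⟨by omega, by omega⟩
    have h2 : foldPlace true v ≤ foldPlace false w := ⟨by omega, by omega⟩
    have h3 : foldPlace true u ≤ d := ⟨by omega, by omega⟩
    have h4 : d ≤ foldPlace true v := ⟨by omega, by omega⟩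
    have k1 : (t ≫ R.proj true rfl) ≫ arr X h1 = 0 := by
      rw [Category.assoc, ← R.proj_zero h' (by omega) rfl rfl h1, reassoc_of% ht, zero_comp]
    have k2 : (t ≫ R.proj true rfl) ≫ arr X h2 = 0 := by
      rw [Category.assoc, R.proj_front fv rfl evv, ← R.proj_zero h' (by omega) evv rfl h2,
        reassoc_of% ht, zero_comp]
    -- a morphism killed by both components is first lifted along the one, then along the other
    obtain ⟨a, ha⟩ := hX.exactAt_of_isTriple h4 h1 ⟨by omega, by omega, by omega⟩ _ k1
    obtain ⟨b, hb⟩ := hX.exactAt_of_isTriple' h3 (h4.trans h2)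
      ⟨by omega, by omega, by push_cast; omega⟩ a (by
        rw [← arr_comp X h4 h2, reassoc_of% ha, ← Category.assoc, k2])
    obtain ⟨s, hs⟩ := R.exists_lift_front fu fu' (c := true) rfl b
    refine ⟨s, R.hom_ext_front fv (c := true) rfl ?_⟩
    rw [Category.assoc, R.proj_zero h (by omega) rfl rfl (h3.trans h4), reassoc_of% hs,
      ← arr_comp X h3 h4, reassoc_of% hb, ha]
  · intro u v w h h' H hu hu' S t ht
    obtain ⟨e1, e2, e3⟩ := H
    have l1 := v.le
    push_cast at hu' e3
    by_cases hy : v.src = 0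
    · obtain rfl : u = v := by ext <;> omega
      exact ⟨t, by rw [arr_self, Category.comp_id]⟩
    have l2 : u.src ≤ v.src := h.1
    have lu : u.level = 0 := level_eq_zero_iff.2 ⟨by omega, by push_cast; omega⟩
    have lv : v.level = 0 := level_eq_zero_iff.2 ⟨by omega, by push_cast; omega⟩
    have fu : u.IsFront := Or.inl (by rw [hu]; exact dvd_zero _)
    have fu' : ¬ u.IsCorner := fun h => not_dvd_of_lt (by omega) (by omega) h.2
    have lw : w.level = 1 := by
      rw [level_eq, show w.tgt = n + 2 by omega, Int.ediv_self (by omega),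
        Int.ediv_eq_zero_of_lt (by omega) (by omega)]
      rfl
    obtain ⟨us, ut⟩ := foldPlace_of_src_eq_zero (v := u) (by omega) (by omega) (by omega) true
    obtain ⟨us', ut'⟩ := foldPlace_of_src_eq_zero (v := u) (by omega) (by omega) (by omega) false
    obtain ⟨vs, vt⟩ := foldPlace_true_of_le (v := v) (by omega) (by omega)
    obtain ⟨vs', vt'⟩ := foldPlace_false_of_le (v := v) (by omega) (by omega)
    obtain ⟨ws, wt⟩ := foldPlace_of_tgt_eq (v := w) (by omega) (by omega) (by omega) true
    have euu : foldPlace false u = foldPlace true u := by ext <;> omega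
    have h1 : foldPlace true u ≤ foldPlace true v := ⟨by omega, by omega⟩
    have h2 : foldPlace true u ≤ foldPlace false v := ⟨by omega, by omega⟩
    have h3 : foldPlace true v ≤ foldPlace true w := ⟨by omega, by omega⟩
    have h4 : foldPlace false v ≤ foldPlace true w := ⟨by omega, by omega⟩
    -- the two components of `t` form a morphism to a weak square of `X`
    obtain ⟨a, ha, ha'⟩ := hX.exists_lift h2 h1 h4 h3 (by omega) (by omega) (by omega) (by omega)
      (t ≫ R.proj false rfl) (t ≫ R.proj true rfl) (by
        have := R.proj_one h' (by omega) rfl rfl (c := true) rfl h3 h4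
        rw [Category.assoc, Category.assoc, eq_comm, ← sub_eq_zero, ← Preadditive.comp_sub, ← this,
          reassoc_of% ht, zero_comp])
    obtain ⟨s, hs⟩ := R.exists_lift_front fu fu' (c := true) rfl a
    refine ⟨s, R.hom_ext rfl rfl ?_ ?_⟩
    · rw [Category.assoc, R.proj_zero h (by omega) rfl rfl h1, reassoc_of% hs, ha']
    · rw [Category.assoc, R.proj_zero h (by omega) euu rfl h2, R.proj_front fu euu rfl,
        reassoc_of% hs, ha]
  · intro u v w h h' H hv hu hv' S t ht
    obtain ⟨e1, e2, e3⟩ := H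
    have l1 := u.le
    push_cast at hu hv'
    by_cases hy : v.src = 0
    · have hz : IsZero (Y.obj v) := R.isZero_of_isCorner
        ⟨by rw [hy]; exact dvd_zero _, ⟨1, by omega⟩⟩
      exact ⟨0, hz.eq_of_tgt _ _⟩
    have lu : u.level = 0 := level_eq_zero_iff.2 ⟨by omega, by push_cast; omega⟩
    have lv : v.level = 1 := by
      rw [level_eq, show v.tgt = n + 2 by omega, Int.ediv_self (by omega),
        Int.ediv_eq_zero_of_lt (by omega) (by omega)]
      rfl
    have lw : w.level = 1 := by
      rw [level_eq, show w.tgt = n + 2 by omega, Int.ediv_self (by omega),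
        Int.ediv_eq_zero_of_lt (by omega) (by omega)]
      rfl
    have fu : ¬ u.IsFront := not_isFront (by omega) (by omega)
    have fv : v.IsFront := Or.inr ⟨1, by omega⟩
    obtain ⟨us, ut⟩ := foldPlace_true_of_le (v := u) (by omega) (by omega)
    obtain ⟨us', ut'⟩ := foldPlace_false_of_le (v := u) (by omega) (by omega)
    obtain ⟨vs, vt⟩ := foldPlace_of_tgt_eq (v := v) (by omega) (by omega) (by omega) true
    obtain ⟨ws, wt⟩ := foldPlace_of_tgt_eq (v := w) (by omega) (by omega) (by omega) true
    obtain ⟨d, ds, dt⟩ := mk (u.tgt + n) (u.src + 2 * n + 1) (by omega) (by omega)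
    have h1 : foldPlace true u ≤ foldPlace true v := ⟨by omega, by omega⟩
    have h2 : foldPlace false u ≤ foldPlace true v := ⟨by omega, by omega⟩
    have h3 : foldPlace true v ≤ d := ⟨by omega, by omega⟩
    have h4 : d ≤ foldPlace true w := ⟨by omega, by omega⟩
    -- At `d`, the morphism `t` comes from the right hand summand at `u`; the remaining difference
    -- vanishes at `d` and comes from the left hand summand.
    obtain ⟨b, hb⟩ := hX.exactAt_of_isTriple' (h2.trans h3) h4
      ⟨by omega, by omega, by push_cast; omega⟩ ((t ≫ R.proj true rfl) ≫ arr X h3) (by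
        rw [Category.assoc, Category.assoc, arr_comp, ← R.proj_zero h' (by omega) rfl rfl,
          reassoc_of% ht, zero_comp])
    obtain ⟨a, ha⟩ := hX.exactAt_of_isTriple h1 h3 ⟨by omega, by omega, by omega⟩
      (t ≫ R.proj true rfl - b ≫ arr X h2) (by
        rw [Preadditive.sub_comp, ← hb, Category.assoc, arr_comp, sub_self])
    obtain ⟨s, hs, hs'⟩ := R.exists_lift fu rfl rfl a (-b)
    refine ⟨s, R.hom_ext_front fv (c := true) rfl ?_⟩
    rw [Category.assoc, R.proj_one h (by omega) rfl rfl rfl h1 h2, Preadditive.comp_sub,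
      reassoc_of% hs, reassoc_of% hs', ha, Preadditive.neg_comp]
    abel

/-- A folding is periodic if its periodicity is compatible with that of `X` along all
projections. -/
theorem FoldRep.isPeriodic_toFolding {X : PerPretriangle T (2 * n + 1)}
    {Y : PerPretriangle T (n + 1)} (R : FoldRep X.obj.obj Y.obj.obj)
    (hR : ∀ (v : Strip (n + 1)) (c : Bool),
      (Y.periodicity.iso v).hom ≫ T.functor.map (R.π v c) =
        R.π (shift (n + 1) v) c ≫ arr X.obj.obj (foldPlace_shift c v).le ≫
          (X.periodicity.iso _).hom) : R.toFolding.IsPeriodic := by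
  have key : ∀ {v w : Strip (n + 1)} {a b : Strip (2 * n + 1)} {c : Bool}
      (hv : foldPlace c v = a) (hw : foldPlace c w = b) (e : shift (n + 1) v = w)
      (e' : shift (2 * n + 1) a = b), (Y.periodicity.iso v).hom ≫ T.functor.map (R.proj c hv) =
        ((entryIso Y.obj.obj e).hom ≫ R.proj c hw ≫ (entryIso X.obj.obj e').inv) ≫
          (X.periodicity.iso a).hom := by
    intro v w a b c hv hw e e'
    subst hv e e'
    change _ = (arr Y.obj.obj _ ≫ R.proj c hw ≫ arr X.obj.obj _) ≫ _
    simp only [FoldRep.proj, arr_self, Category.comp_id, Category.id_comp, Category.assoc]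
    exact hR v c
  exact ⟨fun k α => key (Fold.foldPlace_rho true k α) (Fold.foldPlace_rho true (k + 1) α)
      (shift_iter k _) (shift_iter k _),
    fun k α β h => key (Fold.foldPlace_true_pair k α β h) (Fold.foldPlace_true_pair (k + 1) α β h)
      (shift_iter k _) (shift_iter k _),
    fun k α β h => key (Fold.foldPlace_false_pair k α β h)
      (Fold.foldPlace_false_pair (k + 1) α β h) (shift_iter k _) (shift_iter k _)⟩

/-- Every periodic pretriangle has a periodic folding. -/
theorem PerPretriangle.exists_folding (X : PerPretriangle T (2 * n + 1)) :
    ∃ (Y : PerPretriangle T (n + 1)) (F : Folding X.obj.obj Y.obj.obj), F.IsPeriodic := by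
  obtain ⟨W, ⟨R⟩⟩ := exists_foldRep X.obj.obj
  obtain ⟨Q, hQ⟩ := R.exists_periodicity X.periodicity
  obtain ⟨Y, σ, hσ⟩ := Q.exists_perPretriangle (R.isPretriangle X.obj.property Q)
  refine ⟨Y, (R.ofIso σ).toFolding, (R.ofIso σ).isPeriodic_toFolding fun v c => ?_⟩
  change _ ≫ T.functor.map (σ.hom.app v ≫ R.π v c) = (σ.hom.app _ ≫ R.π _ c) ≫ _
  rw [T.functor.map_comp, ← reassoc_of% hσ v, hQ, Category.assoc]

end FoldPretriangle

end

end Heller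

theorem mainTheorem8 {C : Type u} [Category.{v} C] [Preadditive C] [WeaklyAbelian C]
    (T : CatAut C) (H : HellerTriangulation T) (n m : ℕ) (hn : 1 ≤ n) (hm : 1 ≤ m) :
    -- (1) restriction along periodic monotone maps
    (∀ (X : PerPretriangle T n) (p : PeriodicMap m n),
      IsTriangle H X → IsTriangle H (PerPretriangle.restrict p X)) ∧
    -- (2) folding
    (∀ X : PerPretriangle T (2 * n + 1), IsTriangle H X →
      (∃ (Y : PerPretriangle T (n + 1)) (F : Folding X.obj.obj Y.obj.obj), F.IsPeriodic) ∧
      (∀ (Y : PerPretriangle T (n + 1)) (F : Folding X.obj.obj Y.obj.obj),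
        F.IsPeriodic → IsTriangle H Y)) ∧
    -- (3) full additive subcategory, closed under direct summands
    (HasFiniteBiproducts (PerPretriangle T n) ∧
      HasFiniteBiproducts (Triangle H n) ∧
      (ObjectProperty.ι (fun X : PerPretriangle T n => IsTriangle H X)).Full ∧
      (∀ Z : PerPretriangle T n, IsZero Z → IsTriangle H Z) ∧
      (∀ (X Y : PerPretriangle T n) (b : BinaryBicone X Y), Nonempty b.IsBilimit →
        (IsTriangle H b.pt ↔ IsTriangle H X ∧ IsTriangle H Y))) ∧
    -- (4) periodic isomorphisms
    (∀ X Y : PerPretriangle T n, Nonempty (X ≅ Y) → IsTriangle H X → IsTriangle H Y) ∧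
    -- (5) detecting periodic isomorphisms on `{1, …, n}`
    (∀ (X Y : PerPretriangle T n) (f : X ⟶ Y),
      IsIso ((PerPretriangle.toDot T n).map f) → IsIso f) ∧
    -- (6) lifting isomorphisms from `{1, …, n}`
    (∀ (X Y : Triangle H n) (w : (Triangle.toDot H n).obj X ≅ (Triangle.toDot H n).obj Y),
      ∃ w' : X ≅ Y, (Triangle.toDot H n).mapIso w' = w) ∧
    -- (7) periodic split pretriangles
    (∀ X : PerPretriangle T n, IsSplitDiagram X.obj.obj → IsTriangle H X) :=
  ⟨fun _ p hX => hX.restrict p,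
    fun X hX => ⟨X.exists_folding, fun _ F hF => IsTriangle.of_folding F hF hX⟩,
    ⟨inferInstance, inferInstance, inferInstance, fun _ hZ => IsTriangle.of_isZero hZ,
      fun _ _ b ⟨hb⟩ => isTriangle_biproduct_iff b hb⟩,
    fun _ _ ⟨e⟩ hX => IsTriangle.of_retract e.inv e.hom e.inv_hom_id hX,
    fun _ _ f hf => PerPretriangle.isIso_of_isIso_toDot f hf,
    fun _ _ w => Triangle.exists_iso w,
    fun _ hX => IsTriangle.of_isSplitDiagram hX⟩
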